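/- Write $L^2=L^2(0,1)$ for the real Lebesgue space with norm $\|\cdot\|$ and inner product $(\cdot,\cdot)$, $H^1_0=H^1_0(0,1)$ for the closure of $C_c^\infty(0,1)$ in the norm $\|v\|_{H^1_0}=(\|v\|^2+\|v_x\|^2)^{1/2}$, and $H^{-1}$ for the dual of $H^1_0$, with $L^2\subset H^{-1}$ through $(\cdot,\cdot)$. Let $f\in L^\infty(\mathbb R;L^2)$ and consider the viscous Burgers equation with Dirichlet conditions $$u_t-u_{xx}+u\,u_x=f\quad\text{in }(0,1),\qquad u(0,t)=u(1,t)=0 .$$ For $t_0\in\mathbb R$ and $u_0\in L^2$, a weak solution starting from $u_0$ at time $t_0$ is a function $u\in C([t_0,\infty);L^2)$ with $u(t_0)=u_0$ such that, for every $T>t_0$, $u\in L^2(t_0,T;H^1_0)$ and $u_t\in L^2(t_0,T;H^{-1})$, and for almost every $t>t_0$ $$\langle u_t(t),v\rangle+(u_x(t),v_x)+(u(t)u_x(t),v)=(f(t),v)\qquad\text{for all }v\in H^1_0 .$$ An eternal solution is a function $u:\mathbb R\to H^1_0$ whose restriction to $[t_0,\infty)$ is, for every $t_0\in\mathbb R$,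 a weak solution starting from $u(t_0)$ at time $t_0$. For $X,Y\subset H^1_0$ put $\operatorname{dist}_{H^1_0}(X,Y)=\sup_{x\in X}\inf_{y\in Y}\|x-y\|_{H^1_0}$. **Theorem.** For all $t_0\in\mathbb R$ and $u_0\in L^2$ there is a unique weak solution starting from $u_0$ at time $t_0$; denote its value at time $t\ge t_0$ by $S(t,t_0)u_0$. There is an eternal solution $u\in C_b(\mathbb R;H^1_0)$ (continuous and bounded with values in $H^1_0$), and it is the only eternal solution that is bounded in $H^1_0$. For every bounded set $B\subset L^2$ and every $t\in\mathbb R$, the set $S(t,t_0)B$ is contained in $H^1_0$ for all sufficiently negative $t_0$, and $$\lim_{t_0\to-\infty}\operatorname{dist}_{H^1_0}\bigl(S(t,t_0)B,\{u(t)\}\bigr)=0 .$$ Moreover, the process $S$ has exactly one pullback attractor $\{A(t)\}_{t\in\mathbb R}$, and $A(t)=\{u(t)\}$ for every $t\in\mathbb R$. Here a pullback attractor is a family of nonempty sets $A(t)\subset H^1_0$, compact in $H^1_0$, with $S(t,s)A(s)=A(t)$ for $s\le t$, which pullback attracts bounded sets of $L^2$ (for every bounded $B\subset L^2$ and every $t$,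 $S(t,t_0)B\subset H^1_0$ for all sufficiently negative $t_0$ and $\operatorname{dist}_{H^1_0}(S(t,t_0)B,A(t))\to0$ as $t_0\to-\infty$), and which is minimal: $A(t)\subset C(t)$ for all $t$, for every family of closed sets $C(t)\subset H^1_0$ that pullback attracts bounded sets of $L^2$ in the same sense. -/

import Mathlib

noncomputable section

namespace Burgers

open MeasureTheory Filter Topology
open scoped ENNReal

/-- The real Hilbert space `L²(0,1)`. -/
abbrev L2 : Type := Lp ℝ 2 (volume.restrict (Set.Ioo (0 : ℝ) 1))

/-- Test functions: smooth real functions on `ℝ` with compact support contained in `I`. -/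
structure IsTestFunction (I : Set ℝ) (φ : ℝ → ℝ) : Prop where
  smooth : ContDiff ℝ (⊤ : ℕ∞) φ
  compact : HasCompactSupport φ
  support : tsupport φ ⊆ I

/-- The pairs `(φ, φ')` with `φ ∈ C_c^∞(0,1)`, as a subspace of the Hilbert space
`L²(0,1) × L²(0,1)`. -/
def testGraph : Submodule ℝ (WithLp 2 (L2 × L2)) where
  carrier := {p | ∃ φ : ℝ → ℝ, IsTestFunction (Set.Ioo 0 1) φ ∧
    p.fst =ᵐ[volume.restrict (Set.Ioo 0 1)] φ ∧
    p.snd =ᵐ[volume.restrict (Set.Ioo 0 1)] deriv φ}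
  zero_mem' := by
    refine ⟨fun _ => 0, ⟨contDiff_const, HasCompactSupport.zero, ?_⟩, ?_, ?_⟩
    · have h : tsupport (fun _ : ℝ => (0 : ℝ)) = ∅ := tsupport_eq_empty_iff.2 rfl
      rw [h]
      exact Set.empty_subset _
    · exact Lp.coeFn_zero ℝ 2 _
    · rw [show deriv (fun _ : ℝ => (0 : ℝ)) = 0 from by ext; simp]
      exact Lp.coeFn_zero ℝ 2 _
  add_mem' := by
    rintro p q ⟨φ, hφ, hp, hp'⟩ ⟨ψ, hψ, hq, hq'⟩
    refine ⟨φ + ψ, ⟨hφ.smooth.add hψ.smooth, hφ.compact.add hψ.compact, ?_⟩, ?_, ?_⟩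
    · exact (tsupport_add φ ψ).trans (Set.union_subset hφ.support hψ.support)
    · exact (Lp.coeFn_add p.fst q.fst).trans (hp.add hq)
    · have h : deriv (φ + ψ) = deriv φ + deriv ψ := by
        ext x
        exact deriv_add (hφ.smooth.differentiable (by simp) x)
          (hψ.smooth.differentiable (by simp) x)
      rw [h]
      exact (Lp.coeFn_add p.snd q.snd).trans (hp'.add hq')
  smul_mem' := by
    rintro c p ⟨φ, hφ, hp, hp'⟩
    refine ⟨c • φ, ⟨hφ.smooth.const_smul c, ?_, ?_⟩, ?_, ?_⟩
    · exact hφ.compact.mono (Function.support_const_smul_subset c φ)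
    · exact (closure_mono (Function.support_const_smul_subset c φ)).trans hφ.support
    · exact (Lp.coeFn_smul c p.fst).trans (hp.const_smul c)
    · have h : deriv (c • φ) = c • deriv φ := by
        ext x
        exact deriv_const_smul c (hφ.smooth.differentiable (by simp) x)
      rw [h]
      exact (Lp.coeFn_smul c p.snd).trans (hp'.const_smul c)

/-- The Sobolev space `H¹₀(0,1)`: the closure of `C_c^∞(0,1)` in the norm
`(‖u‖² + ‖u_x‖²)^(1/2)`. An element is stored as the pair `(u, u_x)` of a function and its weak
derivative. -/
abbrev H10 : Type := testGraph.topologicalClosure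

/-- The embedding `H¹₀(0,1) → L²(0,1)`. -/
def toL2 : H10 →L[ℝ] L2 :=
  (WithLp.fstL 2 ℝ L2 L2).comp testGraph.topologicalClosure.subtypeL

/-- The weak derivative `u ↦ u_x` from `H¹₀(0,1)` to `L²(0,1)`. -/
def dx : H10 →L[ℝ] L2 :=
  (WithLp.sndL 2 ℝ L2 L2).comp testGraph.topologicalClosure.subtypeL

/-- The space `H⁻¹(0,1)`, the dual of `H¹₀(0,1)`. -/
abbrev Hneg : Type := StrongDual ℝ H10

/-- The embedding `L²(0,1) → H⁻¹(0,1)`, `w ↦ (v ↦ (w, v))`. -/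
def toHneg (w : L2) : Hneg := (innerSL ℝ w).comp toL2

/-- The form `(u u_x, v) = ∫₀¹ u u_x v dx`. -/
def convection (u v : H10) : ℝ :=
  ∫ x in Set.Ioo (0 : ℝ) 1, toL2 u x * dx u x * toL2 v x

/-- `u' = u_t` on `(t₀, ∞)` in the sense of `H⁻¹`-valued distributions. -/
def HasWeakTimeDeriv (t₀ : ℝ) (u : ℝ → L2) (u' : ℝ → Hneg) : Prop :=
  ∀ φ : ℝ → ℝ, IsTestFunction (Set.Ioi t₀) φ →
    ∫ t in Set.Ioi t₀, deriv φ t • toHneg (u t) = - ∫ t in Set.Ioi t₀, φ t • u' t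

/-- `g` belongs to `L²(t₀, T; E)` for every finite `T`. -/
def LocallyL2 {E : Type*} [NormedAddCommGroup E] (t₀ : ℝ) (g : ℝ → E) : Prop :=
  ∀ T : ℝ, MemLp g 2 (volume.restrict (Set.Ioc t₀ T))

/-- `u` is a weak solution on `[t₀, ∞)` of `u_t - u_xx + u u_x = f` on `(0,1)` with homogeneous
Dirichlet conditions and `u(t₀) = u₀`: it is continuous into `L²`, it is locally square integrable
into `H¹₀` with `u_t` locally square integrable into `H⁻¹`, and for almost every `t > t₀` the
equation holds when tested with any `v ∈ H¹₀`. The values of `u` before `t₀` play no role. -/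
def IsWeakSolution (f : ℝ → L2) (t₀ : ℝ) (u₀ : L2) (u : ℝ → L2) : Prop :=
  ContinuousOn u (Set.Ici t₀) ∧ u t₀ = u₀ ∧
  ∃ (U : ℝ → H10) (u' : ℝ → Hneg),
    LocallyL2 t₀ U ∧ LocallyL2 t₀ u' ∧
    (∀ᵐ t, t₀ < t → toL2 (U t) = u t) ∧
    HasWeakTimeDeriv t₀ u u' ∧
    ∀ᵐ t, t₀ < t → ∀ v : H10,
      u' t v + inner ℝ (dx (U t)) (dx v) + convection (U t) v = inner ℝ (f t) (toL2 v)

/-- `S t t₀ u₀` is the value at time `t ≥ t₀` of the unique weak solution that starts from `u₀` at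
time `t₀`. -/
def IsSolutionProcess (f : ℝ → L2) (S : ℝ → ℝ → L2 → L2) : Prop :=
  ∀ (t₀ : ℝ) (u₀ : L2), IsWeakSolution f t₀ u₀ (fun t => S t t₀ u₀) ∧
    ∀ u : ℝ → L2, IsWeakSolution f t₀ u₀ u → ∀ t, t₀ ≤ t → u t = S t t₀ u₀

/-- `u : ℝ → H¹₀` is an eternal solution: its restriction to every half-line `[t₀, ∞)` is the weak
solution starting from `u(t₀)`. -/
def IsEternalSolution (f : ℝ → L2) (u : ℝ → H10) : Prop :=
  ∀ t₀ : ℝ, IsWeakSolution f t₀ (toL2 (u t₀)) (fun t => toL2 (u t))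

/-- The Hausdorff semidistance `sup_{a ∈ A} inf_{c ∈ C} ‖a - c‖` in `H¹₀`. -/
def semidist (A C : Set H10) : ℝ≥0∞ := ⨆ a ∈ A, Metric.infEDist a C

/-- For every bounded `B ⊆ L²` and every `t`, the set `S(t,t₀)B` is contained in `H¹₀` for all
sufficiently negative `t₀`, and `dist_{H¹₀}(S(t,t₀)B, A(t)) → 0` as `t₀ → -∞`. -/
def PullbackAttracts (S : ℝ → ℝ → L2 → L2) (A : ℝ → Set H10) : Prop :=
  ∀ B : Set L2, Bornology.IsBounded B → ∀ t : ℝ,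
    (∀ᶠ t₀ in atBot, S t t₀ '' B ⊆ Set.range toL2) ∧
    Tendsto (fun t₀ => semidist (toL2 ⁻¹' (S t t₀ '' B)) (A t)) atBot (𝓝 0)

/-- The pullback attractor of the process `S` on `L²`, with attraction in `H¹₀`: nonempty sections
compact in `H¹₀`, invariance, pullback attraction of bounded sets, and minimality among the
families with closed sections that pullback attract bounded sets. -/
structure IsPullbackAttractor (S : ℝ → ℝ → L2 → L2) (A : ℝ → Set H10) : Prop where
  nonempty : ∀ t, (A t).Nonempty
  compact : ∀ t, IsCompact (A t)
  invariant : ∀ s t, s ≤ t → S t s '' (toL2 '' A s) = toL2 '' A t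
  attracts : PullbackAttracts S A
  minimal : ∀ C : ℝ → Set H10, (∀ t, IsClosed (C t)) → PullbackAttracts S C → ∀ t, A t ⊆ C t

end Burgers

end

/-!
The problem is studied through the sine coefficients `u_k = (u, √2 sin(kπ·))`, for which the equation
becomes `u_k' = -(kπ)² u_k + b_k(u) + f_k`, where `b_k(u) = (u²/2, (√2 sin(kπ·))')` is the coefficient of
the nonlinearity in conservation form and is locally Lipschitz on `L²(0,1)` with a constant growing
like `k`. A weak solution is the same as a mild solution, that is a continuous curve in `L²` whose
coefficients satisfy the variation of constants formula (`IsMild.isWeakSolution`,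
`IsWeakSolution.isMild`). Since `∑ (k / k²)² < ∞`, the Duhamel operator is a contraction in a norm with
an exponential weight in time. This gives uniqueness and continuous dependence
(`exists_norm_sub_le`), and global solutions of the equation in which `u` is truncated radially in the
nonlinearity. The truncated nonlinearity still does no work, so the energy estimate
`IsMild.norm_sq_le` shows that the truncation is never active when its radius is large
(`exists_isMild`).

Solutions are smoothed: `b_k(u)` is a convolution of coefficients, and decay of the coefficients
improves through the exponents `0, 1, 3/2, 2` (`exists_mem_decaySet`). With the energy estimate, all
solutions that start in a bounded set of `L²` end up in one set `decaySet D` of functions with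
`|u_k| ≤ D / k²` (`exists_absorbing`). Such a set is bounded in `H¹₀`, and on it closeness of the
coefficients implies closeness in `H¹₀` (`exists_norm_sub_le_of_sc`).

The force may be large, so the energy method alone does not make two solutions `u, v` approach each
other. Their difference `w` satisfies the linear equation `w_t = w_xx - (a w)_x` with the bounded
coefficient `a = (u + v)/2`, without force. If `|a| ≤ M`, the weighted norm `∫ |w| (Q - e^{(M+1)x}) dx`
decreases exponentially: the diffusion term acts on the weight, and its second derivative
`-(M+1)² e^{(M+1)x}` dominates `M` times its first derivative, which is what the transport term
produces. The argument uses a smooth approximation of the absolute value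
(`exists_dissipation`, `frequently_slope_lt`) and yields exponential decay of `w` in `L¹(0,1)`
(`exists_integral_abs_sub_le`). As `L¹` controls the sine coefficients, solutions from a bounded set
approach each other in `H¹₀`, uniformly in the initial time (`exists_norm_lift_sub_le`).

The solutions that start from `0` at time `-n` therefore form a Cauchy sequence, whose limit is a
bounded eternal solution (`exists_eternal`). It attracts all bounded sets
(`pullbackAttracts_singleton`), every bounded eternal solution equals it (`eq_of_isBounded_range`), and
every closed family that attracts bounded sets contains it (`mem_of_pullbackAttracts`). The last fact
and minimality identify the pullback attractor (`isPullbackAttractor_iff`).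
-/

noncomputable section

namespace Burgers

open MeasureTheory Filter Topology
open scoped ENNReal BoundedContinuousFunction

/-! ### The sine basis of `L²(0,1)` -/

/-- Lebesgue measure on `(0,1)`. -/
abbrev μI : Measure ℝ := volume.restrict (Set.Ioo (0 : ℝ) 1)

theorem inner_eq_integral (u v : L2) : inner ℝ u v = ∫ x, u x * v x ∂μI := by
  rw [L2.inner_def]
  exact integral_congr_ae (Eventually.of_forall fun x => by simp [mul_comm])

theorem memLp_of_bound {g : ℝ → ℝ} (hg : AEStronglyMeasurable g μI) (C : ℝ)
    (hC : ∀ x ∈ Set.Ioo (0 : ℝ) 1, |g x| ≤ C) (p : ℝ≥0∞) : MemLp g p μI :=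
  MemLp.of_bound hg C ((ae_restrict_iff' measurableSet_Ioo).2 (Eventually.of_forall hC))

theorem Continuous.memLp_unitInterval {g : ℝ → ℝ} (hg : Continuous g) (p : ℝ≥0∞) : MemLp g p μI := by
  obtain ⟨C, hC⟩ := isCompact_Icc.exists_bound_of_continuousOn (s := Set.Icc (0 : ℝ) 1)
    hg.continuousOn
  exact memLp_of_bound hg.aestronglyMeasurable C (fun x hx => hC x (Set.Ioo_subset_Icc_self hx)) p

theorem Continuous.integrable_unitInterval {g : ℝ → ℝ} (hg : Continuous g) : Integrable g μI :=
  (Continuous.memLp_unitInterval hg 1).integrable le_rfl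

/-- The class in `L²(0,1)` of a continuous function. -/
def ofCont (g : C(ℝ, ℝ)) : L2 := (Continuous.memLp_unitInterval g.continuous 2).toLp g

theorem coeFn_ofCont (g : C(ℝ, ℝ)) : ofCont g =ᵐ[μI] g := MemLp.coeFn_toLp _

theorem L2.integrable_mul (u v : L2) : Integrable (fun x => u x * v x) μI :=
  (Lp.memLp u).integrable_mul (Lp.memLp v)

theorem L2.integrable (u : L2) : Integrable (fun x => u x) μI :=
  (Lp.memLp u).integrable (by norm_num)

theorem integrable_continuous_mul {f g : ℝ → ℝ} (hf : Integrable f μI) (hg : Continuous g) :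
    Integrable (fun x => g x * f x) μI := by
  obtain ⟨C, hC⟩ := isCompact_Icc.exists_bound_of_continuousOn (s := Set.Icc (0 : ℝ) 1)
    hg.continuousOn
  exact hf.bdd_mul (c := C) hg.aestronglyMeasurable ((ae_restrict_iff' measurableSet_Ioo).2
    (Eventually.of_forall fun x hx => hC x (Set.Ioo_subset_Icc_self hx)))

theorem L2.integrable_mul_bdd (u v : L2) {g : ℝ → ℝ} (hg : Continuous g) :
    Integrable (fun x => u x * v x * g x) μI := by
  simpa only [mul_comm] using integrable_continuous_mul (L2.integrable_mul u v) hg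

theorem L2.norm_sq (u : L2) : ‖u‖ ^ 2 = ∫ x, u x ^ 2 ∂μI := by
  rw [← real_inner_self_eq_norm_sq, inner_eq_integral]
  simp only [sq]

theorem inner_ofCont (g : C(ℝ, ℝ)) (u : L2) :
    inner ℝ (ofCont g) u = ∫ x, g x * u x ∂μI := by
  rw [inner_eq_integral]
  refine integral_congr_ae ?_
  filter_upwards [coeFn_ofCont g] with x hx
  rw [hx]

/-- The sine function `√2 sin(kπx)`. -/
def sinFun (k : ℤ) : C(ℝ, ℝ) := ⟨fun x => √2 * Real.sin (k * Real.pi * x), by fun_prop⟩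

/-- The function `√2 sin(kπx)` as an element of `L²(0,1)`. For `k = 1, 2, …` these form an
orthonormal basis; the index runs over `ℤ` so that product formulas need no case distinction. -/
def sn (k : ℤ) : L2 := ofCont (sinFun k)

/-- The sine coefficient `(u, √2 sin(kπ·))`. -/
def sc (u : L2) (k : ℤ) : ℝ := inner ℝ (sn k) u

/-- The eigenvalue `(kπ)²` of `-d²/dx²` with Dirichlet conditions. -/
def lam (k : ℤ) : ℝ := (k * Real.pi) ^ 2

theorem lam_nonneg (k : ℤ) : 0 ≤ lam k := sq_nonneg _

theorem sc_eq_integral (u : L2) (k : ℤ) :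
    sc u k = ∫ x, √2 * Real.sin (k * Real.pi * x) * u x ∂μI := inner_ofCont _ _

theorem sc_zero_right (u : L2) : sc u 0 = 0 := by simp [sc_eq_integral]

theorem sc_neg_right (u : L2) (k : ℤ) : sc u (-k) = - sc u k := by
  simp only [sc_eq_integral, Int.cast_neg, neg_mul, Real.sin_neg, mul_neg, integral_neg]

theorem sc_sub (u v : L2) (k : ℤ) : sc (u - v) k = sc u k - sc v k := inner_sub_right _ _ _
theorem sc_smul (c : ℝ) (u : L2) (k : ℤ) : sc (c • u) k = c * sc u k := inner_smul_right _ _ _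
theorem sc_zero (k : ℤ) : sc 0 k = 0 := inner_zero_right _

theorem continuous_sc (k : ℤ) : Continuous fun u => sc u k := by unfold sc; fun_prop

theorem integral_unitInterval (g : ℝ → ℝ) : ∫ x, g x ∂μI = ∫ x in (0 : ℝ)..1, g x := by
  rw [intervalIntegral.integral_of_le zero_le_one, integral_Ioc_eq_integral_Ioo]

theorem integral_cos_int (m : ℤ) :
    ∫ x, Real.cos (m * Real.pi * x) ∂μI = if m = 0 then 1 else 0 := by
  rw [integral_unitInterval]
  split_ifs with h
  · simp [h]
  · have h0 : (m : ℝ) * Real.pi ≠ 0 := mul_ne_zero (by exact_mod_cast h) Real.pi_ne_zero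
    rw [intervalIntegral.integral_comp_mul_left (fun y => Real.cos y) h0]
    simp [integral_cos, Real.sin_int_mul_pi]

theorem inner_sn (j k : ℤ) : inner ℝ (sn j) (sn k) =
    (if j - k = 0 then 1 else 0) - (if j + k = 0 then (1 : ℝ) else 0) := by
  rw [sn, inner_ofCont, ← integral_cos_int, ← integral_cos_int, ← integral_sub]
  · refine integral_congr_ae ?_
    filter_upwards [coeFn_ofCont (sinFun k)] with x hx
    rw [sn, hx]
    have h2 : √2 * √2 = (2 : ℝ) := Real.mul_self_sqrt (by norm_num)
    simp only [sinFun, ContinuousMap.coe_mk, Int.cast_sub, Int.cast_add, sub_mul, add_mul,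
      Real.cos_sub, Real.cos_add]
    linear_combination (Real.sin (j * Real.pi * x) * Real.sin (k * Real.pi * x)) * h2
  · exact Continuous.integrable_unitInterval (by fun_prop)
  · exact Continuous.integrable_unitInterval (by fun_prop)

theorem orthonormal_sn : Orthonormal ℝ fun k : ℕ => sn (k + 1) := by
  rw [orthonormal_iff_ite]
  intro i j
  rw [inner_sn]
  split_ifs <;> first | omega | simp

/-- Since `sin(kπx)cos(πx) = (sin((k+1)πx) + sin((k-1)πx))/2`, orthogonality to all sines is
stable under multiplication by `cos(πx)`. -/
theorem integral_sin_mul_cos_pow (u : L2) (hu : ∀ k : ℤ, sc u k = 0) (n : ℕ) (k : ℤ) :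
    ∫ x, Real.sin (k * Real.pi * x) * Real.cos (Real.pi * x) ^ n * u x ∂μI = 0 := by
  induction n generalizing k with
  | zero =>
    have h := hu k
    rw [sc_eq_integral] at h
    simp only [mul_assoc, integral_const_mul] at h
    simpa [mul_assoc] using h
  | succ n ih =>
    have hi : ∀ k : ℤ, Integrable (fun x => Real.sin (k * Real.pi * x) *
        Real.cos (Real.pi * x) ^ n * u x) μI := fun k =>
      integrable_continuous_mul (L2.integrable u) (by fun_prop)
    have h := integral_add (hi (k + 1)) (hi (k - 1))
    rw [ih, ih] at h
    have h2 : ∀ x, Real.sin (k * Real.pi * x) * Real.cos (Real.pi * x) ^ (n + 1) * u x =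
        (1 / 2) * (Real.sin ((k + 1 : ℤ) * Real.pi * x) * Real.cos (Real.pi * x) ^ n * u x +
          Real.sin ((k - 1 : ℤ) * Real.pi * x) * Real.cos (Real.pi * x) ^ n * u x) := by
      intro x
      simp only [Int.cast_sub, Int.cast_add, Int.cast_one, sub_mul, add_mul, one_mul,
        Real.sin_sub, Real.sin_add]
      ring
    simp only [h2, integral_const_mul, h]
    norm_num

theorem integral_sin_mul_polynomial_cos (u : L2) (hu : ∀ k : ℤ, sc u k = 0)
    (p : Polynomial ℝ) :
    ∫ x, Real.sin (Real.pi * x) * p.eval (Real.cos (Real.pi * x)) * u x ∂μI = 0 := by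
  have hi : ∀ p : Polynomial ℝ, Integrable
      (fun x => Real.sin (Real.pi * x) * p.eval (Real.cos (Real.pi * x)) * u x) μI := fun p =>
    integrable_continuous_mul (L2.integrable u) (by fun_prop)
  induction p using Polynomial.induction_on' with
  | add p q hp hq =>
    simp only [Polynomial.eval_add, mul_add, add_mul]
    rw [integral_add (hi p) (hi q), hp, hq, add_zero]
  | monomial n a =>
    have h := integral_sin_mul_cos_pow u hu n 1
    simp only [Int.cast_one, one_mul] at h
    have h2 : ∀ x, Real.sin (Real.pi * x) * (Polynomial.monomial n a).eval
        (Real.cos (Real.pi * x)) * u x =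
        a * (Real.sin (Real.pi * x) * Real.cos (Real.pi * x) ^ n * u x) := fun x => by
      rw [Polynomial.eval_monomial]; ring
    simp only [h2, integral_const_mul, h, mul_zero]

/-- The sines are complete: by Weierstrass, polynomials in `cos(πx)` are uniformly dense in the
continuous functions on `[0,1]`. -/
theorem eq_zero_of_sc_eq_zero (u : L2) (hu : ∀ k : ℤ, sc u k = 0) : u = 0 := by
  have key : ∀ h : ℝ → ℝ, Continuous h →
      ∫ x, h x * (Real.sin (Real.pi * x) * u x) ∂μI = 0 := by
    intro h hh
    have hbd : Integrable (fun x => Real.sin (Real.pi * x) * u x) μI :=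
      integrable_continuous_mul (L2.integrable u) (by fun_prop)
    set M := ∫ x, |Real.sin (Real.pi * x) * u x| ∂μI with hM
    have hM0 : 0 ≤ M := integral_nonneg fun x => abs_nonneg _
    have hle : ∀ ε > 0, |∫ x, h x * (Real.sin (Real.pi * x) * u x) ∂μI| ≤ ε * M := by
      intro ε hε
      obtain ⟨p, hp⟩ := exists_polynomial_near_of_continuousOn (-1) 1
        (fun y => h (Real.arccos y / Real.pi))
        (by have := Real.continuous_arccos; fun_prop) ε hε
      have hi1 := integrable_continuous_mul hbd hh
      have hi2 := integrable_continuous_mul hbd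
        (g := fun x => p.eval (Real.cos (Real.pi * x))) (by fun_prop)
      have h0 : ∫ x, p.eval (Real.cos (Real.pi * x)) * (Real.sin (Real.pi * x) * u x) ∂μI = 0 := by
        refine Eq.trans ?_ (integral_sin_mul_polynomial_cos u hu p)
        exact integral_congr_ae (Eventually.of_forall fun x => by ring)
      have h1 := integral_sub hi1 hi2
      rw [h0, sub_zero] at h1
      rw [← h1, hM, ← integral_const_mul, ← Real.norm_eq_abs]
      refine norm_integral_le_of_norm_le (hbd.abs.const_mul ε) ?_
      refine (ae_restrict_iff' measurableSet_Ioo).2 (Eventually.of_forall fun x hx => ?_)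
      rw [← sub_mul, norm_mul, Real.norm_eq_abs, Real.norm_eq_abs]
      refine mul_le_mul_of_nonneg_right ?_ (abs_nonneg _)
      have := hp (Real.cos (Real.pi * x)) ⟨Real.neg_one_le_cos _, Real.cos_le_one _⟩
      rw [Real.arccos_cos (by have := Real.pi_pos; nlinarith [hx.1])
        (by have := Real.pi_pos; nlinarith [hx.2]),
        mul_div_cancel_left₀ _ Real.pi_ne_zero, abs_sub_comm] at this
      exact this.le
    by_contra hne
    have hpos := abs_pos.2 hne
    have := hle (|∫ x, h x * (Real.sin (Real.pi * x) * u x) ∂μI| / (2 * (M + 1)))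
      (by positivity)
    rw [div_mul_eq_mul_div, le_div_iff₀ (by positivity)] at this
    nlinarith
  have hloc : LocallyIntegrableOn (fun x => Real.sin (Real.pi * x) * u x) (Set.Ioo 0 1) := by
    apply IntegrableOn.locallyIntegrableOn
    exact integrable_continuous_mul (L2.integrable u) (by fun_prop)
  have h1 := isOpen_Ioo.ae_eq_zero_of_integral_contDiff_smul_eq_zero hloc (fun g hg _ hgs => by
    refine Eq.trans ?_ (key g hg.continuous)
    simp only [smul_eq_mul]
    refine (setIntegral_eq_integral_of_forall_compl_eq_zero fun x hx => ?_).symm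
    rw [image_eq_zero_of_notMem_tsupport (fun h => hx (hgs h)), zero_mul])
  rw [Lp.eq_zero_iff_ae_eq_zero]
  refine (ae_restrict_iff' measurableSet_Ioo).2 ?_
  filter_upwards [h1] with x hx hxI
  refine (mul_eq_zero.1 (hx hxI)).resolve_left (Real.sin_pos_of_pos_of_lt_pi ?_ ?_).ne'
  · exact mul_pos Real.pi_pos hxI.1
  · nlinarith [Real.pi_pos, hxI.2]

theorem span_sn_orthogonal :
    (Submodule.span ℝ (Set.range fun k : ℕ => sn (k + 1)))ᗮ = ⊥ := by
  rw [Submodule.eq_bot_iff]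
  intro u hu
  rw [Submodule.mem_orthogonal] at hu
  have h1 : ∀ k : ℕ, sc u (k + 1) = 0 := fun k => hu _ (Submodule.subset_span ⟨k, rfl⟩)
  refine eq_zero_of_sc_eq_zero u fun k => ?_
  rcases lt_trichotomy k 0 with h | h | h
  · obtain ⟨n, hn⟩ := Int.eq_ofNat_of_zero_le (show 0 ≤ -k - 1 by omega)
    rw [show k = -((n : ℤ) + 1) by omega, sc_neg_right, h1, neg_zero]
  · rw [h, sc_zero_right]
  · obtain ⟨n, hn⟩ := Int.eq_ofNat_of_zero_le (show 0 ≤ k - 1 by omega)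
    rw [show k = (n : ℤ) + 1 by omega, h1]

/-- The orthonormal basis `√2 sin((k+1)πx)`, `k : ℕ`, of `L²(0,1)`. -/
def sineBasis : HilbertBasis ℕ ℝ L2 :=
  HilbertBasis.mkOfOrthogonalEqBot orthonormal_sn span_sn_orthogonal

theorem sineBasis_apply (k : ℕ) : sineBasis k = sn (k + 1) := by simp [sineBasis]

theorem hasSum_nat_of_succ {E : Type*} [NormedAddCommGroup E] {a : ℕ → E} {s : E} (h0 : a 0 = 0)
    (h : HasSum (fun k => a (k + 1)) s) : HasSum a s := by
  have := (hasSum_nat_add_iff (f := a) 1).1 h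
  simpa [h0] using this

/-- Parseval's identity. The term `k = 0` vanishes. -/
theorem hasSum_sc_mul (u v : L2) : HasSum (fun k : ℕ => sc u k * sc v k) (inner ℝ u v) := by
  refine hasSum_nat_of_succ (by simp [sc_zero_right]) ?_
  have := sineBasis.hasSum_inner_mul_inner u v
  simp only [sineBasis_apply] at this
  refine this.congr_fun fun k => ?_
  rw [sc, sc, real_inner_comm]
  push_cast
  rfl

theorem hasSum_sc_sq (u : L2) : HasSum (fun k : ℕ => sc u k ^ 2) (‖u‖ ^ 2) := by
  have := hasSum_sc_mul u u
  rw [real_inner_self_eq_norm_sq] at this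
  simpa [sq] using this

theorem hasSum_sn (u : L2) : HasSum (fun k : ℕ => sc u k • sn k) u := by
  refine hasSum_nat_of_succ (by simp [sc_zero_right]) ?_
  have := sineBasis.hasSum_repr u
  simp only [sineBasis_apply, HilbertBasis.repr_apply_apply] at this
  simpa [sc] using this

theorem L2.ext_sc {u v : L2} (h : ∀ k : ℕ, sc u k = sc v k) : u = v := by
  refine (hasSum_sn u).unique ?_
  simp only [h]
  exact hasSum_sn v

/-- Riesz–Fischer. -/
theorem exists_sc_eq (a : ℕ → ℝ) (h0 : a 0 = 0) (ha : Summable fun k => a k ^ 2) :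
    ∃ u : L2, ∀ k : ℕ, sc u k = a k := by
  have hm : Memℓp (fun k => a (k + 1)) 2 := by
    refine memℓp_gen ?_
    have := (summable_nat_add_iff 1).2 ha
    simpa using this
  refine ⟨sineBasis.repr.symm ⟨_, hm⟩, fun k => ?_⟩
  cases k with
  | zero => simp [h0, sc_zero_right]
  | succ k =>
    rw [sc]
    have := sineBasis.repr_apply_apply (sineBasis.repr.symm ⟨_, hm⟩) k
    rw [sineBasis_apply] at this
    push_cast
    rw [← this]
    simp

theorem abs_sc_le (u : L2) (k : ℤ) : |sc u k| ≤ ‖u‖ := by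
  have h : ∀ k : ℕ, |sc u k| ≤ ‖u‖ := fun k => by
    refine abs_le_of_sq_le_sq ?_ (norm_nonneg _)
    exact le_hasSum (hasSum_sc_sq u) k fun j _ => sq_nonneg _
  rcases Int.eq_nat_or_neg k with ⟨n, rfl | rfl⟩
  · exact h n
  · rw [sc_neg_right, abs_neg]; exact h n

/-! ### The nonlinear term in sine coefficients -/

/-- The coefficient `(u²/2, (√2 sin(kπ·))')` of the Burgers nonlinearity `-u u_x`. It makes sense
for every `u ∈ L²(0,1)`. -/
def bf (u : L2) (k : ℤ) : ℝ :=
  (k * Real.pi / √2) * ∫ x, u x * u x * Real.cos (k * Real.pi * x) ∂μI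

theorem bf_zero_right (u : L2) : bf u 0 = 0 := by simp [bf]

theorem abs_bf_sub_le (u v : L2) (k : ℕ) :
    |bf u k - bf v k| ≤ k * Real.pi * (‖u + v‖ * ‖u - v‖) := by
  rw [bf, bf, ← mul_sub, abs_mul]
  have hk : |((k : ℤ) : ℝ) * Real.pi / √2| ≤ k * Real.pi := by
    rw [abs_of_nonneg (by positivity)]
    refine div_le_self (by positivity) ?_
    rw [Real.one_le_sqrt]; norm_num
  refine mul_le_mul hk ?_ (abs_nonneg _) (by positivity)
  rw [← integral_sub (L2.integrable_mul_bdd u u (by fun_prop))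
    (L2.integrable_mul_bdd v v (by fun_prop))]
  have h1 : |∫ x, (u x * u x * Real.cos (((k : ℤ) : ℝ) * Real.pi * x) -
      v x * v x * Real.cos (((k : ℤ) : ℝ) * Real.pi * x)) ∂μI| ≤
      ∫ x, |(u + v) x| * |(u - v) x| ∂μI := by
    rw [← Real.norm_eq_abs]
    refine norm_integral_le_of_norm_le ?_ ?_
    · have := (L2.integrable_mul (u + v) (u - v)).abs
      simpa only [abs_mul] using this
    · filter_upwards [Lp.coeFn_add u v, Lp.coeFn_sub u v] with x h1 h2
      rw [h1, h2, ← sub_mul, norm_mul, Pi.add_apply, Pi.sub_apply, ← abs_mul,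
        show (u x + v x) * (u x - v x) = u x * u x - v x * v x by ring]
      exact mul_le_of_le_one_right (abs_nonneg _) (Real.abs_cos_le_one _)
  refine h1.trans ?_
  have h2 : ∫ x, |(u + v) x| * |(u - v) x| ∂μI = inner ℝ |u + v| |u - v| := by
    rw [inner_eq_integral]
    refine integral_congr_ae ?_
    filter_upwards [Lp.coeFn_abs (u + v), Lp.coeFn_abs (u - v)] with x h1 h2
    rw [h1, h2]
  rw [h2]
  refine (real_inner_le_norm _ _).trans (le_of_eq ?_)
  rw [norm_abs_eq_norm, norm_abs_eq_norm]

theorem bf_zero (k : ℤ) : bf 0 k = 0 := by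
  rw [bf]
  have : ∫ x, (0 : L2) x * (0 : L2) x * Real.cos (k * Real.pi * x) ∂μI = 0 := by
    refine integral_eq_zero_of_ae ?_
    filter_upwards [Lp.coeFn_zero ℝ 2 μI] with x hx
    rw [hx]; simp
  rw [this, mul_zero]

theorem abs_bf_le (u : L2) (k : ℕ) : |bf u k| ≤ k * Real.pi * ‖u‖ ^ 2 := by
  have := abs_bf_sub_le u 0 k
  simpa [bf_zero, sq] using this

theorem bf_smul (c : ℝ) (u : L2) (k : ℤ) : bf (c • u) k = c ^ 2 * bf u k := by
  rw [bf, bf, mul_left_comm]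
  congr 1
  rw [← integral_const_mul]
  refine integral_congr_ae ?_
  filter_upwards [Lp.coeFn_smul c u] with x hx
  rw [hx, Pi.smul_apply, smul_eq_mul]; ring

theorem continuous_bf (k : ℕ) : Continuous fun u => bf u k := by
  rw [continuous_iff_continuousAt]
  intro u
  rw [ContinuousAt, tendsto_iff_norm_sub_tendsto_zero]
  refine squeeze_zero (fun _ => norm_nonneg _) (fun v => abs_bf_sub_le v u k) ?_
  have : Continuous fun v : L2 => k * Real.pi * (‖v + u‖ * ‖v - u‖) := by fun_prop
  simpa using this.tendsto u

/-- Convolution formula: `sin(jπx)cos(kπx) = (sin((j+k)πx) + sin((j-k)πx))/2` and Parseval. -/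
theorem hasSum_bf (u : L2) (k : ℤ) :
    HasSum (fun j : ℕ => (k * Real.pi / √2) * (sc u j * ((sc u (j + k) + sc u (j - k)) / 2)))
      (bf u k) := by
  refine HasSum.mul_left _ ?_
  have hmem : MemLp (fun x => u x * Real.cos (k * Real.pi * x)) 2 μI := by
    refine (Lp.memLp u).mono ((Lp.aestronglyMeasurable u).mul (by fun_prop))
      (Eventually.of_forall fun x => ?_)
    rw [norm_mul]
    exact mul_le_of_le_one_right (norm_nonneg _) (Real.abs_cos_le_one _)
  have h := hasSum_sc_mul u (hmem.toLp _)
  rw [inner_eq_integral] at h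
  have hv : ∫ x, u x * (hmem.toLp _ : L2) x ∂μI =
      ∫ x, u x * u x * Real.cos (k * Real.pi * x) ∂μI := by
    refine integral_congr_ae ?_
    filter_upwards [hmem.coeFn_toLp] with x hx
    rw [hx]; ring
  rw [hv] at h
  refine h.congr_fun fun j => ?_
  congr 1
  rw [sc_eq_integral, sc_eq_integral, sc_eq_integral, ← integral_add, ← integral_div]
  · refine integral_congr_ae ?_
    filter_upwards [hmem.coeFn_toLp] with x hx
    rw [hx]
    simp only [Int.cast_sub, Int.cast_add, sub_mul, add_mul, Real.sin_sub, Real.sin_add]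
    ring
  · exact integrable_continuous_mul (L2.integrable u) (by fun_prop)
  · exact integrable_continuous_mul (L2.integrable u) (by fun_prop)

/-- The larger of `a` and `b` is at least `k / 2`, so the factor `(k / 2)^(-β)` can be split off and
a power summable over the remaining variable is left. -/
theorem rpow_neg_mul_rpow_neg_le {a b k α β : ℝ} (ha : 0 < a) (hb : 0 < b) (hk : 0 < k)
    (hab : k ≤ a + b) (hβ : 0 ≤ β) (hβα : β ≤ α) :
    a ^ (-α) * b ^ (-α) ≤ (k / 2) ^ (-β) * (a ^ (-(2 * α - β)) + b ^ (-(2 * α - β))) := by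
  have key : ∀ x y : ℝ, 0 < x → 0 < y → x ≤ y → k ≤ x + y →
      x ^ (-α) * y ^ (-α) ≤ (k / 2) ^ (-β) * x ^ (-(2 * α - β)) := by
    intro x y hx hy hxy hk'
    have h1 : y ^ (-β) ≤ (k / 2) ^ (-β) :=
      Real.rpow_le_rpow_of_nonpos (by positivity) (by linarith) (by linarith)
    have h2 : y ^ (-(α - β)) ≤ x ^ (-(α - β)) :=
      Real.rpow_le_rpow_of_nonpos hx hxy (by linarith)
    have h3 : y ^ (-α) = y ^ (-β) * y ^ (-(α - β)) := by
      rw [← Real.rpow_add hy]; ring_nf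
    have h4 : x ^ (-(2 * α - β)) = x ^ (-(α - β)) * x ^ (-α) := by
      rw [← Real.rpow_add hx]; ring_nf
    rw [h3, h4, mul_comm, ← mul_assoc]
    gcongr
  have p1 : 0 ≤ (k / 2) ^ (-β) := by positivity
  have p2 : 0 ≤ a ^ (-(2 * α - β)) := by positivity
  have p3 : 0 ≤ b ^ (-(2 * α - β)) := by positivity
  rcases le_total a b with h | h
  · exact (key a b ha hb h hab).trans (by gcongr; linarith)
  · rw [mul_comm]
    exact (key b a hb ha h (by linarith)).trans (by gcongr; linarith)

/-- Decay of the sine coefficients of `u` gives decay of the coefficients of the nonlinearity. -/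
theorem exists_abs_bf_le_of_decay {α β : ℝ} (hβ : 0 ≤ β) (hβα : β ≤ α) (hα : 1 < 2 * α - β) :
    ∃ M : ℝ, 0 ≤ M ∧ ∀ (u : L2) (C : ℝ), (∀ j : ℕ, |sc u j| ≤ C * (j : ℝ) ^ (-α)) →
      ∀ k : ℕ, |bf u k| ≤ M * C ^ 2 * (k : ℝ) ^ (1 - β) := by
  set g : ℤ → ℝ := fun m => |(m : ℝ)| ^ (-(2 * α - β)) with hg
  have hgs : Summable g := Real.summable_abs_int_rpow hα
  have hg0 : ∀ m, 0 ≤ g m := fun m => by positivity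
  have hα0 : 0 < α := by linarith
  refine ⟨2 * Real.pi * 2 ^ β * ∑' m, g m,
    mul_nonneg (by positivity) (tsum_nonneg hg0), fun u C hu k => ?_⟩
  have hC : 0 ≤ C := by
    have := (abs_nonneg _).trans (hu 1)
    simpa using this
  rcases Nat.eq_zero_or_pos k with rfl | hk
  · have : 0 ≤ ∑' m, g m := tsum_nonneg hg0
    simp only [Nat.cast_zero, bf_zero_right, abs_zero]
    positivity
  have hk' : (0 : ℝ) < k := by exact_mod_cast hk
  have huz : ∀ m : ℤ, |sc u m| ≤ C * |(m : ℝ)| ^ (-α) := fun m => by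
    rcases Int.eq_nat_or_neg m with ⟨n, rfl | rfl⟩
    · simpa using hu n
    · simpa [sc_neg_right] using hu n
  have hprod : ∀ (j : ℕ) (m : ℤ), (k : ℝ) ≤ |(j : ℝ)| + |(m : ℝ)| →
      |sc u j * sc u m| ≤ C ^ 2 * (k / 2) ^ (-β) * (g j + g m) := by
    intro j m hjm
    have hr : 0 ≤ C ^ 2 * ((k : ℝ) / 2) ^ (-β) * (g j + g m) :=
      mul_nonneg (by positivity) (add_nonneg (hg0 _) (hg0 _))
    rcases Nat.eq_zero_or_pos j with rfl | hj
    · simpa [sc_zero_right] using hr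
    rcases eq_or_ne m 0 with rfl | hm
    · simpa [sc_zero_right] using hr
    have hj' : (0 : ℝ) < |((j : ℤ) : ℝ)| := by simpa using hj
    have hm' : (0 : ℝ) < |(m : ℝ)| := by simpa using hm
    rw [abs_mul]
    calc |sc u j| * |sc u m| ≤ (C * |((j : ℤ) : ℝ)| ^ (-α)) * (C * |(m : ℝ)| ^ (-α)) :=
          mul_le_mul (huz j) (huz m) (abs_nonneg _) (by positivity)
      _ = C ^ 2 * (|((j : ℤ) : ℝ)| ^ (-α) * |(m : ℝ)| ^ (-α)) := by ring
      _ ≤ C ^ 2 * ((k / 2) ^ (-β) * (g j + g m)) := by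
          refine mul_le_mul_of_nonneg_left ?_ (by positivity)
          exact rpow_neg_mul_rpow_neg_le hj' hm' hk' (by simpa using hjm) hβ hβα
      _ = _ := by ring
  -- By `hasSum_bf`, `bf u k` is a convolution of the coefficients at frequencies `j` and `j ± k`.
  set A : ℝ := k * Real.pi * (C ^ 2 * ((k : ℝ) / 2) ^ (-β)) with hA
  have hA0 : 0 ≤ A := by positivity
  have i1 : Function.Injective (fun j : ℕ => (j : ℤ)) := Nat.cast_injective
  have i2 : Function.Injective (fun j : ℕ => (j : ℤ) + k) := fun a b h => by
    simpa using h
  have i3 : Function.Injective (fun j : ℕ => (j : ℤ) - k) := fun a b h => by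
    simpa using h
  have hs : HasSum (fun j : ℕ => A * ((g j + g (j + k)) / 2 + (g j + g (j - k)) / 2))
      (A * ((∑' j : ℕ, g j + ∑' j : ℕ, g (j + k)) / 2 +
        (∑' j : ℕ, g j + ∑' j : ℕ, g (j - k)) / 2)) :=
    ((((hgs.comp_injective i1).hasSum.add (hgs.comp_injective i2).hasSum).div_const 2).add
      (((hgs.comp_injective i1).hasSum.add (hgs.comp_injective i3).hasSum).div_const 2)).mul_left A
  have hb := (hasSum_bf u k).norm_le_of_bounded hs (fun j => by
    have e1 := hprod j (j + k) (by
      push_cast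
      rw [abs_of_nonneg (by positivity), abs_of_nonneg (by positivity)]; linarith [hk'.le,
        (Nat.cast_nonneg j : (0 : ℝ) ≤ j)])
    have e2 := hprod j (j - k) (by
      push_cast
      have h1 := neg_abs_le ((j : ℝ) - k)
      rw [abs_of_nonneg (Nat.cast_nonneg j : (0 : ℝ) ≤ j)]; linarith)
    have hk2 : |((k : ℤ) : ℝ) * Real.pi / √2| ≤ k * Real.pi := by
      rw [abs_of_nonneg (by positivity)]
      refine div_le_self (by positivity) ?_
      rw [Real.one_le_sqrt]; norm_num
    rw [norm_mul, Real.norm_eq_abs, hA, mul_assoc]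
    refine mul_le_mul hk2 ?_ (norm_nonneg _) (by positivity)
    rw [show sc u j * ((sc u (j + k) + sc u (j - k)) / 2) =
      (sc u j * sc u (j + k)) / 2 + (sc u j * sc u (j - k)) / 2 by ring]
    refine (norm_add_le _ _).trans ?_
    rw [norm_div, norm_div, Real.norm_eq_abs, Real.norm_eq_abs, Real.norm_eq_abs,
      abs_of_pos (two_pos : (0 : ℝ) < 2), mul_add]
    refine add_le_add ?_ ?_
    · rw [← mul_div_assoc]; exact div_le_div_of_nonneg_right e1 two_pos.le
    · rw [← mul_div_assoc]; exact div_le_div_of_nonneg_right e2 two_pos.le)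
  rw [Real.norm_eq_abs] at hb
  have t1 : ∑' j : ℕ, g j ≤ ∑' m, g m :=
    tsum_comp_le_tsum_of_inj hgs hg0 i1
  have t2 : ∑' j : ℕ, g (j + k) ≤ ∑' m, g m :=
    tsum_comp_le_tsum_of_inj hgs hg0 i2
  have t3 : ∑' j : ℕ, g (j - k) ≤ ∑' m, g m :=
    tsum_comp_le_tsum_of_inj hgs hg0 i3
  have hA2 : A = (k : ℝ) ^ (1 - β) * (Real.pi * 2 ^ β * C ^ 2) := by
    rw [hA, Real.div_rpow hk'.le two_pos.le, Real.rpow_neg two_pos.le, Real.rpow_sub hk',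
      Real.rpow_neg hk'.le, Real.rpow_one]
    field_simp
  calc |bf u k| ≤ _ := hb
    _ ≤ A * (2 * ∑' m, g m) := by gcongr; linarith
    _ = _ := by rw [hA2]; ring

/-! ### Absolutely continuous functions of one variable -/

/-- The primitive of an integrable function is absolutely continuous and differentiable almost
everywhere, by Lebesgue's theorem. -/
theorem ac_of_eq_integral {F g : ℝ → ℝ} {a b : ℝ} (hab : a ≤ b)
    (hg : IntervalIntegrable g volume a b)
    (hF : ∀ t ∈ Set.Icc a b, F t = F a + ∫ s in a..t, g s) :
    AbsolutelyContinuousOnInterval F a b ∧ ∀ᵐ t, t ∈ Set.Ioo a b → HasDerivAt F (g t) t := by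
  have hac := hg.absolutelyContinuousOnInterval_intervalIntegral (c := a) (by simp)
  have hconst : AbsolutelyContinuousOnInterval (fun _ : ℝ => F a) a b :=
    (LipschitzWith.const (F a)).lipschitzOnWith.absolutelyContinuousOnInterval (K := 0)
  have hsum := hconst.fun_add hac
  have hFt : ∀ t ∈ Set.uIcc a b, F t = F a + ∫ s in a..t, g s := by
    rw [Set.uIcc_of_le hab]; exact hF
  constructor
  · rw [AbsolutelyContinuousOnInterval] at hsum ⊢
    refine hsum.congr' (eventually_inf_principal.2 (Eventually.of_forall fun E hE => ?_))
    refine Finset.sum_congr rfl fun i hi => ?_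
    rw [hFt _ (hE.1 i hi).1, hFt _ (hE.1 i hi).2]
  · filter_upwards [hg.ae_hasDerivAt_integral] with t ht hmem
    have h1 := (ht (by rw [Set.uIcc_of_le hab]; exact Set.Ioo_subset_Icc_self hmem) a
      (by simp)).const_add (F a)
    refine h1.congr_of_eventuallyEq ?_
    filter_upwards [Ioo_mem_nhds hmem.1 hmem.2] with s hs
    exact hF s (Set.Ioo_subset_Icc_self hs)

/-- Integration by parts for two functions that are given as integrals of their derivatives. -/
theorem integral_mul_add_mul {F H g h : ℝ → ℝ} {a b : ℝ} (hab : a ≤ b)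
    (hg : IntervalIntegrable g volume a b) (hh : IntervalIntegrable h volume a b)
    (hF : ∀ t ∈ Set.Icc a b, F t = F a + ∫ s in a..t, g s)
    (hH : ∀ t ∈ Set.Icc a b, H t = H a + ∫ s in a..t, h s) :
    ∫ t in a..b, (g t * H t + F t * h t) = F b * H b - F a * H a := by
  obtain ⟨hF1, hF2⟩ := ac_of_eq_integral hab hg hF
  obtain ⟨hH1, hH2⟩ := ac_of_eq_integral hab hh hH
  rw [← hF1.integral_deriv_mul_eq_sub hH1]
  rw [intervalIntegral.integral_of_le hab, intervalIntegral.integral_of_le hab,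
    integral_Ioc_eq_integral_Ioo, integral_Ioc_eq_integral_Ioo]
  refine integral_congr_ae ((ae_restrict_iff' measurableSet_Ioo).2 ?_)
  filter_upwards [hF2, hH2] with t h1 h2 ht
  rw [(h1 ht).deriv, (h2 ht).deriv]

theorem continuousOn_of_eq_integral {F g : ℝ → ℝ} {a b : ℝ} (hab : a ≤ b)
    (hg : IntervalIntegrable g volume a b)
    (hF : ∀ t ∈ Set.Icc a b, F t = F a + ∫ s in a..t, g s) : ContinuousOn F (Set.Icc a b) := by
  have := (ac_of_eq_integral hab hg hF).1.continuousOn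
  rwa [Set.uIcc_of_le hab] at this

/-- A test function with integral zero is the derivative of a test function. -/
theorem IsTestFunction.exists_primitive {I : Set ℝ} (hI : I.OrdConnected) {φ : ℝ → ℝ}
    (hφ : IsTestFunction I φ) (h0 : ∫ x, φ x = 0) :
    ∃ Φ, IsTestFunction I Φ ∧ ∀ x, HasDerivAt Φ (φ x) x := by
  rcases (tsupport φ).eq_empty_or_nonempty with he | hne
  · have : φ = 0 := tsupport_eq_empty_iff.1 he
    refine ⟨0, ⟨contDiff_const, HasCompactSupport.zero, ?_⟩, fun x => ?_⟩
    · have h : tsupport (0 : ℝ → ℝ) = ∅ := tsupport_eq_empty_iff.2 rfl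
      rw [h]; exact Set.empty_subset _
    · rw [this]; exact hasDerivAt_const x 0
  have hK : IsCompact (tsupport φ) := hφ.compact
  set a := sInf (tsupport φ)
  set b := sSup (tsupport φ)
  have ha : a ∈ tsupport φ := hK.sInf_mem hne
  have hb : b ∈ tsupport φ := hK.sSup_mem hne
  have hsub : tsupport φ ⊆ Set.Icc a b := fun x hx =>
    ⟨csInf_le hK.bddBelow hx, le_csSup hK.bddAbove hx⟩
  have hcont : Continuous φ := hφ.smooth.continuous
  have hz : ∀ x, x ∉ Set.Icc a b → φ x = 0 := fun x hx =>
    image_eq_zero_of_notMem_tsupport fun h => hx (hsub h)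
  have hd : ∀ x, HasDerivAt (fun x => ∫ y in a..x, φ y) (φ x) x := fun x =>
    intervalIntegral.integral_hasDerivAt_right (hcont.intervalIntegrable _ _)
      (hcont.stronglyMeasurableAtFilter _ _) hcont.continuousAt
  have hΦz : ∀ x, x ∉ Set.Icc a b → ∫ y in a..x, φ y = 0 := by
    intro x hx
    rcases lt_or_ge x a with h | h
    · rw [intervalIntegral.integral_symm, intervalIntegral.integral_of_le h.le,
        integral_Ioc_eq_integral_Ioo, neg_eq_zero]
      refine setIntegral_eq_zero_of_forall_eq_zero fun y hy => hz y fun hy' => ?_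
      exact absurd hy'.1 (not_le.2 hy.2)
    · have hbx : b < x := not_le.1 fun h' => hx ⟨h, h'⟩
      rw [intervalIntegral.integral_of_le h, ← integral_Icc_eq_integral_Ioc, ← h0]
      refine setIntegral_eq_integral_of_forall_compl_eq_zero fun y hy => hz y fun hy' => ?_
      exact hy ⟨hy'.1, hy'.2.trans hbx.le⟩
  have hts : tsupport (fun x => ∫ y in a..x, φ y) ⊆ Set.Icc a b := by
    refine closure_minimal (fun x hx => ?_) isClosed_Icc
    by_contra h
    exact hx (hΦz x h)
  refine ⟨fun x => ∫ y in a..x, φ y, ⟨?_, ?_, ?_⟩, hd⟩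
  · rw [contDiff_infty_iff_deriv]
    refine ⟨fun x => (hd x).differentiableAt, ?_⟩
    rw [show deriv (fun x => ∫ y in a..x, φ y) = φ from funext fun x => (hd x).deriv]
    exact hφ.smooth
  · exact isCompact_Icc.of_isClosed_subset (isClosed_tsupport _) hts
  · exact hts.trans (hI.out (hφ.support ha) (hφ.support hb))

theorem IsTestFunction.add {I : Set ℝ} {φ ψ : ℝ → ℝ} (hφ : IsTestFunction I φ)
    (hψ : IsTestFunction I ψ) : IsTestFunction I (φ + ψ) :=
  ⟨hφ.smooth.add hψ.smooth, hφ.compact.add hψ.compact,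
    (tsupport_add φ ψ).trans (Set.union_subset hφ.support hψ.support)⟩

theorem IsTestFunction.smul {I : Set ℝ} {φ : ℝ → ℝ} (hφ : IsTestFunction I φ) (c : ℝ) :
    IsTestFunction I (c • φ) :=
  ⟨hφ.smooth.const_smul c, hφ.compact.mono (Function.support_const_smul_subset c φ),
    (closure_mono (Function.support_const_smul_subset c φ)).trans hφ.support⟩

theorem IsTestFunction.integrable {I : Set ℝ} {φ : ℝ → ℝ} (hφ : IsTestFunction I φ) :
    Integrable φ := hφ.smooth.continuous.integrable_of_hasCompactSupport hφ.compact

theorem IsTestFunction.zero_of_notMem {I : Set ℝ} {φ : ℝ → ℝ} (hφ : IsTestFunction I φ) {x : ℝ}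
    (hx : x ∉ I) : φ x = 0 :=
  image_eq_zero_of_notMem_tsupport fun h => hx (hφ.support h)

/-- In every nonempty open set there is a test function with integral one. -/
theorem exists_isTestFunction_integral_eq_one {I : Set ℝ} (hI : IsOpen I) (hne : I.Nonempty) :
    ∃ χ, IsTestFunction I χ ∧ ∫ x, χ x = 1 := by
  obtain ⟨c, hc⟩ := hne
  obtain ⟨r, hr, hball⟩ := Metric.isOpen_iff.1 hI c hc
  let B : ContDiffBump c := ⟨r / 4, r / 2, by positivity, by linarith⟩
  refine ⟨B.normed volume, ⟨B.contDiff_normed, B.hasCompactSupport_normed, ?_⟩,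
    B.integral_normed⟩
  rw [B.tsupport_normed_eq]
  exact (Metric.closedBall_subset_ball (by show r / 2 < r; linarith)).trans hball

/-- The lemma of du Bois-Reymond on a half-line, for continuous functions. -/
theorem eq_const_of_forall_integral_deriv_eq_zero {t₀ : ℝ} {z : ℝ → ℝ}
    (hz : ContinuousOn z (Set.Ioi t₀))
    (h : ∀ φ, IsTestFunction (Set.Ioi t₀) φ → ∫ t in Set.Ioi t₀, deriv φ t * z t = 0) :
    ∃ c, ∀ t, t₀ < t → z t = c := by
  obtain ⟨χ, hχ, hχ1⟩ := exists_isTestFunction_integral_eq_one (isOpen_Ioi (a := t₀))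
    ⟨t₀ + 1, by simp⟩
  have hint : ∀ φ, IsTestFunction (Set.Ioi t₀) φ →
      Integrable (fun t => φ t * z t) (volume.restrict (Set.Ioi t₀)) := by
    intro φ hφ
    refine Integrable.integrableOn ?_
    rw [← integrableOn_iff_integrable_of_support_subset (s := tsupport φ)
      (fun t ht => subset_tsupport _ (left_ne_zero_of_mul ht))]
    exact (hφ.smooth.continuous.continuousOn.mul (hz.mono hφ.support)).integrableOn_compact
      hφ.compact
  set c := ∫ t in Set.Ioi t₀, χ t * z t with hc
  have hset : ∀ g : ℝ → ℝ, IsTestFunction (Set.Ioi t₀) g →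
      ∫ t in Set.Ioi t₀, g t = ∫ t, g t := fun g hg =>
    setIntegral_eq_integral_of_forall_compl_eq_zero fun x hx => hg.zero_of_notMem hx
  -- Subtracting from `φ` the multiple `(∫ φ) χ` leaves the derivative of a test function.
  have key : ∀ φ, IsTestFunction (Set.Ioi t₀) φ →
      ∫ t in Set.Ioi t₀, φ t * (z t - c) = 0 := by
    intro φ hφ
    obtain ⟨Φ, hΦ, hd⟩ := (hφ.add (hχ.smul (-∫ t, φ t))).exists_primitive
      Set.ordConnected_Ioi (by
        have := integral_add hφ.integrable (hχ.smul (-∫ t, φ t)).integrable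
        simp only [Pi.add_apply]
        rw [this]
        simp only [Pi.smul_apply, smul_eq_mul]
        rw [integral_const_mul, hχ1]; ring)
    have h1 := h Φ hΦ
    have h2 : ∀ t, deriv Φ t * z t = φ t * z t + (-∫ t, φ t) * (χ t * z t) := fun t => by
      rw [(hd t).deriv]; simp only [Pi.add_apply, Pi.smul_apply, smul_eq_mul]; ring
    simp only [h2] at h1
    rw [integral_add (hint φ hφ) ((hint χ hχ).const_mul _), integral_const_mul, ← hc] at h1
    simp only [mul_sub]
    rw [integral_sub (hint φ hφ) (hφ.integrable.integrableOn.mul_const c), integral_mul_const,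
      hset φ hφ]
    linarith
  have hae := isOpen_Ioi.ae_eq_zero_of_integral_contDiff_smul_eq_zero (U := Set.Ioi t₀)
    (f := fun t => z t - c) (μ := volume)
    ((hz.sub continuousOn_const).locallyIntegrableOn measurableSet_Ioi)
    (fun g hg hgc hgs => by
      rw [← key g ⟨hg, hgc, hgs⟩]
      simp only [smul_eq_mul]
      refine (setIntegral_eq_integral_of_forall_compl_eq_zero fun x hx => ?_).symm
      rw [image_eq_zero_of_notMem_tsupport (fun h => hx (hgs h)), zero_mul])
  refine ⟨c, fun t ht => ?_⟩
  have hae2 : z =ᵐ[volume.restrict (Set.Ioi t₀)] fun _ => c := by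
    refine (ae_restrict_iff' measurableSet_Ioi).2 ?_
    filter_upwards [hae] with s hs hs'
    exact sub_eq_zero.1 (hs hs')
  exact Measure.eqOn_open_of_ae_eq hae2 isOpen_Ioi hz continuousOn_const ht

/-! ### The Sobolev space `H¹₀(0,1)` -/

theorem L2.intervalIntegrable (g : L2) : IntervalIntegrable g volume 0 1 := by
  rw [intervalIntegrable_iff_integrableOn_Ioo_of_le zero_le_one]
  exact L2.integrable g

theorem integral_abs_le_norm (g : L2) : ∫ x, |g x| ∂μI ≤ ‖g‖ := by
  have h1 : ∫ x, |g x| ∂μI = inner ℝ (ofCont 1) |g| := by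
    rw [inner_ofCont]
    refine integral_congr_ae ?_
    filter_upwards [Lp.coeFn_abs g] with x hx
    rw [hx]; simp
  rw [h1]
  refine (real_inner_le_norm _ _).trans ?_
  rw [norm_abs_eq_norm]
  have h2 : ‖ofCont 1‖ = 1 := by
    have h3 : ‖ofCont 1‖ ^ 2 = 1 := by
      rw [← real_inner_self_eq_norm_sq, inner_ofCont]
      have : ∫ x, (1 : C(ℝ, ℝ)) x * ofCont 1 x ∂μI = ∫ x, (1 : ℝ) ∂μI := by
        refine integral_congr_ae ?_
        filter_upwards [coeFn_ofCont 1] with x hx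
        rw [hx]; simp
      rw [this, integral_unitInterval]; simp
    nlinarith [norm_nonneg (ofCont 1)]
  rw [h2, one_mul]

/-- The primitive of `g` that vanishes at `0`. -/
def prim (g : L2) (x : ℝ) : ℝ := ∫ y in (0 : ℝ)..x, g y

theorem L2.intervalIntegrable' (g : L2) {x : ℝ} (hx : x ∈ Set.Icc (0 : ℝ) 1) :
    IntervalIntegrable g volume 0 x :=
  (L2.intervalIntegrable g).mono_set (by
    rw [Set.uIcc_of_le hx.1, Set.uIcc_of_le zero_le_one]; exact Set.Icc_subset_Icc_right hx.2)

theorem prim_zero_right (g : L2) : prim g 0 = 0 := intervalIntegral.integral_same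

theorem prim_eq (g : L2) (x : ℝ) : prim g x = prim g 0 + ∫ y in (0 : ℝ)..x, g y := by
  rw [prim_zero_right, zero_add, prim]

theorem continuousOn_prim (g : L2) : ContinuousOn (prim g) (Set.Icc 0 1) :=
  continuousOn_of_eq_integral zero_le_one (L2.intervalIntegrable g) fun x _ => prim_eq g x

theorem abs_prim_le (g : L2) {x : ℝ} (hx : x ∈ Set.Icc (0 : ℝ) 1) : |prim g x| ≤ ‖g‖ := by
  refine le_trans ?_ (integral_abs_le_norm g)
  rw [integral_unitInterval]
  refine (intervalIntegral.abs_integral_le_integral_abs hx.1).trans ?_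
  exact intervalIntegral.integral_mono_interval le_rfl hx.1 hx.2
    (Eventually.of_forall fun y => abs_nonneg _) (L2.intervalIntegrable g).abs

theorem ae_unitInterval {p : ℝ → Prop} (h : ∀ x ∈ Set.Ioo (0 : ℝ) 1, p x) : ∀ᵐ x ∂μI, p x :=
  (ae_restrict_iff' measurableSet_Ioo).2 (Eventually.of_forall h)

theorem intervalIntegral_congr_μI {f g : ℝ → ℝ} (h : f =ᵐ[μI] g) {x : ℝ}
    (hx : x ∈ Set.Icc (0 : ℝ) 1) : ∫ y in (0 : ℝ)..x, f y = ∫ y in (0 : ℝ)..x, g y := by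
  rw [intervalIntegral.integral_of_le hx.1, intervalIntegral.integral_of_le hx.1,
    integral_Ioc_eq_integral_Ioo, integral_Ioc_eq_integral_Ioo]
  exact integral_congr_ae (ae_restrict_of_ae_restrict_of_subset
    (Set.Ioo_subset_Ioo_right hx.2) h)

theorem prim_add (g h : L2) {x : ℝ} (hx : x ∈ Set.Icc (0 : ℝ) 1) :
    prim (g + h) x = prim g x + prim h x := by
  rw [prim, prim, prim, ← intervalIntegral.integral_add (L2.intervalIntegrable' g hx)
    (L2.intervalIntegrable' h hx)]
  exact intervalIntegral_congr_μI (Lp.coeFn_add g h) hx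

theorem prim_smul (c : ℝ) (g : L2) {x : ℝ} (hx : x ∈ Set.Icc (0 : ℝ) 1) :
    prim (c • g) x = c * prim g x := by
  rw [prim, prim, ← intervalIntegral.integral_const_mul]
  exact intervalIntegral_congr_μI (Lp.coeFn_smul c g) hx

theorem memLp_prim (g : L2) : MemLp (prim g) 2 μI :=
  memLp_of_bound (((continuousOn_prim g).mono Set.Ioo_subset_Icc_self).aestronglyMeasurable
    measurableSet_Ioo) ‖g‖ (fun _ hx => abs_prim_le g (Set.Ioo_subset_Icc_self hx)) 2

theorem norm_le_of_ae_bound {u : L2} {C : ℝ} (hC : 0 ≤ C) (h : ∀ᵐ x ∂μI, |u x| ≤ C) :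
    ‖u‖ ≤ C := by
  have := Lp.norm_le_of_ae_bound (μ := μI) (p := 2) (f := u) hC
    (by simpa only [Real.norm_eq_abs] using h)
  have h1 : measureUnivNNReal μI = 1 := by simp [measureUnivNNReal]
  simpa [h1] using this

/-- Integration from `0`, as an operator on `L²(0,1)`. -/
def primL : L2 →L[ℝ] L2 :=
  LinearMap.mkContinuous
    { toFun := fun g => (memLp_prim g).toLp _
      map_add' := fun g h => by
        rw [← MemLp.toLp_add]
        refine MemLp.toLp_congr _ _ (ae_unitInterval fun x hx => ?_)
        exact prim_add g h (Set.Ioo_subset_Icc_self hx)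
      map_smul' := fun c g => by
        rw [RingHom.id_apply, ← MemLp.toLp_const_smul]
        refine MemLp.toLp_congr _ _ (ae_unitInterval fun x hx => ?_)
        exact prim_smul c g (Set.Ioo_subset_Icc_self hx) } 1 (fun g => by
    rw [one_mul]
    refine norm_le_of_ae_bound (norm_nonneg _) ?_
    filter_upwards [(memLp_prim g).coeFn_toLp, ae_unitInterval fun x hx =>
      abs_prim_le g (Set.Ioo_subset_Icc_self hx)] with x h1 h2
    simpa [h1] using h2)

theorem coeFn_primL (g : L2) : primL g =ᵐ[μI] prim g := (memLp_prim g).coeFn_toLp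

theorem integral_eq_inner_one (g : L2) : ∫ x, g x ∂μI = inner ℝ (ofCont 1) g := by
  rw [inner_ofCont]; simp

theorem prim_one_right (g : L2) : prim g 1 = inner ℝ (ofCont 1) g := by
  rw [← integral_eq_inner_one, integral_unitInterval, prim]

/-- A test function is the integral of its derivative from `0`, and it vanishes at `1`. Stated with
continuous operators on `L²`, these two facts pass to the closure of the graph. -/
theorem testGraph_subset {p : WithLp 2 (L2 × L2)} (hp : p ∈ testGraph) :
    p.fst = primL p.snd ∧ inner ℝ (ofCont 1) p.snd = 0 := by
  obtain ⟨φ, hφ, h1, h2⟩ := hp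
  have hd : ∀ x, HasDerivAt φ (deriv φ x) x := fun x =>
    (hφ.smooth.differentiable (by simp) x).hasDerivAt
  have hc : Continuous (deriv φ) := hφ.smooth.continuous_deriv (by simp)
  have h0 : φ 0 = 0 := hφ.zero_of_notMem (by simp)
  have h1' : φ 1 = 0 := hφ.zero_of_notMem (by simp)
  have hprim : ∀ x ∈ Set.Icc (0 : ℝ) 1, prim p.snd x = φ x := fun x hx => by
    rw [prim, intervalIntegral_congr_μI h2 hx,
      intervalIntegral.integral_eq_sub_of_hasDerivAt (fun y _ => hd y)
        (hc.intervalIntegrable _ _), h0, sub_zero]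
  constructor
  · refine Lp.ext ?_
    filter_upwards [h1, coeFn_primL p.snd, ae_unitInterval fun x hx =>
      hprim x (Set.Ioo_subset_Icc_self hx)] with x e1 e2 e3
    rw [e1, e2, e3]
  · rw [← prim_one_right, hprim 1 (by simp), h1']

/-- An element of `H¹₀(0,1)` is the integral of its weak derivative, which has mean zero. -/
theorem H10.primL_dx (U : H10) : toL2 U = primL (dx U) ∧ inner ℝ (ofCont 1) (dx U) = 0 := by
  have hcl : IsClosed {p : WithLp 2 (L2 × L2) | p.fst = primL p.snd ∧
      inner ℝ (ofCont 1) p.snd = (0 : ℝ)} := by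
    have c1 : Continuous fun p : WithLp 2 (L2 × L2) => p.fst := (WithLp.fstL 2 ℝ L2 L2).continuous
    have c2 : Continuous fun p : WithLp 2 (L2 × L2) => p.snd := (WithLp.sndL 2 ℝ L2 L2).continuous
    exact (isClosed_eq c1 (primL.continuous.comp c2)).inter
      (isClosed_eq (continuous_const.inner c2) continuous_const)
  exact closure_minimal (fun p hp => testGraph_subset hp) hcl U.2

theorem H10.coeFn_toL2 (U : H10) : toL2 U =ᵐ[μI] prim (dx U) := by
  rw [(H10.primL_dx U).1]; exact coeFn_primL _

theorem H10.prim_dx_one (U : H10) : prim (dx U) 1 = 0 := by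
  rw [prim_one_right, (H10.primL_dx U).2]

/-- The classes of test functions are dense in `L²(0,1)`. -/
theorem testGraph_fst_dense :
    (testGraph.map (WithLp.fstL 2 ℝ L2 L2).toLinearMap).topologicalClosure = ⊤ := by
  rw [Submodule.topologicalClosure_eq_top_iff, Submodule.eq_bot_iff]
  intro u hu
  rw [Submodule.mem_orthogonal] at hu
  rw [Lp.eq_zero_iff_ae_eq_zero]
  refine (ae_restrict_iff' measurableSet_Ioo).2 ?_
  refine isOpen_Ioo.ae_eq_zero_of_integral_contDiff_smul_eq_zero
    (IntegrableOn.locallyIntegrableOn (L2.integrable u)) fun g hg hgc hgs => ?_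
  have hc : Continuous (deriv g) := hg.continuous_deriv (by simp)
  have := hu (ofCont ⟨g, hg.continuous⟩) ⟨WithLp.toLp 2 (ofCont ⟨g, hg.continuous⟩,
    ofCont ⟨deriv g, hc⟩), ⟨g, ⟨hg, hgc, hgs⟩, coeFn_ofCont _, coeFn_ofCont _⟩, rfl⟩
  rw [inner_ofCont] at this
  refine Eq.trans ?_ this
  refine (setIntegral_eq_integral_of_forall_compl_eq_zero fun x hx => ?_).symm
  rw [image_eq_zero_of_notMem_tsupport (fun h => hx (hgs h)), zero_smul]

/-- Every `g ∈ L²(0,1)` with mean zero is the weak derivative of an element of `H¹₀(0,1)`. -/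
theorem H10.exists_dx_eq (g : L2) (hg : inner ℝ (ofCont 1) g = (0 : ℝ)) :
    ∃ U : H10, toL2 U = primL g ∧ dx U = g := by
  -- `T` is the projection onto mean zero along the test function `χ`, and `Θ h` is the primitive of
  -- `T h` with its derivative. `Θ` maps test functions into the graph, hence all of `L²` into its closure.
  obtain ⟨χ, hχ, hχ1⟩ := exists_isTestFunction_integral_eq_one (isOpen_Ioo (a := (0 : ℝ)) (b := 1))
    ⟨1 / 2, by norm_num⟩
  set X : L2 := ofCont ⟨χ, hχ.smooth.continuous⟩ with hX
  let T : L2 → L2 := fun h => h - (inner ℝ (ofCont 1) h : ℝ) • X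
  have hc1 : Continuous fun h : L2 => (inner ℝ (ofCont 1) h : ℝ) :=
    continuous_const.inner continuous_id
  have hT : Continuous T := by fun_prop
  let Θ : L2 → WithLp 2 (L2 × L2) := fun h => WithLp.toLp 2 (primL (T h), T h)
  have hΘ : Continuous Θ :=
    (WithLp.prod_continuous_toLp 2 L2 L2).comp ((primL.continuous.comp hT).prodMk hT)
  have hmem : ∀ h ∈ testGraph.map (WithLp.fstL 2 ℝ L2 L2).toLinearMap, Θ h ∈ testGraph := by
    rintro h ⟨p, ⟨φ, hφ, h1, h2⟩, rfl⟩
    have h1' : (WithLp.fstL 2 ℝ L2 L2) p =ᵐ[μI] φ := h1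
    have hint : inner ℝ (ofCont 1) ((WithLp.fstL 2 ℝ L2 L2) p) = ∫ x, φ x := by
      rw [← integral_eq_inner_one, integral_congr_ae h1']
      exact setIntegral_eq_integral_of_forall_compl_eq_zero fun x hx => hφ.zero_of_notMem hx
    obtain ⟨Φ, hΦ, hd⟩ := (hφ.add (hχ.smul (-∫ t, φ t))).exists_primitive
      Set.ordConnected_Ioo (by
        have := integral_add hφ.integrable (hχ.smul (-∫ t, φ t)).integrable
        simp only [Pi.add_apply]
        rw [this]
        simp only [Pi.smul_apply, smul_eq_mul]
        rw [integral_const_mul, hχ1]; ring)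
    have hTae : T ((WithLp.fstL 2 ℝ L2 L2) p) =ᵐ[μI] deriv Φ := by
      filter_upwards [h1', Lp.coeFn_sub ((WithLp.fstL 2 ℝ L2 L2) p)
        ((inner ℝ (ofCont 1) ((WithLp.fstL 2 ℝ L2 L2) p) : ℝ) • X),
        Lp.coeFn_smul (inner ℝ (ofCont 1) ((WithLp.fstL 2 ℝ L2 L2) p) : ℝ) X,
        coeFn_ofCont ⟨χ, hχ.smooth.continuous⟩] with x e1 e2 e3 e4
      rw [(hd x).deriv]
      simp only [T]
      rw [e2, Pi.sub_apply, e3, Pi.smul_apply, hX, e4, e1, hint]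
      simp only [smul_eq_mul, Pi.add_apply, Pi.smul_apply, ContinuousMap.coe_mk]
      ring
    refine ⟨Φ, hΦ, ?_, hTae⟩
    have hc : Continuous (deriv Φ) := hΦ.smooth.continuous_deriv (by simp)
    refine (coeFn_primL _).trans (ae_unitInterval fun x hx => ?_)
    refine (intervalIntegral_congr_μI hTae (Set.Ioo_subset_Icc_self hx)).trans ?_
    rw [intervalIntegral.integral_eq_sub_of_hasDerivAt
        (fun y _ => (hΦ.smooth.differentiable (by simp) y).hasDerivAt)
        (hc.intervalIntegrable _ _), hΦ.zero_of_notMem (by simp : (0 : ℝ) ∉ _), sub_zero]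
  have hcl : Θ g ∈ testGraph.topologicalClosure := by
    have h1 : g ∈ closure ((testGraph.map (WithLp.fstL 2 ℝ L2 L2).toLinearMap : Submodule ℝ L2) :
        Set L2) := by
      rw [← Submodule.topologicalClosure_coe, testGraph_fst_dense]; trivial
    exact map_mem_closure hΘ h1 hmem
  have hTg : T g = g := by simp [T, hg]
  refine ⟨⟨Θ g, hcl⟩, ?_, ?_⟩
  · show primL (T g) = primL g
    rw [hTg]
  · exact hTg

/-- A `C¹` function that vanishes at `0` and `1` belongs to `H¹₀(0,1)`. -/
theorem H10.exists_of_contDiff {φ : ℝ → ℝ} (hφ : ContDiff ℝ 1 φ) (h0 : φ 0 = 0) (h1 : φ 1 = 0) :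
    ∃ U : H10, toL2 U =ᵐ[μI] φ ∧ dx U =ᵐ[μI] deriv φ := by
  have hc : Continuous (deriv φ) := hφ.continuous_deriv le_rfl
  set g : L2 := ofCont ⟨deriv φ, hc⟩ with hg
  have hgae : g =ᵐ[μI] deriv φ := coeFn_ofCont _
  have hprim : ∀ x ∈ Set.Icc (0 : ℝ) 1, prim g x = φ x := fun x hx => by
    rw [prim, intervalIntegral_congr_μI hgae hx, intervalIntegral.integral_eq_sub_of_hasDerivAt
        (fun y _ => (hφ.differentiable (by simp) y).hasDerivAt)
        (hc.intervalIntegrable _ _), h0, sub_zero]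
  obtain ⟨U, hU1, hU2⟩ := H10.exists_dx_eq g (by rw [← prim_one_right, hprim 1 (by simp), h1])
  refine ⟨U, ?_, by rw [hU2]; exact hgae⟩
  rw [hU1]
  exact (coeFn_primL g).trans (ae_unitInterval fun x hx => hprim x (Set.Ioo_subset_Icc_self hx))

/-- The embedding of `H¹₀(0,1)` into the bounded functions. -/
theorem H10.abs_le_norm_dx (U : H10) : ∀ᵐ x ∂μI, |toL2 U x| ≤ ‖dx U‖ := by
  filter_upwards [H10.coeFn_toL2 U, ae_unitInterval fun x hx =>
      abs_prim_le (dx U) (Set.Ioo_subset_Icc_self hx)] with x h1 h2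
  rw [h1]; exact h2

/-- Poincaré's inequality. -/
theorem H10.norm_toL2_le (U : H10) : ‖toL2 U‖ ≤ ‖dx U‖ :=
  norm_le_of_ae_bound (norm_nonneg _) (H10.abs_le_norm_dx U)

theorem H10.norm_sq (U : H10) : ‖U‖ ^ 2 = ‖toL2 U‖ ^ 2 + ‖dx U‖ ^ 2 :=
  WithLp.prod_norm_sq_eq_of_L2 (U : WithLp 2 (L2 × L2))

/-- Integration by parts against a `C¹` function. -/
theorem H10.integral_dx_mul (U : H10) {y : ℝ → ℝ} (hy : ContDiff ℝ 1 y) :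
    ∫ x, y x * dx U x ∂μI = - ∫ x, deriv y x * toL2 U x ∂μI := by
  have hc : Continuous (deriv y) := hy.continuous_deriv le_rfl
  have key := integral_mul_add_mul zero_le_one (hc.intervalIntegrable 0 1)
    (L2.intervalIntegrable (dx U)) (F := y) (H := prim (dx U))
    (fun t _ => by
      rw [intervalIntegral.integral_eq_sub_of_hasDerivAt
        (fun x _ => (hy.differentiable (by simp) x).hasDerivAt) (hc.intervalIntegrable _ _)]
      ring) (fun t _ => prim_eq _ t)
  rw [H10.prim_dx_one, prim_zero_right, mul_zero, mul_zero, sub_zero,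
    ← integral_unitInterval] at key
  have e : ∫ x, deriv y x * toL2 U x ∂μI = ∫ x, deriv y x * prim (dx U) x ∂μI := by
    refine integral_congr_ae ?_
    filter_upwards [H10.coeFn_toL2 U] with x hx
    rw [hx]
  have hi : Integrable (fun x => deriv y x * prim (dx U) x) μI :=
    integrable_continuous_mul ((memLp_prim _).integrable (by norm_num)) hc
  rw [integral_add hi (integrable_continuous_mul (L2.integrable _) hy.continuous)] at key
  rw [e]; linarith

theorem H10.toL2_injective : Function.Injective toL2 := by
  rw [injective_iff_map_eq_zero]
  intro U hU
  have hdx : dx U = 0 := by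
    refine eq_zero_of_sc_eq_zero _ fun k => ?_
    have hy : ContDiff ℝ 1 (fun x : ℝ => √2 * Real.sin (k * Real.pi * x)) := by fun_prop
    rw [sc_eq_integral, H10.integral_dx_mul U hy, hU, neg_eq_zero]
    refine integral_eq_zero_of_ae ?_
    filter_upwards [Lp.coeFn_zero ℝ 2 μI] with x hx
    rw [hx]; simp
  have : ‖U‖ ^ 2 = 0 := by rw [H10.norm_sq, hU, hdx]; simp
  exact norm_eq_zero.1 (by simpa using this)

/-! ### Sine series in `H¹₀(0,1)` -/

theorem exists_sine_H10 (k : ℤ) : ∃ U : H10, toL2 U = sn k ∧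
    dx U =ᵐ[μI] fun x => √2 * (k * Real.pi) * Real.cos (k * Real.pi * x) := by
  have hd : ∀ x, HasDerivAt (fun x : ℝ => √2 * Real.sin (k * Real.pi * x))
      (√2 * (k * Real.pi) * Real.cos (k * Real.pi * x)) x := fun x => by
    have := (((hasDerivAt_id x).const_mul (k * Real.pi)).sin).const_mul √2
    convert! this using 1
    simp; ring
  obtain ⟨U, h1, h2⟩ := H10.exists_of_contDiff
    (φ := fun x : ℝ => √2 * Real.sin (k * Real.pi * x)) (by fun_prop) (by simp)
    (by simp [Real.sin_int_mul_pi])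
  refine ⟨U, Lp.ext (h1.trans (coeFn_ofCont (sinFun k)).symm), h2.trans ?_⟩
  exact Eventually.of_forall fun x => (hd x).deriv

/-- The function `√2 sin(kπx)` as an element of `H¹₀(0,1)`. -/
def sineH (k : ℤ) : H10 := (exists_sine_H10 k).choose

theorem toL2_sineH (k : ℤ) : toL2 (sineH k) = sn k := (exists_sine_H10 k).choose_spec.1

theorem coeFn_dx_sineH (k : ℤ) :
    dx (sineH k) =ᵐ[μI] fun x => √2 * (k * Real.pi) * Real.cos (k * Real.pi * x) :=
  (exists_sine_H10 k).choose_spec.2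

/-- Testing `U_x` with a sine gives `(kπ)²` times the sine coefficient of `U`: integration by parts
without boundary terms. -/
theorem inner_dx_sineH (k : ℤ) (U : H10) :
    inner ℝ (dx (sineH k)) (dx U) = lam k * sc (toL2 U) k := by
  have hd : ∀ x, HasDerivAt (fun x : ℝ => √2 * (k * Real.pi) * Real.cos (k * Real.pi * x))
      (-(lam k) * (√2 * Real.sin (k * Real.pi * x))) x := fun x => by
    have := (((hasDerivAt_id x).const_mul (k * Real.pi)).cos).const_mul (√2 * (k * Real.pi))
    convert! this using 1
    simp [lam]; ring
  rw [inner_eq_integral, sc_eq_integral, ← integral_const_mul]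
  have h1 : ∫ x, dx (sineH k) x * dx U x ∂μI =
      ∫ x, √2 * (k * Real.pi) * Real.cos (k * Real.pi * x) * dx U x ∂μI := by
    refine integral_congr_ae ?_
    filter_upwards [coeFn_dx_sineH k] with x hx
    rw [hx]
  rw [h1, H10.integral_dx_mul U (by fun_prop), ← integral_neg]
  refine integral_congr_ae (Eventually.of_forall fun x => ?_)
  simp only [(hd x).deriv]; ring

theorem H10.inner_eq (U V : H10) :
    inner ℝ U V = inner ℝ (toL2 U) (toL2 V) + inner ℝ (dx U) (dx V) := rfl

theorem H10.inner_smul_left (c : ℝ) (U V : H10) : inner ℝ (c • U) V = c * inner ℝ U V :=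
  real_inner_smul_left U V c

theorem H10.inner_smul_right (c : ℝ) (U V : H10) : inner ℝ U (c • V) = c * inner ℝ U V :=
  real_inner_smul_right U V c

theorem inner_sineH (k : ℤ) (U : H10) :
    inner ℝ (sineH k) U = (1 + lam k) * sc (toL2 U) k := by
  rw [H10.inner_eq, inner_dx_sineH, toL2_sineH, sc]; ring

theorem one_add_lam_pos (k : ℤ) : 0 < 1 + lam k := by linarith [lam_nonneg k]

theorem orthonormal_sineH :
    Orthonormal ℝ fun k : ℕ => (√(1 + lam (k + 1)))⁻¹ • sineH (k + 1) := by
  rw [orthonormal_iff_ite]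
  intro i j
  rw [H10.inner_smul_left, H10.inner_smul_right, inner_sineH, toL2_sineH, sc, inner_sn]
  have h2 : (i : ℤ) + 1 + (j + 1) ≠ 0 := by omega
  split_ifs with h3 h4 h4
  · subst h4
    have := Real.mul_self_sqrt (one_add_lam_pos (i + 1)).le
    have h0 := (Real.sqrt_pos.2 (one_add_lam_pos ((i : ℤ) + 1))).ne'
    field_simp
    linarith
  · omega
  · omega
  · simp

theorem span_sineH_orthogonal :
    (Submodule.span ℝ (Set.range fun k : ℕ => (√(1 + lam (k + 1)))⁻¹ • sineH (k + 1)))ᗮ = ⊥ := by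
  rw [Submodule.eq_bot_iff]
  intro U hU
  rw [Submodule.mem_orthogonal] at hU
  refine H10.toL2_injective ?_
  rw [map_zero]
  refine L2.ext_sc fun k => ?_
  rw [sc_zero]
  cases k with
  | zero => simp [sc_zero_right]
  | succ k =>
    have := hU _ (Submodule.subset_span ⟨k, rfl⟩)
    dsimp only at this
    rw [H10.inner_smul_left, inner_sineH] at this
    have h0 := (Real.sqrt_pos.2 (one_add_lam_pos ((k : ℤ) + 1))).ne'
    have h1 := (one_add_lam_pos ((k : ℤ) + 1)).ne'
    simpa [h0, h1] using this

instance : CompleteSpace H10 :=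
  (Submodule.isClosed_topologicalClosure testGraph).completeSpace_coe

/-- The normalized sines form an orthonormal basis of `H¹₀(0,1)`. -/
def sineBasisH : HilbertBasis ℕ ℝ H10 :=
  HilbertBasis.mkOfOrthogonalEqBot orthonormal_sineH span_sineH_orthogonal

theorem sineBasisH_apply (k : ℕ) :
    sineBasisH k = (√(1 + lam (k + 1)))⁻¹ • sineH (k + 1) := by simp [sineBasisH]

theorem inner_sineBasisH (k : ℕ) (U : H10) :
    inner ℝ (sineBasisH k) U = √(1 + lam (k + 1)) * sc (toL2 U) (k + 1) := by
  rw [sineBasisH_apply, H10.inner_smul_left, inner_sineH]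
  have := Real.mul_self_sqrt (one_add_lam_pos (k + 1)).le
  have h0 := (Real.sqrt_pos.2 (one_add_lam_pos ((k : ℤ) + 1))).ne'
  field_simp
  linear_combination (-sc (toL2 U) (k + 1)) * this

theorem H10.hasSum_sineH (U : H10) : HasSum (fun k : ℕ => sc (toL2 U) k • sineH k) U := by
  refine hasSum_nat_of_succ (by simp [sc_zero_right]) ?_
  refine (sineBasisH.hasSum_repr U).congr_fun fun k => ?_
  rw [HilbertBasis.repr_apply_apply, inner_sineBasisH, sineBasisH_apply, smul_smul]
  have h0 := (Real.sqrt_pos.2 (one_add_lam_pos ((k : ℤ) + 1))).ne'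
  push_cast
  congr 1
  field_simp

theorem H10.hasSum_norm_sq (U : H10) :
    HasSum (fun k : ℕ => (1 + lam k) * sc (toL2 U) k ^ 2) (‖U‖ ^ 2) := by
  refine hasSum_nat_of_succ (by simp [sc_zero_right]) ?_
  have := sineBasisH.hasSum_inner_mul_inner U U
  rw [real_inner_self_eq_norm_sq] at this
  refine this.congr_fun fun k => ?_
  rw [real_inner_comm, inner_sineBasisH]
  have := Real.mul_self_sqrt (one_add_lam_pos (k + 1)).le
  push_cast
  linear_combination (-sc (toL2 U) (k + 1) ^ 2) * this

theorem H10.hasSum_lam_mul_sq (U : H10) :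
    HasSum (fun k : ℕ => lam k * sc (toL2 U) k ^ 2) (‖dx U‖ ^ 2) := by
  have h := (H10.hasSum_norm_sq U).sub (hasSum_sc_sq (toL2 U))
  rw [H10.norm_sq, add_sub_cancel_left] at h
  exact h.congr_fun fun k => by ring

/-- Riesz–Fischer in `H¹₀(0,1)`. -/
theorem H10.exists_sc_eq (a : ℕ → ℝ) (h0 : a 0 = 0)
    (ha : Summable fun k : ℕ => (1 + lam k) * a k ^ 2) :
    ∃ U : H10, ∀ k : ℕ, sc (toL2 U) k = a k := by
  have hm : Memℓp (fun k : ℕ => √(1 + lam (k + 1)) * a (k + 1)) 2 := by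
    refine memℓp_gen ?_
    have := (summable_nat_add_iff 1).2 ha
    refine this.congr fun k => ?_
    push_cast
    simp [mul_pow, Real.sq_sqrt (one_add_lam_pos _).le]
  refine ⟨sineBasisH.repr.symm ⟨_, hm⟩, fun k => ?_⟩
  cases k with
  | zero => simp [h0, sc_zero_right]
  | succ k =>
    have := sineBasisH.repr_apply_apply (sineBasisH.repr.symm ⟨_, hm⟩) k
    rw [inner_sineBasisH] at this
    simp only [LinearIsometryEquiv.apply_symm_apply] at this
    have h0 := (Real.sqrt_pos.2 (one_add_lam_pos ((k : ℤ) + 1))).ne'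
    push_cast
    exact (mul_left_cancel₀ h0 this).symm

/-- A function with `∑ (kπ)² u_k² < ∞` belongs to `H¹₀(0,1)`. -/
theorem mem_range_toL2 (w : L2) (hw : Summable fun k : ℕ => lam k * sc w k ^ 2) :
    ∃ U : H10, toL2 U = w := by
  obtain ⟨U, hU⟩ := H10.exists_sc_eq (fun k => sc w k) (sc_zero_right w)
    (((hasSum_sc_sq w).summable.add hw).congr fun k => by ring)
  exact ⟨U, L2.ext_sc hU⟩

/-! ### The convection term -/

theorem memLp_mul (U : H10) (w : L2) : MemLp (fun x => toL2 U x * w x) 2 μI := by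
  refine (Lp.memLp w).of_le_mul (c := ‖dx U‖)
    ((Lp.aestronglyMeasurable _).mul (Lp.aestronglyMeasurable _)) ?_
  filter_upwards [H10.abs_le_norm_dx U] with x hx
  rw [norm_mul]
  exact mul_le_mul_of_nonneg_right hx (norm_nonneg _)

theorem norm_mul_toLp_le (U : H10) (w : L2) :
    ‖(memLp_mul U w).toLp _‖ ≤ ‖dx U‖ * ‖w‖ := by
  refine Lp.norm_le_mul_norm_of_ae_le_mul ?_
  filter_upwards [(memLp_mul U w).coeFn_toLp, H10.abs_le_norm_dx U] with x h1 h2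
  rw [h1, norm_mul]
  exact mul_le_mul_of_nonneg_right h2 (norm_nonneg _)

theorem H10.norm_dx_le (U : H10) : ‖dx U‖ ≤ ‖U‖ := by
  refine le_of_sq_le_sq ?_ (norm_nonneg _)
  rw [H10.norm_sq]; linarith [sq_nonneg ‖toL2 U‖]

/-- Pointwise multiplication `H¹₀ × L² → L²`. -/
def mulL : H10 →L[ℝ] L2 →L[ℝ] L2 :=
  LinearMap.mkContinuous₂
    (LinearMap.mk₂ ℝ (fun U w => (memLp_mul U w).toLp _)
      (fun U V w => by
        rw [← MemLp.toLp_add]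
        refine MemLp.toLp_congr _ _ ?_
        filter_upwards [Lp.coeFn_add (toL2 U) (toL2 V)] with x hx
        rw [map_add, hx, Pi.add_apply, Pi.add_apply, add_mul])
      (fun c U w => by
        rw [← MemLp.toLp_const_smul]
        refine MemLp.toLp_congr _ _ ?_
        filter_upwards [Lp.coeFn_smul c (toL2 U)] with x hx
        rw [map_smul, hx, Pi.smul_apply, Pi.smul_apply, smul_eq_mul, smul_eq_mul, mul_assoc])
      (fun U v w => by
        rw [← MemLp.toLp_add]
        refine MemLp.toLp_congr _ _ ?_
        filter_upwards [Lp.coeFn_add v w] with x hx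
        rw [hx, Pi.add_apply, Pi.add_apply, mul_add])
      (fun c U w => by
        rw [← MemLp.toLp_const_smul]
        refine MemLp.toLp_congr _ _ ?_
        filter_upwards [Lp.coeFn_smul c w] with x hx
        rw [hx, Pi.smul_apply, Pi.smul_apply, smul_eq_mul, smul_eq_mul]; ring)) 1
    (fun U w => by
      rw [one_mul]
      exact (norm_mul_toLp_le U w).trans
        (mul_le_mul_of_nonneg_right (H10.norm_dx_le U) (norm_nonneg _)))

theorem coeFn_mulL (U : H10) (w : L2) : mulL U w =ᵐ[μI] fun x => toL2 U x * w x :=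
  (memLp_mul U w).coeFn_toLp

theorem norm_mulL_le (U : H10) (w : L2) : ‖mulL U w‖ ≤ ‖dx U‖ * ‖w‖ := norm_mul_toLp_le U w

/-- The square `u²` of a function in `H¹₀(0,1)`, as an element of `L²(0,1)`. -/
def sqL (U : H10) : L2 := mulL U (toL2 U)

theorem continuous_sqL : Continuous sqL := by unfold sqL; fun_prop

theorem coeFn_sqL (U : H10) : sqL U =ᵐ[μI] fun x => toL2 U x * toL2 U x := coeFn_mulL _ _

theorem norm_sqL_le (U : H10) : ‖sqL U‖ ≤ ‖dx U‖ * ‖toL2 U‖ := norm_mulL_le _ _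

theorem convection_eq_inner_mulL (U V : H10) :
    convection U V = inner ℝ (mulL U (dx U)) (toL2 V) := by
  rw [convection, inner_eq_integral]
  refine integral_congr_ae ?_
  filter_upwards [coeFn_mulL U (dx U)] with x hx
  rw [hx]

/-- The conservation form `(u u_x, v) = -(u², v_x)/2`. -/
theorem convection_eq (U V : H10) : convection U V = -(1 / 2) * inner ℝ (sqL U) (dx V) := by
  set g := dx U
  set h := dx V
  have hg := L2.intervalIntegrable g
  have hh := L2.intervalIntegrable h
  have hcont : ContinuousOn (prim g) (Set.uIcc 0 1) := by
    rw [Set.uIcc_of_le zero_le_one]; exact continuousOn_prim g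
  have hgu : IntervalIntegrable (fun x => g x * prim g x + prim g x * g x) volume 0 1 :=
    (hg.mul_continuousOn hcont).add (hg.continuousOn_mul hcont)
  have hsq : ∀ t ∈ Set.Icc (0 : ℝ) 1, prim g t * prim g t = prim g 0 * prim g 0 +
      ∫ x in (0 : ℝ)..t, (g x * prim g x + prim g x * g x) := fun t ht => by
    rw [integral_mul_add_mul ht.1 (L2.intervalIntegrable' g ht) (L2.intervalIntegrable' g ht)
      (fun s _ => prim_eq g s) (fun s _ => prim_eq g s)]
    ring
  have key := integral_mul_add_mul (F := fun x => prim g x * prim g x) (H := prim h)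
    zero_le_one hgu hh hsq (fun t _ => prim_eq h t)
  rw [H10.prim_dx_one V, prim_zero_right, mul_zero, zero_mul, zero_mul, sub_zero,
    ← integral_unitInterval] at key
  have h1 : ∫ x, ((g x * prim g x + prim g x * g x) * prim h x + prim g x * prim g x * h x) ∂μI =
      2 * convection U V + inner ℝ (sqL U) h := by
    rw [convection_eq_inner_mulL, inner_eq_integral, inner_eq_integral, ← integral_const_mul,
      ← integral_add ((L2.integrable_mul _ _).const_mul 2) (L2.integrable_mul _ _)]
    refine integral_congr_ae ?_
    filter_upwards [coeFn_mulL U (dx U), coeFn_sqL U, H10.coeFn_toL2 U, H10.coeFn_toL2 V]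
      with x e1 e2 e3 e4
    rw [e1, e2, e3, e4]; ring
  linarith

/-- On a sine, the convection term is given by the coefficient `bf`. -/
theorem convection_sineH (U : H10) (k : ℤ) : convection U (sineH k) = - bf (toL2 U) k := by
  rw [convection_eq, bf, inner_eq_integral]
  have h2 : √2 * √2 = (2 : ℝ) := Real.mul_self_sqrt (by norm_num)
  have h1 : ∫ x, sqL U x * dx (sineH k) x ∂μI =
      √2 * (k * Real.pi) * ∫ x, toL2 U x * toL2 U x * Real.cos (k * Real.pi * x) ∂μI := by
    rw [← integral_const_mul]
    refine integral_congr_ae ?_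
    filter_upwards [coeFn_sqL U, coeFn_dx_sineH k] with x e1 e2
    rw [e1, e2]; ring
  rw [h1]
  generalize ∫ x, toL2 U x * toL2 U x * Real.cos (k * Real.pi * x) ∂μI = J
  have h3 : √2 ≠ 0 := by positivity
  field_simp
  linear_combination (-J * k) * h2

/-- The nonlinearity does no work: `(u u_x, u) = 0`. -/
theorem convection_self (U : H10) : convection U U = 0 := by
  have h1 := convection_eq U U
  have h2 : inner ℝ (sqL U) (dx U) = convection U U := by
    rw [convection_eq_inner_mulL, inner_eq_integral, inner_eq_integral]
    refine integral_congr_ae ?_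
    filter_upwards [coeFn_mulL U (dx U), coeFn_sqL U] with x e1 e2
    rw [e1, e2]; ring
  linarith

/-- The convection term as a series in sine coefficients. -/
theorem hasSum_bf_mul_sc (U V : H10) :
    HasSum (fun k : ℕ => bf (toL2 U) k * sc (toL2 V) k) (-convection U V) := by
  have h := (((innerSL ℝ (sqL U)).comp dx).hasSum (H10.hasSum_sineH V)).mul_left (1 / 2)
  have e : -convection U V = 1 / 2 * ((innerSL ℝ (sqL U)).comp dx) V := by
    rw [convection_eq]; simp
  rw [e]
  refine h.congr_fun fun k => ?_
  have := convection_sineH U k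
  rw [convection_eq] at this
  simp only [ContinuousLinearMap.comp_apply, map_smul, innerSL_apply_apply,
    smul_eq_mul]
  linear_combination (sc (toL2 V) k) * this

/-! ### Mild solutions -/

/-- Variation of constants for a scalar equation `y' = -l y + h`. -/
theorem mild_iff_integral {l t₀ T : ℝ} {y h : ℝ → ℝ} (hT : t₀ ≤ T)
    (hh : IntervalIntegrable h volume t₀ T) (hy : ContinuousOn y (Set.Icc t₀ T)) :
    (∀ t ∈ Set.Icc t₀ T, y t = Real.exp (-l * (t - t₀)) * y t₀ +
      ∫ r in t₀..t, Real.exp (-l * (t - r)) * h r) ↔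
    ∀ t ∈ Set.Icc t₀ T, y t = y t₀ + ∫ r in t₀..t, (h r - l * y r) := by
  have hsub : ∀ t ∈ Set.Icc t₀ T, IntervalIntegrable h volume t₀ t := fun t ht =>
    hh.mono_set (by
      rw [Set.uIcc_of_le ht.1, Set.uIcc_of_le hT]; exact Set.Icc_subset_Icc_right ht.2)
  have hexp : ∀ c d t : ℝ, Real.exp (c * (t - d)) = Real.exp (c * (t₀ - d)) +
      ∫ r in t₀..t, c * Real.exp (c * (r - d)) := fun c d t => by
    have hd : ∀ r, HasDerivAt (fun r => Real.exp (c * (r - d))) (c * Real.exp (c * (r - d))) r :=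
      fun r => by
        have := (((hasDerivAt_id r).sub_const d).const_mul c).exp
        simpa [mul_comm] using this
    rw [intervalIntegral.integral_eq_sub_of_hasDerivAt (fun r _ => hd r)
      ((by fun_prop : Continuous fun r => c * Real.exp (c * (r - d))).intervalIntegrable _ _)]
    ring
  constructor
  · intro H t ht
    have hint : IntervalIntegrable (fun r => Real.exp (l * (r - t₀)) * h r) volume t₀ t :=
      (hsub t ht).continuousOn_mul (by fun_prop)
    have hz : ∀ s ∈ Set.Icc t₀ t, Real.exp (l * (s - t₀)) * y s =
        Real.exp (l * (t₀ - t₀)) * y t₀ + ∫ r in t₀..s, Real.exp (l * (r - t₀)) * h r := by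
      intro s hs
      rw [H s ⟨hs.1, hs.2.trans ht.2⟩, mul_add, ← mul_assoc, ← Real.exp_add,
        ← intervalIntegral.integral_const_mul, sub_self, mul_zero, Real.exp_zero]
      congr 1
      · ring_nf; simp
      · refine intervalIntegral.integral_congr fun r _ => ?_
        simp only [← mul_assoc, ← Real.exp_add]
        ring_nf
    -- Integrate `e^{l(r - t₀)} y(r)` against `e^{-l(r - t₀)}` by parts.
    have key := integral_mul_add_mul ht.1 hint
      ((by fun_prop : Continuous fun r => -l * Real.exp (-l * (r - t₀))).intervalIntegrable _ _)
      (F := fun s => Real.exp (l * (s - t₀)) * y s) (H := fun s => Real.exp (-l * (s - t₀)))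
      hz (fun s _ => hexp (-l) t₀ s)
    have e : ∀ s a, Real.exp (l * (s - t₀)) * a * Real.exp (-l * (s - t₀)) = a := fun s a => by
      rw [mul_right_comm, ← Real.exp_add]; ring_nf; simp
    simp only [e] at key
    rw [← sub_eq_iff_eq_add', ← key]
    refine intervalIntegral.integral_congr fun r _ => ?_
    show _ = h r - l * y r
    have := e r (y r)
    linear_combination -l * this
  · intro H t ht
    have hg : IntervalIntegrable (fun r => h r - l * y r) volume t₀ t :=
      (hsub t ht).sub ((hy.mono (Set.Icc_subset_Icc_right ht.2)).intervalIntegrable_of_Icc ht.1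
        |>.const_mul l)
    -- Multiply by the integrating factor `e^{l(r - t)}`.
    have key := integral_mul_add_mul ht.1 hg
      ((by fun_prop : Continuous fun r => l * Real.exp (l * (r - t))).intervalIntegrable _ _)
      (F := y) (H := fun s => Real.exp (l * (s - t)))
      (fun s hs => H s ⟨hs.1, hs.2.trans ht.2⟩) (fun s _ => hexp l t s)
    simp only [sub_self, mul_zero, Real.exp_zero, mul_one] at key
    rw [← sub_eq_iff_eq_add']
    rw [show -l * (t - t₀) = l * (t₀ - t) by ring, mul_comm _ (y t₀), ← key]
    refine intervalIntegral.integral_congr fun r _ => ?_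
    show _ = Real.exp (-l * (t - r)) * h r
    rw [show -l * (t - r) = l * (r - t) by ring]; ring

/-- A continuous curve `u : [t₀, ∞) → L²(0,1)` is a mild solution of
`u_t - u_xx + (P(u)²/2)_x = f` if its sine coefficients satisfy the variation of constants formula.
The map `P` is the identity for the Burgers equation, and a radial projection for the truncated
equation by which solutions are constructed. -/
structure IsMild (f : ℝ → L2) (P : L2 → L2) (t₀ : ℝ) (u : ℝ → L2) : Prop where
  cont : ContinuousOn u (Set.Ici t₀)
  eq : ∀ k : ℕ, ∀ t, t₀ ≤ t → sc (u t) k = Real.exp (-lam k * (t - t₀)) * sc (u t₀) k +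
    ∫ r in t₀..t, Real.exp (-lam k * (t - r)) * (sc (f r) k + bf (P (u r)) k)

/-- An essentially bounded force, with a bound. -/
structure IsForce (f : ℝ → L2) (F : ℝ) : Prop where
  meas : AEStronglyMeasurable f volume
  nonneg : 0 ≤ F
  bound : ∀ᵐ t, ‖f t‖ ≤ F

theorem exists_isForce {f : ℝ → L2} (hf : MemLp f ⊤ volume) : ∃ F, IsForce f F := by
  refine ⟨(eLpNorm f ⊤ volume).toReal, hf.1, ENNReal.toReal_nonneg, ?_⟩
  filter_upwards [ae_le_eLpNormEssSup (f := f) (μ := volume)] with t ht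
  have h2 := hf.2.ne
  rw [eLpNorm_exponent_top] at h2 ⊢
  rw [← toReal_enorm]
  exact ENNReal.toReal_mono h2 ht

/-- Truncations: `P u` is a multiple `c u` with `0 ≤ c ≤ 1`, depending continuously on `u`. -/
structure IsTrunc (P : L2 → L2) : Prop where
  cont : Continuous P
  smul : ∀ u, ∃ c : ℝ, 0 ≤ c ∧ c ≤ 1 ∧ P u = c • u

theorem isTrunc_id : IsTrunc id := ⟨continuous_id, fun u => ⟨1, by simp⟩⟩

theorem IsForce.intervalIntegrable {f : ℝ → L2} {F : ℝ} (hf : IsForce f F) (k : ℤ) (a b : ℝ) :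
    IntervalIntegrable (fun r => sc (f r) k) volume a b := by
  rw [intervalIntegrable_iff]
  refine Measure.integrableOn_of_bounded (M := F) (by simp)
    ((continuous_sc k).comp_aestronglyMeasurable hf.meas) ?_
  filter_upwards [ae_restrict_of_ae hf.bound] with t ht
  exact (abs_sc_le _ _).trans ht

namespace IsMild

variable {f : ℝ → L2} {F : ℝ} {P : L2 → L2} {t₀ : ℝ} {u : ℝ → L2}

theorem continuousOn_bf (hP : IsTrunc P) (hu : IsMild f P t₀ u) (k : ℕ) :
    ContinuousOn (fun r => bf (P (u r)) k) (Set.Ici t₀) :=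
  ((continuous_bf k).comp hP.cont).comp_continuousOn hu.cont

theorem continuousOn_sc (hu : IsMild f P t₀ u) (k : ℤ) :
    ContinuousOn (fun r => sc (u r) k) (Set.Ici t₀) :=
  (continuous_sc k).comp_continuousOn hu.cont

theorem intervalIntegrable (hf : IsForce f F) (hP : IsTrunc P) (hu : IsMild f P t₀ u) (k : ℕ)
    {s T : ℝ} (hs : t₀ ≤ s) (hT : s ≤ T) :
    IntervalIntegrable (fun r => sc (f r) k + bf (P (u r)) k) volume s T :=
  (hf.intervalIntegrable k s T).add (((hu.continuousOn_bf hP k).mono fun _ hr =>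
    hs.trans hr.1).intervalIntegrable_of_Icc hT)

/-- The integrated equation for one coefficient. -/
theorem integral_eq (hf : IsForce f F) (hP : IsTrunc P) (hu : IsMild f P t₀ u) (k : ℕ)
    {s t : ℝ} (hs : t₀ ≤ s) (ht : s ≤ t) :
    sc (u t) k = sc (u s) k + ∫ r in s..t, (sc (f r) k + bf (P (u r)) k - lam k * sc (u r) k) := by
  have h := (mild_iff_integral (hs.trans ht)
    (hu.intervalIntegrable hf hP k le_rfl (hs.trans ht))
    ((hu.continuousOn_sc k).mono Set.Icc_subset_Ici_self)).1 (fun t ht => hu.eq k t ht.1)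
  have i2 : ∀ a b, t₀ ≤ a → a ≤ b → IntervalIntegrable
      (fun r => sc (f r) k + bf (P (u r)) k - lam k * sc (u r) k) volume a b := fun a b ha hab =>
    (hu.intervalIntegrable hf hP k ha hab).sub (((hu.continuousOn_sc k).mono fun _ hr =>
      ha.trans hr.1).intervalIntegrable_of_Icc hab |>.const_mul _)
  rw [h t ⟨hs.trans ht, le_rfl⟩, h s ⟨hs, ht⟩, add_assoc,
    intervalIntegral.integral_add_adjacent_intervals (i2 _ _ le_rfl hs) (i2 _ _ hs ht)]

/-- The restriction of a mild solution to a later half-line is a mild solution. -/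
theorem restart (hf : IsForce f F) (hP : IsTrunc P) (hu : IsMild f P t₀ u) {s : ℝ}
    (hs : t₀ ≤ s) : IsMild f P s u where
  cont := hu.cont.mono (Set.Ici_subset_Ici.2 hs)
  eq k t ht := (mild_iff_integral ht (hu.intervalIntegrable hf hP k hs ht)
    ((hu.continuousOn_sc k).mono fun _ hr => hs.trans hr.1)).2
    (fun _ hr => hu.integral_eq hf hP k hs hr.1) t ⟨ht, le_rfl⟩

end IsMild

theorem integral_exp_le {l : ℝ} (hl : 0 < l) (s t : ℝ) :
    ∫ r in s..t, Real.exp (-l * (t - r)) ≤ 1 / l := by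
  have hd : ∀ r, HasDerivAt (fun r => Real.exp (-l * (t - r)) / l) (Real.exp (-l * (t - r))) r :=
    fun r => by
      have := ((((hasDerivAt_id r).const_sub t).const_mul (-l)).exp).div_const l
      convert! this using 1
      simp; field_simp
  rw [intervalIntegral.integral_eq_sub_of_hasDerivAt (fun r _ => hd r)
    ((by fun_prop : Continuous fun r => Real.exp (-l * (t - r))).intervalIntegrable _ _)]
  simp only [sub_self, mul_zero, Real.exp_zero]
  have : 0 ≤ Real.exp (-l * (t - s)) / l := by positivity
  linarith

theorem lam_pos {k : ℕ} (hk : 0 < k) : 0 < lam k := by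
  rw [lam]; have := Real.pi_pos; push_cast; positivity

theorem sq_le_lam (k : ℕ) : (k : ℝ) ^ 2 ≤ lam k := by
  rw [lam, mul_pow]; push_cast
  have := Real.pi_gt_three
  exact le_mul_of_one_le_right (sq_nonneg _) (by nlinarith)

/-- Smoothing of one mode: after time `τ` the coefficient has forgotten its initial value. -/
theorem IsMild.lam_mul_abs_sc_le {f : ℝ → L2} {F : ℝ} {P : L2 → L2} {s : ℝ} {u : ℝ → L2}
    (hf : IsForce f F) (hu : IsMild f P s u) {k : ℕ} {R G τ t : ℝ} (hτ : 0 < τ)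
    (hR : |sc (u s) k| ≤ R) (ht : s + τ ≤ t)
    (hG : ∀ r ∈ Set.Icc s t, |bf (P (u r)) k| ≤ G) :
    lam k * |sc (u t) k| ≤ R / τ + F + G := by
  have hst : s ≤ t := by linarith
  have hR0 : 0 ≤ R := (abs_nonneg _).trans hR
  have hG0 : 0 ≤ G := (abs_nonneg _).trans (hG s ⟨le_rfl, hst⟩)
  have hF0 := hf.nonneg
  rcases Nat.eq_zero_or_pos k with rfl | hk
  · simp [sc_zero_right]; positivity
  have hl := lam_pos hk
  rw [hu.eq k t hst]
  have h1 : |∫ r in s..t, Real.exp (-lam k * (t - r)) * (sc (f r) k + bf (P (u r)) k)| ≤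
      (F + G) * (1 / lam k) := by
    have h2 : |∫ r in s..t, Real.exp (-lam k * (t - r)) * (sc (f r) k + bf (P (u r)) k)| ≤
        ∫ r in s..t, Real.exp (-lam k * (t - r)) * (F + G) := by
      rw [← Real.norm_eq_abs]
      refine intervalIntegral.norm_integral_le_of_norm_le hst ?_
        ((by fun_prop : Continuous fun r =>
          Real.exp (-lam k * (t - r)) * (F + G)).intervalIntegrable _ _)
      filter_upwards [hf.bound] with r hr hmem
      rw [norm_mul, Real.norm_eq_abs, abs_of_pos (Real.exp_pos _)]
      refine mul_le_mul_of_nonneg_left ?_ (Real.exp_pos _).le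
      exact (norm_add_le _ _).trans (add_le_add ((abs_sc_le _ _).trans hr)
        (hG r (Set.Ioc_subset_Icc_self hmem)))
    rw [intervalIntegral.integral_mul_const, mul_comm] at h2
    exact h2.trans (mul_le_mul_of_nonneg_left (integral_exp_le hl s t) (by positivity))
  have h3 : lam k * Real.exp (-lam k * (t - s)) ≤ 1 / τ := by
    have hx : 0 < lam k * (t - s) := mul_pos hl (by linarith)
    have h4 := Real.add_one_le_exp (lam k * (t - s))
    rw [neg_mul, Real.exp_neg, ← div_eq_mul_inv, div_le_div_iff₀ (Real.exp_pos _) hτ]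
    nlinarith
  calc lam k * |_| ≤ lam k * (|Real.exp (-lam k * (t - s)) * sc (u s) k| +
        |∫ r in s..t, Real.exp (-lam k * (t - r)) * (sc (f r) k + bf (P (u r)) k)|) :=
        mul_le_mul_of_nonneg_left (abs_add_le _ _) hl.le
    _ ≤ lam k * (Real.exp (-lam k * (t - s)) * R + (F + G) * (1 / lam k)) := by
        rw [abs_mul, abs_of_pos (Real.exp_pos _)]; gcongr
    _ = lam k * Real.exp (-lam k * (t - s)) * R + (F + G) := by field_simp
    _ ≤ 1 / τ * R + (F + G) := by gcongr
    _ = _ := by ring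

theorem IsTrunc.abs_sc_le {P : L2 → L2} (hP : IsTrunc P) (u : L2) (k : ℤ) :
    |sc (P u) k| ≤ |sc u k| := by
  obtain ⟨c, h0, h1, hc⟩ := hP.smul u
  rw [hc, sc_smul, abs_mul, abs_of_nonneg h0]
  exact mul_le_of_le_one_left (abs_nonneg _) h1

theorem IsTrunc.norm_le {P : L2 → L2} (hP : IsTrunc P) (u : L2) : ‖P u‖ ≤ ‖u‖ := by
  obtain ⟨c, h0, h1, hc⟩ := hP.smul u
  rw [hc, norm_smul, Real.norm_eq_abs, abs_of_nonneg h0]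
  exact mul_le_of_le_one_left (norm_nonneg _) h1

/-- The smoothing step: if the coefficients of the nonlinearity grow at most like `k^(1-β)`, the
solution has coefficients of size `k^(-1-β)` after time `τ`. -/
theorem IsMild.abs_sc_le_rpow {f : ℝ → L2} {F : ℝ} {P : L2 → L2} {s : ℝ} {u : ℝ → L2}
    (hf : IsForce f F) (hu : IsMild f P s u) {R A β τ T : ℝ} (hτ : 0 < τ)
    (hβ : β ≤ 1) (hβ' : 0 ≤ β) (hR : ‖u s‖ ≤ R)
    (hA : ∀ r ∈ Set.Icc s T, ∀ k : ℕ, |bf (P (u r)) k| ≤ A * (k : ℝ) ^ (1 - β)) :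
    ∀ t ∈ Set.Icc (s + τ) T, ∀ k : ℕ,
      |sc (u t) k| ≤ (R / τ + F + A) * (k : ℝ) ^ (-(1 + β)) := by
  intro t ht k
  rcases Nat.eq_zero_or_pos k with rfl | hk
  · have : -(1 + β) ≠ 0 := by linarith
    rw [Nat.cast_zero, Nat.cast_zero, Real.zero_rpow this]
    simp [sc_zero_right]
  have hk1 : (1 : ℝ) ≤ k := by exact_mod_cast hk
  have hk0 : (0 : ℝ) < k := by linarith
  have hR0 : 0 ≤ R := (norm_nonneg _).trans hR
  have hF0 := hf.nonneg
  have h := hu.lam_mul_abs_sc_le hf hτ ((abs_sc_le _ _).trans hR) ht.1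
    (fun r hr => hA r ⟨hr.1, hr.2.trans ht.2⟩ k)
  have h1 : (1 : ℝ) ≤ (k : ℝ) ^ (1 - β) := Real.one_le_rpow hk1 (by linarith)
  have h2 : (k : ℝ) ^ 2 * |sc (u t) k| ≤ (R / τ + F + A) * (k : ℝ) ^ (1 - β) :=
    calc (k : ℝ) ^ 2 * |sc (u t) k| ≤ lam k * |sc (u t) k| :=
          mul_le_mul_of_nonneg_right (sq_le_lam k) (abs_nonneg _)
      _ ≤ R / τ + F + A * (k : ℝ) ^ (1 - β) := h
      _ ≤ (R / τ + F) * (k : ℝ) ^ (1 - β) + A * (k : ℝ) ^ (1 - β) := by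
          gcongr; exact le_mul_of_one_le_right (by positivity) h1
      _ = _ := by ring
  have h3 : (k : ℝ) ^ (1 - β) = (k : ℝ) ^ 2 * (k : ℝ) ^ (-(1 + β)) := by
    rw [← Real.rpow_natCast, ← Real.rpow_add hk0]; congr 1; push_cast; ring
  rw [h3, mul_left_comm] at h2
  exact le_of_mul_le_mul_left h2 (by positivity)

/-- The functions whose sine coefficients decay like `k⁻²`. (For `k = 0` both sides vanish.) -/
def decaySet (D : ℝ) : Set L2 := {u | ∀ k : ℕ, |sc u k| ≤ D / (k : ℝ) ^ 2}

/-- Smoothing: a mild solution bounded in `L²` has sine coefficients of size `k⁻²` after any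
positive time, with a constant that depends only on the bounds. Each step gains decay from the
convolution structure of the nonlinearity. -/
theorem exists_mem_decaySet (R F : ℝ) {τ : ℝ} (hτ : 0 < τ) :
    ∃ D, 0 ≤ D ∧ ∀ (f : ℝ → L2) (P : L2 → L2) (s T : ℝ) (u : ℝ → L2), IsForce f F → IsTrunc P →
      IsMild f P s u → (∀ r ∈ Set.Icc s T, ‖u r‖ ≤ R) →
      ∀ t ∈ Set.Icc (s + τ) T, u t ∈ decaySet D := by
  -- Three steps, each on a third of the time: decay `k⁻¹` from the `L²` bound, then `k^(-3/2)`, then `k⁻²`.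
  obtain ⟨M₁, hM₁, H₁⟩ := exists_abs_bf_le_of_decay (α := 1) (β := 1 / 2)
    (by norm_num) (by norm_num) (by norm_num)
  obtain ⟨M₂, hM₂, H₂⟩ := exists_abs_bf_le_of_decay (α := 1 + 1 / 2) (β := 1)
    (by norm_num) (by norm_num) (by norm_num)
  have hτ3 : 0 < τ / 3 := by positivity
  set C₁ := R / (τ / 3) + F + Real.pi * R ^ 2 with hC₁
  set C₂ := R / (τ / 3) + F + M₁ * C₁ ^ 2 with hC₂
  set C₃ := R / (τ / 3) + F + M₂ * C₂ ^ 2 with hC₃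
  refine ⟨|C₃|, abs_nonneg _, fun f P s T u hf hP hu hR t ht => ?_⟩
  have hsT : s + τ ≤ T := ht.1.trans ht.2
  -- The bound in `L²` gives `|bf (P u) k| ≤ C k`, that is `β = 0`.
  have step1 := hu.abs_sc_le_rpow (β := 0) (A := Real.pi * R ^ 2) (T := T) hf hτ3 zero_le_one le_rfl
    (hR s ⟨le_rfl, by linarith⟩) (fun r hr k => by
      rw [sub_zero, Real.rpow_one]
      refine (abs_bf_le _ k).trans ?_
      have h1 := (hP.norm_le (u r)).trans (hR r hr)
      have h2 : ‖P (u r)‖ ^ 2 ≤ R ^ 2 := pow_le_pow_left₀ (norm_nonneg _) h1 2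
      have h3 : 0 ≤ (k : ℝ) * Real.pi := by positivity
      nlinarith)
  have hu1 := hu.restart hf hP (s := s + τ / 3) (by linarith)
  -- Decay `k⁻¹` allows `β = 1 / 2` but not `β = 1`, for which the convolution kernel is not summable.
  have step2 := hu1.abs_sc_le_rpow (β := 1 / 2) (A := M₁ * C₁ ^ 2) (T := T) hf hτ3
    (by norm_num) (by norm_num) (hR _ ⟨by linarith, by linarith⟩) (fun r hr k => by
      refine H₁ _ C₁ (fun j => (hP.abs_sc_le _ _).trans ?_) k
      have := step1 r hr j
      simpa using this)
  have hu2 := hu1.restart hf hP (s := s + τ / 3 + τ / 3) (by linarith)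
  have step3 := hu2.abs_sc_le_rpow (β := 1) (A := M₂ * C₂ ^ 2) (T := T) hf hτ3
    (by norm_num) (by norm_num) (hR _ ⟨by linarith, by linarith⟩) (fun r hr k =>
      H₂ _ C₂ (fun j => (hP.abs_sc_le _ _).trans (step2 r hr j)) k)
  intro k
  have h := step3 t ⟨by linarith [ht.1], ht.2⟩ k
  rw [show (-(1 + 1) : ℝ) = -((2 : ℕ) : ℝ) by norm_num, Real.rpow_neg (Nat.cast_nonneg k),
    Real.rpow_natCast, ← div_eq_mul_inv] at h
  exact h.trans (div_le_div_of_nonneg_right (le_abs_self _) (by positivity))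

/-! ### Functions with decaying sine coefficients -/

open Classical in
/-- The element of `H¹₀(0,1)` over a given element of `L²(0,1)`; zero if there is none. -/
def lift (w : L2) : H10 := if h : ∃ U : H10, toL2 U = w then h.choose else 0

theorem toL2_lift {w : L2} (h : ∃ U : H10, toL2 U = w) : toL2 (lift w) = w := by
  rw [lift, dif_pos h]; exact h.choose_spec

theorem lift_toL2 (U : H10) : lift (toL2 U) = U :=
  H10.toL2_injective (toL2_lift ⟨U, rfl⟩)

theorem lam_le (k : ℕ) : lam k ≤ Real.pi ^ 2 * (k : ℝ) ^ 2 := by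
  rw [lam, mul_pow, mul_comm]; push_cast; rfl

theorem summable_decay_sq (D : ℝ) : Summable fun k : ℕ => (1 + lam k) * (D / (k : ℝ) ^ 2) ^ 2 := by
  refine Summable.of_nonneg_of_le
    (fun k => mul_nonneg (one_add_lam_pos k).le (sq_nonneg _)) (fun k => ?_)
    ((Real.summable_one_div_nat_pow.2 (by norm_num : 1 < 2)).mul_left ((1 + Real.pi ^ 2) * D ^ 2))
  rcases Nat.eq_zero_or_pos k with rfl | hk
  · simp
  have hk1 : (1 : ℝ) ≤ (k : ℝ) ^ 2 := by
    have : (1 : ℝ) ≤ k := by exact_mod_cast hk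
    nlinarith
  have h1 : 1 + lam k ≤ (1 + Real.pi ^ 2) * (k : ℝ) ^ 2 := by
    have := lam_le k; nlinarith
  calc (1 + lam k) * (D / (k : ℝ) ^ 2) ^ 2
      ≤ ((1 + Real.pi ^ 2) * (k : ℝ) ^ 2) * (D / (k : ℝ) ^ 2) ^ 2 := by gcongr
    _ = _ := by field_simp

theorem summable_lam_mul_decay_sq (D : ℝ) :
    Summable fun k : ℕ => lam k * (D / (k : ℝ) ^ 2) ^ 2 :=
  (summable_decay_sq D).of_nonneg_of_le (fun k => mul_nonneg (lam_nonneg k) (sq_nonneg _))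
    (fun k => by nlinarith [sq_nonneg (D / (k : ℝ) ^ 2)])

theorem toL2_lift_of_mem {D : ℝ} {w : L2} (hw : w ∈ decaySet D) : toL2 (lift w) = w := by
  refine toL2_lift (mem_range_toL2 w ?_)
  refine (summable_lam_mul_decay_sq D).of_nonneg_of_le
    (fun k => mul_nonneg (lam_nonneg k) (sq_nonneg _)) (fun k => ?_)
  refine mul_le_mul_of_nonneg_left ?_ (lam_nonneg k)
  rw [← sq_abs]
  exact pow_le_pow_left₀ (abs_nonneg _) (hw k) 2

/-- A bound in `H¹₀` for the elements of `decaySet D`. -/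
def decayBound (D : ℝ) : ℝ := √(∑' k : ℕ, (1 + lam k) * (D / (k : ℝ) ^ 2) ^ 2)

theorem norm_le_decayBound {D : ℝ} {U : H10} (hU : toL2 U ∈ decaySet D) : ‖U‖ ≤ decayBound D := by
  refine Real.le_sqrt_of_sq_le ?_
  rw [← (H10.hasSum_norm_sq U).tsum_eq]
  refine (H10.hasSum_norm_sq U).summable.tsum_le_tsum (fun k => ?_) (summable_decay_sq D)
  refine mul_le_mul_of_nonneg_left ?_ (one_add_lam_pos k).le
  rw [← sq_abs]
  exact pow_le_pow_left₀ (abs_nonneg _) (hU k) 2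

/-- Convergence in `H¹₀` from convergence and domination of the sine coefficients. -/
theorem H10.tendsto_of_sc {ι : Type*} {l : Filter ι} {U : ι → H10} {V : H10} {D : ℝ}
    (hb : ∀ᶠ i in l, toL2 (U i) ∈ decaySet D) (hV : toL2 V ∈ decaySet D)
    (h : ∀ k : ℕ, Tendsto (fun i => sc (toL2 (U i)) k) l (𝓝 (sc (toL2 V) k))) :
    Tendsto U l (𝓝 V) := by
  rw [tendsto_iff_norm_sub_tendsto_zero]
  have h1 : Tendsto (fun i => ‖U i - V‖ ^ 2) l (𝓝 0) := by
    have e : ∀ i, ‖U i - V‖ ^ 2 = ∑' k : ℕ, (1 + lam k) * (sc (toL2 (U i)) k - sc (toL2 V) k) ^ 2 :=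
      fun i => by
        rw [← (H10.hasSum_norm_sq (U i - V)).tsum_eq]
        simp only [map_sub, sc_sub]
    simp only [e]
    have := tendsto_tsum_of_dominated_convergence (𝓕 := l)
      (f := fun i (k : ℕ) => (1 + lam k) * (sc (toL2 (U i)) k - sc (toL2 V) k) ^ 2)
      (g := fun _ => 0) (summable_decay_sq (2 * D)) (fun k => by
        have := (((h k).sub_const (sc (toL2 V) k)).pow 2).const_mul (1 + lam k)
        simpa using this) (by
        filter_upwards [hb] with i hi k
        rw [Real.norm_eq_abs, abs_of_nonneg (mul_nonneg (one_add_lam_pos k).le (sq_nonneg _))]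
        refine mul_le_mul_of_nonneg_left ?_ (one_add_lam_pos k).le
        rw [← sq_abs]
        refine pow_le_pow_left₀ (abs_nonneg _) ((abs_sub _ _).trans ?_) 2
        rw [mul_div_assoc, two_mul]
        exact add_le_add (hi k) (hV k))
    simpa using this
  have h2 := h1.sqrt
  simpa using h2

/-- A curve continuous in `L²` whose coefficients decay uniformly like `k⁻²` is continuous in `H¹₀`. -/
theorem continuousOn_lift {D : ℝ} {u : ℝ → L2} {I : Set ℝ} (hu : ContinuousOn u I)
    (hD : ∀ t ∈ I, u t ∈ decaySet D) : ContinuousOn (fun t => lift (u t)) I := by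
  intro t ht
  refine H10.tendsto_of_sc (D := D) ?_ ?_ fun k => ?_
  · filter_upwards [self_mem_nhdsWithin] with s hs
    rw [toL2_lift_of_mem (hD s hs)]; exact hD s hs
  · rw [toL2_lift_of_mem (hD t ht)]; exact hD t ht
  · rw [toL2_lift_of_mem (hD t ht)]
    refine Tendsto.congr' ?_ (((continuous_sc k).comp_continuousOn hu) t ht)
    filter_upwards [self_mem_nhdsWithin] with s hs
    rw [toL2_lift_of_mem (hD s hs)]; rfl

theorem exists_abs_bf_le_of_mem_decaySet :
    ∃ M : ℝ, 0 ≤ M ∧ ∀ (D : ℝ) (u : L2), u ∈ decaySet D →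
      ∀ k : ℕ, |bf u k| ≤ M * D ^ 2 / k := by
  obtain ⟨M, hM, h⟩ := exists_abs_bf_le_of_decay (α := 2) (β := 2)
    (by norm_num) (by norm_num) (by norm_num)
  refine ⟨M, hM, fun D u hu k => ?_⟩
  have := h u D (fun j => (hu j).trans (le_of_eq ?_)) k
  · rwa [show (1 - 2 : ℝ) = -1 by norm_num, Real.rpow_neg_one, ← div_eq_mul_inv] at this
  · rw [Real.rpow_neg (Nat.cast_nonneg j), div_eq_mul_inv]; norm_cast

theorem IsTrunc.mem_decaySet {P : L2 → L2} (hP : IsTrunc P) {D : ℝ} {u : L2}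
    (hu : u ∈ decaySet D) : P u ∈ decaySet D := fun k => (hP.abs_sc_le u k).trans (hu k)

/-- On compact subintervals of `(t₀, ∞)` the coefficients of a mild solution decay uniformly. -/
theorem IsMild.exists_mem_decaySet {f : ℝ → L2} {F : ℝ} {P : L2 → L2} {t₀ : ℝ} {u : ℝ → L2}
    (hf : IsForce f F) (hP : IsTrunc P) (hu : IsMild f P t₀ u) {s : ℝ} (hs : t₀ < s) (T : ℝ) :
    ∃ D, 0 ≤ D ∧ ∀ t ∈ Set.Icc s T, u t ∈ decaySet D := by
  obtain ⟨R, hR⟩ := isCompact_Icc.exists_bound_of_continuousOn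
    (hu.cont.mono (Set.Icc_subset_Ici_self : Set.Icc t₀ T ⊆ _))
  obtain ⟨D, hD, h⟩ := Burgers.exists_mem_decaySet R F (sub_pos.2 hs)
  refine ⟨D, hD, fun t ht => h f P t₀ T u hf hP hu hR t ?_⟩
  rwa [add_sub_cancel]

/-- After the initial time a mild solution takes values in `H¹₀(0,1)`. -/
theorem IsMild.toL2_lift {f : ℝ → L2} {F : ℝ} {P : L2 → L2} {t₀ : ℝ} {u : ℝ → L2}
    (hf : IsForce f F) (hP : IsTrunc P) (hu : IsMild f P t₀ u) {t : ℝ} (ht : t₀ < t) :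
    toL2 (lift (u t)) = u t := by
  obtain ⟨D, -, h⟩ := hu.exists_mem_decaySet hf hP ht t
  exact toL2_lift_of_mem (h t ⟨le_rfl, le_rfl⟩)

theorem IsMild.continuousOn_lift {f : ℝ → L2} {F : ℝ} {P : L2 → L2} {t₀ : ℝ} {u : ℝ → L2}
    (hf : IsForce f F) (hP : IsTrunc P) (hu : IsMild f P t₀ u) :
    ContinuousOn (fun t => lift (u t)) (Set.Ioi t₀) := by
  intro t ht
  obtain ⟨s, hs1, hs2⟩ := exists_between (Set.mem_Ioi.1 ht)
  obtain ⟨D, -, h⟩ := hu.exists_mem_decaySet hf hP hs1 (t + 1)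
  have := Burgers.continuousOn_lift (hu.cont.mono fun r hr => hs1.le.trans hr.1) h
  exact (this.continuousAt (Icc_mem_nhds hs2 (by linarith))).continuousWithinAt

/-! ### The energy identity -/

theorem IsMild.sc_sq_sub {f : ℝ → L2} {F : ℝ} {P : L2 → L2} {t₀ : ℝ} {u : ℝ → L2}
    (hf : IsForce f F) (hP : IsTrunc P) (hu : IsMild f P t₀ u) (k : ℕ) {s t : ℝ} (hs : t₀ ≤ s)
    (hst : s ≤ t) : sc (u t) k ^ 2 - sc (u s) k ^ 2 =
      ∫ r in s..t, 2 * (sc (u r) k * (sc (f r) k + bf (P (u r)) k - lam k * sc (u r) k)) := by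
  have hg : IntervalIntegrable (fun r => sc (f r) k + bf (P (u r)) k - lam k * sc (u r) k)
      volume s t :=
    (hu.intervalIntegrable hf hP k hs hst).sub (((hu.continuousOn_sc k).mono fun _ hr =>
      hs.trans hr.1).intervalIntegrable_of_Icc hst |>.const_mul _)
  have key := integral_mul_add_mul (F := fun r => sc (u r) k) (H := fun r => sc (u r) k) hst hg hg
    (fun r hr => hu.integral_eq hf hP k hs hr.1) (fun r hr => hu.integral_eq hf hP k hs hr.1)
  rw [sq, sq, ← key]
  refine intervalIntegral.integral_congr fun r _ => ?_
  ring

/-- The rate of change of `‖U‖²` as a series in sine coefficients. Truncation replaces `U` by `c U`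
in the nonlinearity, which only multiplies `(U U_x, U) = 0` by `c²`, so it does not affect the energy. -/
theorem H10.inner_force_hasSum {P : L2 → L2} (hP : IsTrunc P) (U : H10) (g : L2) :
    HasSum (fun k : ℕ => 2 * (sc (toL2 U) k *
      (sc g k + bf (P (toL2 U)) k - lam k * sc (toL2 U) k)))
      (2 * (inner ℝ g (toL2 U) - ‖dx U‖ ^ 2)) := by
  obtain ⟨c, -, -, hc⟩ := hP.smul (toL2 U)
  have h1 := hasSum_sc_mul g (toL2 U)
  have h2 := (hasSum_bf_mul_sc U U).mul_left (c ^ 2)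
  rw [convection_self, neg_zero, mul_zero] at h2
  have h3 := ((h1.add h2).sub (H10.hasSum_lam_mul_sq U)).mul_left 2
  rw [add_zero] at h3
  refine h3.congr_fun fun k => ?_
  rw [hc, bf_smul]; ring

/-- The energy identity between positive times. -/
theorem IsMild.energy {f : ℝ → L2} {F : ℝ} {P : L2 → L2} {t₀ : ℝ} {u : ℝ → L2}
    (hf : IsForce f F) (hP : IsTrunc P) (hu : IsMild f P t₀ u) {s t : ℝ} (hs : t₀ < s)
    (hst : s ≤ t) : ‖u t‖ ^ 2 - ‖u s‖ ^ 2 =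
      ∫ r in s..t, 2 * (inner ℝ (f r) (u r) - ‖dx (lift (u r))‖ ^ 2) := by
  obtain ⟨D, hD, hmem⟩ := hu.exists_mem_decaySet hf hP hs t
  obtain ⟨M, hM, hbf⟩ := exists_abs_bf_le_of_mem_decaySet
  have hF0 := hf.nonneg
  have hsum : HasSum (fun k : ℕ => sc (u t) k ^ 2 - sc (u s) k ^ 2) (‖u t‖ ^ 2 - ‖u s‖ ^ 2) :=
    (hasSum_sc_sq (u t)).sub (hasSum_sc_sq (u s))
  refine hsum.unique ?_
  simp only [hu.sc_sq_sub hf hP _ hs.le hst]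
  -- The energy identity for single coefficients is summed over `k`; the decay `k⁻²` justifies exchanging
  -- the sum with the integral.
  refine intervalIntegral.hasSum_integral_of_dominated_convergence
    (fun (k : ℕ) _ => 2 * D * (F + M * D ^ 2 + Real.pi ^ 2 * D) * (1 / (k : ℝ) ^ 2))
    (fun k => ?_) (fun k => ?_) ?_ ?_ ?_
  · have hg := ((hu.intervalIntegrable hf hP k hs.le hst).sub (((hu.continuousOn_sc k).mono
      fun _ hr => hs.le.trans hr.1).intervalIntegrable_of_Icc hst |>.const_mul (lam k)))
    have hc : ContinuousOn (fun r => sc (u r) k) (Set.uIcc s t) := by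
      rw [Set.uIcc_of_le hst]
      exact (hu.continuousOn_sc k).mono fun _ hr => hs.le.trans hr.1
    have := (hg.continuousOn_mul hc).const_mul 2
    rw [intervalIntegrable_iff] at this
    exact this.aestronglyMeasurable
  · filter_upwards [hf.bound] with r hr hmr
    rw [Set.uIoc_of_le hst] at hmr
    have hd := hmem r (Set.Ioc_subset_Icc_self hmr)
    rcases Nat.eq_zero_or_pos k with rfl | hk
    · simp [sc_zero_right]
    have hk1 : (1 : ℝ) ≤ k := by exact_mod_cast hk
    have e1 := hd k
    have e2 := (abs_sc_le (f r) k).trans hr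
    have e3 : |bf (P (u r)) k| ≤ M * D ^ 2 := (hbf D _ (hP.mem_decaySet hd) k).trans
      (div_le_self (by positivity) hk1)
    have e4 : |lam k * sc (u r) k| ≤ Real.pi ^ 2 * D := by
      rw [abs_mul, abs_of_nonneg (lam_nonneg k)]
      calc lam k * |sc (u r) k| ≤ (Real.pi ^ 2 * (k : ℝ) ^ 2) * (D / (k : ℝ) ^ 2) :=
            mul_le_mul (lam_le k) e1 (abs_nonneg _) (by positivity)
        _ = _ := by field_simp
    rw [norm_mul, norm_mul, Real.norm_eq_abs, Real.norm_eq_abs, Real.norm_eq_abs, abs_two]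
    have e5 : |sc (f r) k + bf (P (u r)) k - lam k * sc (u r) k| ≤
        F + M * D ^ 2 + Real.pi ^ 2 * D :=
      (abs_sub _ _).trans (add_le_add ((abs_add_le _ _).trans (add_le_add e2 e3)) e4)
    calc 2 * (|sc (u r) k| * _) ≤ 2 * (D / (k : ℝ) ^ 2 * (F + M * D ^ 2 + Real.pi ^ 2 * D)) := by
          gcongr
      _ = _ := by ring
  · exact Eventually.of_forall fun r _ =>
      (Real.summable_one_div_nat_pow.2 (by norm_num : 1 < 2)).mul_left _
  · exact _root_.intervalIntegrable_const
  · refine Eventually.of_forall fun r hr => ?_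
    rw [Set.uIoc_of_le hst] at hr
    have := H10.inner_force_hasSum hP (lift (u r)) (f r)
    rwa [toL2_lift_of_mem (hmem r (Set.Ioc_subset_Icc_self hr))] at this

theorem IsMild.intervalIntegrable_inner {f : ℝ → L2} {F : ℝ} {P : L2 → L2} {t₀ : ℝ} {u : ℝ → L2}
    (hf : IsForce f F) (hu : IsMild f P t₀ u) {s t : ℝ} (hs : t₀ ≤ s) (hst : s ≤ t) :
    IntervalIntegrable (fun r => (inner ℝ (f r) (u r) : ℝ)) volume s t := by
  have hc : ContinuousOn u (Set.Icc s t) := hu.cont.mono fun _ hr => hs.trans hr.1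
  obtain ⟨R, hR⟩ := isCompact_Icc.exists_bound_of_continuousOn hc
  rw [intervalIntegrable_iff_integrableOn_Icc_of_le hst]
  refine Integrable.of_bound
    (hf.meas.restrict.inner (hc.aestronglyMeasurable measurableSet_Icc)) (F * R) ?_
  filter_upwards [ae_restrict_of_ae hf.bound, ae_restrict_mem measurableSet_Icc] with r hr hmr
  exact (norm_inner_le_norm _ _).trans (mul_le_mul hr (hR r hmr) (norm_nonneg _) hf.nonneg)

theorem IsMild.intervalIntegrable_norm_dx_sq {f : ℝ → L2} {F : ℝ} {P : L2 → L2} {t₀ : ℝ}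
    {u : ℝ → L2} (hf : IsForce f F) (hP : IsTrunc P) (hu : IsMild f P t₀ u) {s t : ℝ}
    (hs : t₀ < s) (hst : s ≤ t) :
    IntervalIntegrable (fun r => ‖dx (lift (u r))‖ ^ 2) volume s t :=
  ((dx.continuous.comp_continuousOn ((hu.continuousOn_lift hf hP).mono
    fun _ hr => hs.trans_le hr.1)).norm.pow 2).intervalIntegrable_of_Icc hst

/-- Gronwall's inequality for `z' ≤ -z` in integrated form. -/
theorem le_exp_mul_of_sub_le_integral {z : ℝ → ℝ} {a b : ℝ} (hz : ContinuousOn z (Set.Icc a b))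
    (h : ∀ s t, a ≤ s → s ≤ t → t ≤ b → z t - z s ≤ ∫ r in s..t, -z r) :
    ∀ t ∈ Set.Icc a b, z t ≤ Real.exp (-(t - a)) * z a := by
  intro t ht
  have := le_gronwallBound_of_liminf_deriv_right_le (f := z) (f' := fun t => -z t) (δ := z a)
    (K := -1) (ε := 0) hz (fun x hx r hr => ?_) le_rfl (fun x _ => by simp) t ht
  · rwa [gronwallBound_ε0, mul_comm, neg_one_mul] at this
  · refine Eventually.frequently ?_
    have hcx : ContinuousWithinAt (fun r => -z r) (Set.Ioi x) x :=
      ((hz x (Set.Ico_subset_Icc_self hx)).mono_of_mem_nhdsWithin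
        (mem_of_superset (Ioo_mem_nhdsGT hx.2) fun y hy =>
          ⟨hx.1.trans hy.1.le, hy.2.le⟩)).neg
    obtain ⟨r', hr1, hr2⟩ := exists_between hr
    have hd : ∀ᶠ y in 𝓝[>] x, -z y < r' := hcx.eventually_lt_const hr1
    obtain ⟨y₀, hy₀, hsub⟩ := (mem_nhdsGT_iff_exists_Ioo_subset).1 hd
    filter_upwards [Ioo_mem_nhdsGT hx.2, Ioo_mem_nhdsGT hy₀] with y hy1 hy2
    have h1 : ∫ r in x..y, -z r ≤ ∫ _ in x..y, r' := by
      refine intervalIntegral.integral_mono_on hy1.1.le ?_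
        _root_.intervalIntegrable_const fun w hw => ?_
      · exact (hz.mono (Set.Icc_subset_Icc hx.1 hy1.2.le)).neg.intervalIntegrable_of_Icc hy1.1.le
      · rcases hw.1.eq_or_lt with rfl | hlt
        · exact hr1.le
        · exact (hsub ⟨hlt, hw.2.trans_lt hy2.2⟩).le
    rw [intervalIntegral.integral_const, smul_eq_mul] at h1
    have h2 := h x y hx.1 hy1.1.le hy1.2.le
    have h3 : 0 < y - x := sub_pos.2 hy1.1
    calc (y - x)⁻¹ * (z y - z x) ≤ (y - x)⁻¹ * ((y - x) * r') := by gcongr; linarith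
      _ = r' := by field_simp
      _ < r := hr2

/-- Dissipativity: the ball of radius `F` in `L²` attracts exponentially. The energy identity and
Poincaré's inequality give `(‖u‖² - F²)' ≤ -(‖u‖² - F²)`. -/
theorem IsMild.norm_sq_le {f : ℝ → L2} {F : ℝ} {P : L2 → L2} {t₀ : ℝ} {u : ℝ → L2}
    (hf : IsForce f F) (hP : IsTrunc P) (hu : IsMild f P t₀ u) {t : ℝ} (ht : t₀ ≤ t) :
    ‖u t‖ ^ 2 ≤ F ^ 2 + Real.exp (-(t - t₀)) * ‖u t₀‖ ^ 2 := by
  have hF0 := hf.nonneg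
  set z : ℝ → ℝ := fun t => ‖u t‖ ^ 2 - F ^ 2 with hz
  have hzc : ContinuousOn z (Set.Ici t₀) := (hu.cont.norm.pow 2).sub continuousOn_const
  have hzi : ∀ s t, t₀ ≤ s → s ≤ t → IntervalIntegrable (fun r => -z r) volume s t :=
    fun s t hs hst => (hzc.mono fun _ hr => hs.trans hr.1).neg.intervalIntegrable_of_Icc hst
  have h1 : ∀ s t, t₀ < s → s ≤ t → z t - z s ≤ ∫ r in s..t, -z r := by
    intro s t hs hst
    have e := hu.energy hf hP hs hst
    rw [hz, sub_sub_sub_cancel_right, e]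
    refine intervalIntegral.integral_mono_ae_restrict hst ?_ (hzi s t hs.le hst) ?_
    · exact ((hu.intervalIntegrable_inner hf hs.le hst).sub
        (hu.intervalIntegrable_norm_dx_sq hf hP hs hst)).const_mul 2
    · filter_upwards [ae_restrict_of_ae hf.bound, ae_restrict_mem measurableSet_Icc] with r hr hmr
      have e1 : |inner ℝ (f r) (u r)| ≤ F * ‖u r‖ := (abs_real_inner_le_norm _ _).trans
        (mul_le_mul_of_nonneg_right hr (norm_nonneg _))
      have e2 : ‖u r‖ ≤ ‖dx (lift (u r))‖ := by
        have := H10.norm_toL2_le (lift (u r))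
        rwa [hu.toL2_lift hf hP (hs.trans_le hmr.1)] at this
      have e3 : ‖u r‖ ^ 2 ≤ ‖dx (lift (u r))‖ ^ 2 := pow_le_pow_left₀ (norm_nonneg _) e2 2
      have e4 := le_abs_self (inner ℝ (f r) (u r) : ℝ)
      nlinarith [sq_nonneg (F - ‖u r‖)]
  -- The energy identity holds after the initial time only; the inequality extends by continuity.
  have h2 : ∀ s t, t₀ ≤ s → s ≤ t → z t - z s ≤ ∫ r in s..t, -z r := by
    intro s t hs hst
    rcases hst.eq_or_lt with rfl | hlt
    · simp
    have hi := hzi s t hs hst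
    have c1 : Tendsto (fun a => z t - z a) (𝓝[>] s) (𝓝 (z t - z s)) :=
      (((hzc s hs).mono (fun y hy => hs.trans (Set.mem_Ioi.1 hy).le)).const_sub (z t))
    have c2 : Tendsto (fun a => ∫ r in a..t, -z r) (𝓝[>] s) (𝓝 (∫ r in s..t, -z r)) := by
      have hc := intervalIntegral.continuousOn_primitive_interval_left (μ := volume)
        (f := fun r => -z r) (a := s) (b := t) (by
          rw [← intervalIntegrable_iff']; exact hi)
      have := hc s Set.left_mem_uIcc
      rw [Set.uIcc_of_le hst] at this
      exact this.mono_left (nhdsWithin_le_of_mem (mem_of_superset (Ioo_mem_nhdsGT hlt)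
        Set.Ioo_subset_Icc_self))
    refine le_of_tendsto_of_tendsto c1 c2 ?_
    filter_upwards [Ioo_mem_nhdsGT hlt] with a ha
    exact h1 a t (hs.trans_lt ha.1) ha.2.le
  have h3 := le_exp_mul_of_sub_le_integral (b := t) (hzc.mono Set.Icc_subset_Ici_self)
    (fun a b ha hab _ => h2 a b ha hab) t ⟨ht, le_rfl⟩
  simp only [hz] at h3
  have h4 := Real.exp_pos (-(t - t₀))
  nlinarith [mul_nonneg h4.le (sq_nonneg F)]

/-! ### Contraction, uniqueness and existence of mild solutions -/

theorem sq_div_lam_le (K : ℝ) {γ : ℝ} (hγ : 0 ≤ γ) (k : ℕ) :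
    (k * Real.pi * K / (lam k + γ)) ^ 2 ≤ K ^ 2 * (1 / (k : ℝ) ^ 2) := by
  rcases Nat.eq_zero_or_pos k with rfl | hk
  · simp
  have hl := lam_pos hk
  have hk0 : (0 : ℝ) < k := by exact_mod_cast hk
  have e : lam k = (k * Real.pi) ^ 2 := by rw [lam]; push_cast; rfl
  rw [div_pow, mul_pow, ← e]
  calc lam k * K ^ 2 / (lam k + γ) ^ 2 ≤ lam k * K ^ 2 / (lam k) ^ 2 := by gcongr; linarith
    _ = K ^ 2 * (1 / lam k) := by field_simp
    _ ≤ _ := by gcongr; exact sq_le_lam k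

theorem summable_sq_div_lam (K : ℝ) {γ : ℝ} (hγ : 0 ≤ γ) :
    Summable fun k : ℕ => (k * Real.pi * K / (lam k + γ)) ^ 2 :=
  ((Real.summable_one_div_nat_pow.2 (by norm_num : 1 < 2)).mul_left _).of_nonneg_of_le
    (fun _ => sq_nonneg _) (sq_div_lam_le K hγ)

/-- The weight `e^{γt}` makes the Duhamel operator a contraction when `γ` is large. -/
theorem exists_weight (K : ℝ) :
    ∃ γ : ℝ, 0 < γ ∧ ∑' k : ℕ, (k * Real.pi * K / (lam k + γ)) ^ 2 ≤ 1 / 4 := by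
  have h := tendsto_tsum_of_dominated_convergence (𝓕 := atTop)
    (f := fun (γ : ℝ) (k : ℕ) => (k * Real.pi * K / (lam k + γ)) ^ 2) (g := fun _ => 0)
    ((Real.summable_one_div_nat_pow.2 (by norm_num : 1 < 2)).mul_left (K ^ 2)) (fun k => by
      have h1 : Tendsto (fun γ : ℝ => lam k + γ) atTop atTop :=
        tendsto_atTop_add_const_left _ _ tendsto_id
      have := (h1.const_div_atTop (k * Real.pi * K)).pow 2
      simpa using this) (by
      filter_upwards [eventually_ge_atTop 0] with γ hγ k
      rw [Real.norm_eq_abs, abs_of_nonneg (sq_nonneg _)]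
      exact sq_div_lam_le K hγ k)
  rw [tsum_zero] at h
  obtain ⟨γ, h1, h2⟩ := ((h.eventually_le_const (by norm_num : (0 : ℝ) < 1 / 4)).and
    (eventually_gt_atTop 0)).exists
  exact ⟨γ, h2, h1⟩

theorem norm_sq_le_of_abs_sc_le {d : L2} {b : ℕ → ℝ} (hb : Summable fun k => b k ^ 2)
    (h : ∀ k : ℕ, |sc d k| ≤ b k) : ‖d‖ ^ 2 ≤ ∑' k, b k ^ 2 := by
  rw [← (hasSum_sc_sq d).tsum_eq]
  refine (hasSum_sc_sq d).summable.tsum_le_tsum (fun k => ?_) hb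
  rw [← sq_abs]
  exact pow_le_pow_left₀ (abs_nonneg _) (h k) 2

/-- A function is at most half as large as `m` if its coefficients have the size of the Duhamel
integral of a nonlinearity with Lipschitz constant `K`, with the weight of `exists_weight`. -/
theorem norm_le_half_of_abs_sc_le {d : L2} {K γ m : ℝ} (hγ : 0 < γ) (hm : 0 ≤ m)
    (hK : ∑' k : ℕ, (k * Real.pi * K / (lam k + γ)) ^ 2 ≤ 1 / 4)
    (h : ∀ k : ℕ, |sc d k| ≤ k * Real.pi * K / (lam k + γ) * m) : ‖d‖ ≤ 1 / 2 * m := by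
  have hs := (summable_sq_div_lam K hγ.le).mul_right (m ^ 2)
  simp only [← mul_pow] at hs
  have := norm_sq_le_of_abs_sc_le hs h
  simp only [mul_pow _ m] at this
  rw [tsum_mul_right] at this
  refine le_of_sq_le_sq ?_ (by positivity)
  nlinarith [sq_nonneg m]

/-- An integrand growing like `e^{γ(r - t₀)}` has a Duhamel integral of the same growth, with a
constant that is small when `γ` is large. -/
theorem abs_duhamel_le {l γ B t₀ t : ℝ} {g : ℝ → ℝ} (hl : 0 ≤ l) (hγ : 0 < γ) (hB : 0 ≤ B)
    (ht : t₀ ≤ t) (h : ∀ r ∈ Set.Icc t₀ t, |g r| ≤ B * Real.exp (γ * (r - t₀))) :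
    |∫ r in t₀..t, Real.exp (-l * (t - r)) * g r| ≤ B / (l + γ) * Real.exp (γ * (t - t₀)) := by
  have h1 : |∫ r in t₀..t, Real.exp (-l * (t - r)) * g r| ≤
      ∫ r in t₀..t, Real.exp (-(l + γ) * (t - r)) * (B * Real.exp (γ * (t - t₀))) := by
    rw [← Real.norm_eq_abs]
    refine intervalIntegral.norm_integral_le_of_norm_le ht
      (Eventually.of_forall fun r hr => ?_) ((by fun_prop : Continuous fun r =>
          Real.exp (-(l + γ) * (t - r)) * (B * Real.exp (γ * (t - t₀)))).intervalIntegrable _ _)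
    rw [norm_mul, Real.norm_eq_abs, Real.norm_eq_abs, abs_of_pos (Real.exp_pos _)]
    have e : Real.exp (-(l + γ) * (t - r)) * Real.exp (γ * (t - t₀)) =
        Real.exp (-l * (t - r)) * Real.exp (γ * (r - t₀)) := by
      rw [← Real.exp_add, ← Real.exp_add]; ring_nf
    calc Real.exp (-l * (t - r)) * |g r|
        ≤ Real.exp (-l * (t - r)) * (B * Real.exp (γ * (r - t₀))) :=
          mul_le_mul_of_nonneg_left (h r (Set.Ioc_subset_Icc_self hr)) (Real.exp_pos _).le
      _ = _ := by rw [mul_left_comm, ← e]; ring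
  rw [intervalIntegral.integral_mul_const] at h1
  refine h1.trans ?_
  have h2 := integral_exp_le (by linarith : 0 < l + γ) t₀ t
  calc _ ≤ 1 / (l + γ) * (B * Real.exp (γ * (t - t₀))) :=
        mul_le_mul_of_nonneg_right h2 (by positivity)
    _ = _ := by ring

/-- Continuous dependence on the initial value, with a constant depending only on a bound for the
two solutions and on the elapsed time. -/
theorem exists_norm_sub_le (R : ℝ) : ∃ γ : ℝ, ∀ (f : ℝ → L2) (F t₀ T : ℝ) (u v : ℝ → L2),
    IsForce f F → IsMild f id t₀ u → IsMild f id t₀ v →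
    (∀ t ∈ Set.Icc t₀ T, ‖u t‖ ≤ R) → (∀ t ∈ Set.Icc t₀ T, ‖v t‖ ≤ R) →
    ∀ t ∈ Set.Icc t₀ T, ‖u t - v t‖ ≤ 2 * Real.exp (γ * (t - t₀)) * ‖u t₀ - v t₀‖ := by
  obtain ⟨γ, hγ, hK⟩ := exists_weight (2 * R)
  refine ⟨γ, fun f F t₀ T u v hf hu hv hR hR' t ht => ?_⟩
  have htT : t₀ ≤ T := ht.1.trans ht.2
  have hR0 : 0 ≤ R := (norm_nonneg _).trans (hR t ht)
  -- `m` is the maximum of the weighted distance `e^{-γ(s - t₀)} ‖u(s) - v(s)‖`, attained at `t₁`. At `t₁`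
  -- the Duhamel integral contributes at most half of it, so it is controlled by the initial distance.
  have hcd : ContinuousOn (fun s => Real.exp (-γ * (s - t₀)) * ‖u s - v s‖) (Set.Icc t₀ T) :=
    (by fun_prop : Continuous fun s => Real.exp (-γ * (s - t₀))).continuousOn.mul
      ((hu.cont.sub hv.cont).norm.mono Set.Icc_subset_Ici_self)
  obtain ⟨t₁, ht₁, hmax⟩ := isCompact_Icc.exists_isMaxOn ⟨t₀, le_rfl, htT⟩ hcd
  set m := Real.exp (-γ * (t₁ - t₀)) * ‖u t₁ - v t₁‖ with hm
  have hm0 : 0 ≤ m := by positivity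
  have hle : ∀ s ∈ Set.Icc t₀ T, ‖u s - v s‖ ≤ m * Real.exp (γ * (s - t₀)) := fun s hs => by
    have h1 : Real.exp (-γ * (s - t₀)) * ‖u s - v s‖ ≤ m := hmax hs
    have h2 : Real.exp (γ * (s - t₀)) * Real.exp (-γ * (s - t₀)) = 1 := by
      rw [← Real.exp_add]; ring_nf; simp
    calc ‖u s - v s‖ = Real.exp (γ * (s - t₀)) * (Real.exp (-γ * (s - t₀)) * ‖u s - v s‖) := by
          rw [← mul_assoc, h2, one_mul]
      _ ≤ Real.exp (γ * (s - t₀)) * m := by gcongr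
      _ = _ := mul_comm _ _
  -- The part of `u - v` that comes from the initial values.
  obtain ⟨e, he⟩ := exists_sc_eq
    (fun k => Real.exp (-lam k * (t₁ - t₀)) * sc (u t₀ - v t₀) k) (by simp [sc_zero_right]) (by
      refine (hasSum_sc_sq (u t₀ - v t₀)).summable.of_nonneg_of_le (fun _ => sq_nonneg _)
        fun k => ?_
      rw [mul_pow]
      refine mul_le_of_le_one_left (sq_nonneg _) (pow_le_one₀ (Real.exp_pos _).le ?_)
      rw [Real.exp_le_one_iff]
      nlinarith [lam_nonneg k, ht₁.1])
  have hen : ‖e‖ ≤ ‖u t₀ - v t₀‖ := by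
    refine le_of_sq_le_sq ?_ (norm_nonneg _)
    rw [← (hasSum_sc_sq (u t₀ - v t₀)).tsum_eq]
    have := norm_sq_le_of_abs_sc_le (d := e) (b := fun k => |sc (u t₀ - v t₀) k|)
      (by simpa using (hasSum_sc_sq (u t₀ - v t₀)).summable) (fun k => by
        rw [he k, abs_mul, abs_of_pos (Real.exp_pos _)]
        refine mul_le_of_le_one_left (abs_nonneg _) ?_
        rw [Real.exp_le_one_iff]
        nlinarith [lam_nonneg k, ht₁.1])
    simpa using this
  have hd : ‖u t₁ - v t₁ - e‖ ≤ 1 / 2 * (m * Real.exp (γ * (t₁ - t₀))) := by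
    refine norm_le_half_of_abs_sc_le hγ (by positivity) hK fun k => ?_
    have i1 := (hu.intervalIntegrable hf isTrunc_id k le_rfl ht₁.1).continuousOn_mul
      (g := fun r => Real.exp (-lam k * (t₁ - r))) (by fun_prop)
    have i2 := (hv.intervalIntegrable hf isTrunc_id k le_rfl ht₁.1).continuousOn_mul
      (g := fun r => Real.exp (-lam k * (t₁ - r))) (by fun_prop)
    rw [sc_sub, sc_sub, hu.eq k t₁ ht₁.1, hv.eq k t₁ ht₁.1, he k, sc_sub]
    rw [show ∀ a b c x y : ℝ, a * b + x - (a * c + y) - a * (b - c) = x - y by intros; ring,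
      ← intervalIntegral.integral_sub i1 i2]
    have e1 : ∀ r, Real.exp (-lam k * (t₁ - r)) * (sc (f r) k + bf (id (u r)) k) -
        Real.exp (-lam k * (t₁ - r)) * (sc (f r) k + bf (id (v r)) k) =
        Real.exp (-lam k * (t₁ - r)) * (bf (u r) k - bf (v r) k) := fun r => by
      simp only [id]; ring
    simp only [e1]
    refine (abs_duhamel_le (B := k * Real.pi * (2 * R) * m) (lam_nonneg k) hγ (by positivity)
      ht₁.1 fun r hr => ?_).trans (le_of_eq (by ring))
    have hrT : r ∈ Set.Icc t₀ T := ⟨hr.1, hr.2.trans ht₁.2⟩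
    refine (abs_bf_sub_le _ _ k).trans ?_
    rw [mul_assoc (k * Real.pi), mul_assoc (k * Real.pi)]
    refine mul_le_mul_of_nonneg_left ?_ (by positivity)
    rw [mul_assoc (2 * R)]
    refine mul_le_mul ?_ (hle r hrT) (norm_nonneg _) (by positivity)
    exact (norm_add_le _ _).trans (by linarith [hR r hrT, hR' r hrT])
  have h1 : m * Real.exp (γ * (t₁ - t₀)) = ‖u t₁ - v t₁‖ := by
    rw [hm, mul_right_comm, ← Real.exp_add]; ring_nf; simp
  have h2 : ‖u t₁ - v t₁‖ ≤ ‖e‖ + ‖u t₁ - v t₁ - e‖ := by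
    have := norm_add_le e (u t₁ - v t₁ - e)
    rwa [add_sub_cancel] at this
  have h3 : m * Real.exp (γ * (t₁ - t₀)) ≤ 2 * ‖u t₀ - v t₀‖ := by linarith
  have h4 : m ≤ m * Real.exp (γ * (t₁ - t₀)) :=
    le_mul_of_one_le_right hm0 (Real.one_le_exp (mul_nonneg hγ.le (by linarith [ht₁.1])))
  refine (hle t ht).trans ?_
  have : m ≤ 2 * ‖u t₀ - v t₀‖ := h4.trans h3
  nlinarith [Real.exp_pos (γ * (t - t₀))]

theorem IsMild.unique {f : ℝ → L2} {F t₀ : ℝ} {u v : ℝ → L2} (hf : IsForce f F)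
    (hu : IsMild f id t₀ u) (hv : IsMild f id t₀ v) (h : u t₀ = v t₀) {t : ℝ} (ht : t₀ ≤ t) :
    u t = v t := by
  obtain ⟨R, hR⟩ := isCompact_Icc.exists_bound_of_continuousOn
    (hu.cont.mono (Set.Icc_subset_Ici_self : Set.Icc t₀ t ⊆ _))
  obtain ⟨R', hR'⟩ := isCompact_Icc.exists_bound_of_continuousOn
    (hv.cont.mono (Set.Icc_subset_Ici_self : Set.Icc t₀ t ⊆ _))
  obtain ⟨γ, hγ⟩ := exists_norm_sub_le (max R R')
  have := hγ f F t₀ t u v hf hu hv (fun s hs => (hR s hs).trans (le_max_left _ _))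
    (fun s hs => (hR' s hs).trans (le_max_right _ _)) t ⟨ht, le_rfl⟩
  rw [h, sub_self, norm_zero, mul_zero] at this
  exact sub_eq_zero.1 (norm_le_zero_iff.1 this)

/-- The radial projection onto the ball of radius `R`. -/
def radial (R : ℝ) (u : L2) : L2 := (R / max R ‖u‖) • u

theorem radial_of_norm_le {R : ℝ} (hR : 0 < R) {u : L2} (h : ‖u‖ ≤ R) : radial R u = u := by
  rw [radial, max_eq_left h, div_self hR.ne', one_smul]

theorem norm_radial_le {R : ℝ} (hR : 0 < R) (u : L2) : ‖radial R u‖ ≤ R := by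
  have h : 0 < max R ‖u‖ := lt_max_of_lt_left hR
  rw [radial, norm_smul, Real.norm_eq_abs, abs_of_pos (by positivity), div_mul_eq_mul_div,
    div_le_iff₀ h]
  exact mul_le_mul_of_nonneg_left (le_max_right _ _) hR.le

theorem isTrunc_radial {R : ℝ} (hR : 0 < R) : IsTrunc (radial R) where
  cont := by
    refine Continuous.smul (continuous_const.div (continuous_const.max continuous_norm)
      fun u => (lt_max_of_lt_left hR).ne') continuous_id
  smul u := ⟨R / max R ‖u‖, by have : 0 < max R ‖u‖ := lt_max_of_lt_left hR; positivity,
    div_le_one_of_le₀ (le_max_left _ _) (hR.le.trans (le_max_left _ _)), rfl⟩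

theorem norm_radial_sub_le {R : ℝ} (hR : 0 < R) (u v : L2) :
    ‖radial R u - radial R v‖ ≤ 2 * ‖u - v‖ := by
  have hu : 0 < max R ‖u‖ := lt_max_of_lt_left hR
  have hv : 0 < max R ‖v‖ := lt_max_of_lt_left hR
  have e : radial R u - radial R v = (R / max R ‖u‖) • (u - v) +
      (R / max R ‖u‖ - R / max R ‖v‖) • v := by
    rw [radial, radial, smul_sub, sub_smul]; abel
  rw [e, two_mul]
  refine (norm_add_le _ _).trans (add_le_add ?_ ?_)
  · rw [norm_smul, Real.norm_eq_abs, abs_of_pos (by positivity)]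
    exact mul_le_of_le_one_left (norm_nonneg _)
      (div_le_one_of_le₀ (le_max_left _ _) hu.le)
  · have h1 : |max R ‖v‖ - max R ‖u‖| ≤ ‖u - v‖ := by
      rw [max_comm R, max_comm R]
      refine (abs_max_sub_max_le_abs _ _ R).trans ?_
      rw [norm_sub_rev]; exact abs_norm_sub_norm_le _ _
    rw [norm_smul, Real.norm_eq_abs, div_sub_div _ _ hu.ne' hv.ne', ← mul_comm R,
      ← mul_sub, abs_div, abs_mul, abs_of_pos hR, abs_of_pos (mul_pos hu hv), div_mul_eq_mul_div,
      div_le_iff₀ (mul_pos hu hv)]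
    calc R * |max R ‖v‖ - max R ‖u‖| * ‖v‖ ≤ max R ‖u‖ * ‖u - v‖ * max R ‖v‖ := by
          gcongr
          · exact le_max_left _ _
          · exact le_max_right _ _
      _ = _ := by ring

theorem abs_bf_radial_sub_le {R : ℝ} (hR : 0 < R) (u v : L2) (k : ℕ) :
    |bf (radial R u) k - bf (radial R v) k| ≤ k * Real.pi * (4 * R) * ‖u - v‖ := by
  refine (abs_bf_sub_le _ _ k).trans ?_
  rw [mul_assoc (k * Real.pi)]
  refine mul_le_mul_of_nonneg_left ?_ (by positivity)
  have h1 : ‖radial R u + radial R v‖ ≤ 2 * R :=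
    (norm_add_le _ _).trans (by linarith [norm_radial_le hR u, norm_radial_le hR v])
  calc _ ≤ (2 * R) * (2 * ‖u - v‖) :=
        mul_le_mul h1 (norm_radial_sub_le hR u v) (norm_nonneg _) (by positivity)
    _ = _ := by ring

/-- A curve in `L²(0,1)` with prescribed continuous coefficients under a square summable bound. -/
theorem exists_curve {a : ℕ → ℝ → ℝ} {b : ℕ → ℝ} (hb : Summable fun k => b k ^ 2)
    (ha : ∀ k, Continuous (a k)) (h0 : ∀ t, a 0 t = 0) (hab : ∀ k t, |a k t| ≤ b k) :
    ∃ v : ℝ →ᵇ L2, ∀ t (k : ℕ), sc (v t) k = a k t := by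
  have hsq : ∀ k t, a k t ^ 2 ≤ b k ^ 2 := fun k t => by
    rw [← sq_abs]; exact pow_le_pow_left₀ (abs_nonneg _) (hab k t) 2
  choose v hv using fun t => exists_sc_eq (fun k => a k t) (h0 t)
    (hb.of_nonneg_of_le (fun _ => sq_nonneg _) fun k => hsq k t)
  have hcont : Continuous v := by
    rw [continuous_iff_continuousAt]
    intro t
    rw [ContinuousAt, tendsto_iff_norm_sub_tendsto_zero]
    have h1 : Tendsto (fun s => ‖v s - v t‖ ^ 2) (𝓝 t) (𝓝 0) := by
      have e : ∀ s, ‖v s - v t‖ ^ 2 = ∑' k : ℕ, (a k s - a k t) ^ 2 := fun s => by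
        rw [← (hasSum_sc_sq (v s - v t)).tsum_eq]
        simp only [sc_sub, hv]
      simp only [e]
      have := tendsto_tsum_of_dominated_convergence (𝓕 := 𝓝 t)
        (f := fun s (k : ℕ) => (a k s - a k t) ^ 2) (g := fun _ => 0) (hb.mul_left 4)
        (fun k => by
          have := ((((ha k).tendsto t).sub_const (a k t)).pow 2)
          simpa using this)
        (Eventually.of_forall fun s k => by
          rw [Real.norm_eq_abs, abs_of_nonneg (sq_nonneg _)]
          nlinarith [hsq k s, hsq k t, sq_nonneg (a k s + a k t)])
      simpa using this
    simpa using h1.sqrt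
  refine ⟨BoundedContinuousFunction.ofNormedAddCommGroup v hcont (√(∑' k, b k ^ 2)) fun t =>
    Real.le_sqrt_of_sq_le (norm_sq_le_of_abs_sc_le hb fun k => ?_), hv⟩
  rw [hv]; exact hab k t

/-- The truncated equation is globally solvable: the Duhamel operator is a contraction of the
space of bounded continuous curves, after division by `e^{γ(t-t₀)}`. -/
theorem exists_isMild_radial {f : ℝ → L2} {F : ℝ} (hf : IsForce f F) {R : ℝ} (hR : 0 < R)
    (t₀ : ℝ) (u₀ : L2) : ∃ u, IsMild f (radial R) t₀ u ∧ u t₀ = u₀ := by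
  obtain ⟨γ, hγ, hK⟩ := exists_weight (4 * R)
  have hF0 := hf.nonneg
  -- For `y = e^{-γ(t - t₀)} u`, `D y k` is coefficient `k` of the right side of the variation of
  -- constants formula, and `b` is a square summable bound for it.
  let g : (ℝ →ᵇ L2) → ℕ → ℝ → ℝ := fun y k r =>
    sc (f r) k + bf (radial R (Real.exp (γ * (r - t₀)) • y r)) k
  have hbfc : ∀ (y : ℝ →ᵇ L2) (k : ℕ),
      Continuous fun r => bf (radial R (Real.exp (γ * (r - t₀)) • y r)) k := fun y k =>
    ((continuous_bf k).comp (isTrunc_radial hR).cont).comp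
      ((by fun_prop : Continuous fun r => Real.exp (γ * (r - t₀))).smul y.continuous)
  have hgi : ∀ y k a b, IntervalIntegrable (g y k) volume a b := fun y k a b =>
    (hf.intervalIntegrable k a b).add ((hbfc y k).intervalIntegrable a b)
  let D : (ℝ →ᵇ L2) → ℕ → ℝ → ℝ := fun y k t =>
    Real.exp (-lam k * (t - t₀)) * sc u₀ k + ∫ r in t₀..t, Real.exp (-lam k * (t - r)) * g y k r
  have hDc : ∀ y k, Continuous (D y k) := fun y k => by
    have e : D y k = fun t => Real.exp (-lam k * (t - t₀)) * sc u₀ k + Real.exp (-lam k * t) *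
        ∫ r in t₀..t, Real.exp (lam k * r) * g y k r := by
      funext t
      simp only [D]
      rw [← intervalIntegral.integral_const_mul]
      congr 1
      refine intervalIntegral.integral_congr fun r _ => ?_
      simp only [← mul_assoc, ← Real.exp_add]
      ring_nf
    rw [e]
    have hp := intervalIntegral.continuous_primitive (μ := volume)
      (f := fun r => Real.exp (lam k * r) * g y k r)
      (fun a b => (hgi y k a b).continuousOn_mul (by fun_prop)) t₀
    fun_prop
  let b : ℕ → ℝ := fun k => |sc u₀ k| + (F + k * Real.pi * R ^ 2) / lam k
  have hbs : Summable fun k => b k ^ 2 := by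
    refine Summable.of_nonneg_of_le (fun _ => sq_nonneg _) (fun k => ?_)
      (((hasSum_sc_sq u₀).summable.mul_left 2).add
      ((Real.summable_one_div_nat_pow.2 (by norm_num : 1 < 2)).mul_left
        (2 * (F + Real.pi * R ^ 2) ^ 2)))
    have h1 : ((F + k * Real.pi * R ^ 2) / lam k) ^ 2 ≤
        (F + Real.pi * R ^ 2) ^ 2 * (1 / (k : ℝ) ^ 2) := by
      rcases Nat.eq_zero_or_pos k with rfl | hk
      · simp [lam]
      have hk1 : (1 : ℝ) ≤ k := by exact_mod_cast hk
      have hk0 : (0 : ℝ) < k := by linarith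
      have h2 : (F + k * Real.pi * R ^ 2) / lam k ≤ (F + Real.pi * R ^ 2) * (1 / k) := by
        rw [div_le_iff₀ (lam_pos hk)]
        calc F + k * Real.pi * R ^ 2 ≤ (F + Real.pi * R ^ 2) * k := by
              nlinarith [Real.pi_pos, sq_nonneg R]
          _ = (F + Real.pi * R ^ 2) * (1 / k) * (k : ℝ) ^ 2 := by field_simp
          _ ≤ _ := by gcongr; exact sq_le_lam k
      calc _ ≤ ((F + Real.pi * R ^ 2) * (1 / k)) ^ 2 :=
            pow_le_pow_left₀ (div_nonneg (by positivity) (lam_nonneg k)) h2 2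
        _ = _ := by ring
    simp only [b]
    nlinarith [sq_abs (sc u₀ k),
      sq_nonneg (|sc u₀ k| - (F + k * Real.pi * R ^ 2) / lam k)]
  have hDb : ∀ y (k : ℕ) t, t₀ ≤ t → |D y k t| ≤ b k := by
    intro y k t ht
    have h1 : |Real.exp (-lam k * (t - t₀)) * sc u₀ k| ≤ |sc u₀ k| := by
      rw [abs_mul, abs_of_pos (Real.exp_pos _)]
      refine mul_le_of_le_one_left (abs_nonneg _) ?_
      rw [Real.exp_le_one_iff]; nlinarith [lam_nonneg k]
    refine (abs_add_le _ _).trans (add_le_add h1 ?_)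
    rcases Nat.eq_zero_or_pos k with rfl | hk
    · simp [g, sc_zero_right, bf_zero_right, lam]
    have h2 : |∫ r in t₀..t, Real.exp (-lam k * (t - r)) * g y k r| ≤
        ∫ r in t₀..t, Real.exp (-lam k * (t - r)) * (F + k * Real.pi * R ^ 2) := by
      rw [← Real.norm_eq_abs]
      refine intervalIntegral.norm_integral_le_of_norm_le ht ?_
        ((by fun_prop : Continuous fun r =>
          Real.exp (-lam k * (t - r)) * (F + k * Real.pi * R ^ 2)).intervalIntegrable _ _)
      filter_upwards [hf.bound] with r hr _
      rw [norm_mul, Real.norm_eq_abs, abs_of_pos (Real.exp_pos _)]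
      refine mul_le_mul_of_nonneg_left ?_ (Real.exp_pos _).le
      refine (norm_add_le _ _).trans (add_le_add ((abs_sc_le _ _).trans hr) ?_)
      refine (abs_bf_le _ k).trans (mul_le_mul_of_nonneg_left ?_ (by positivity))
      exact pow_le_pow_left₀ (norm_nonneg _) (norm_radial_le hR _) 2
    rw [intervalIntegral.integral_mul_const] at h2
    refine h2.trans ?_
    rw [div_eq_mul_one_div, mul_comm]
    exact mul_le_mul_of_nonneg_left (integral_exp_le (lam_pos hk) t₀ t) (by positivity)
  have hmax : ∀ t, t₀ ≤ max t t₀ := fun t => le_max_right _ _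
  -- `Ψ` maps `y` to the weighted curve with coefficients `D y k`, extended to `t < t₀` by its value at `t₀`.
  choose Ψ hΨ using fun y => exists_curve (b := b)
    (a := fun k t => Real.exp (-γ * (max t t₀ - t₀)) * D y k (max t t₀)) hbs
    (fun k => by
      have := hDc y k
      fun_prop)
    (fun t => by simp [D, g, sc_zero_right, bf_zero_right]) (fun k t => by
      rw [abs_mul, abs_of_pos (Real.exp_pos _)]
      refine (mul_le_of_le_one_left (abs_nonneg _) ?_).trans (hDb y k _ (hmax t))
      rw [Real.exp_le_one_iff]; nlinarith [hmax t])
  have hcontr : ContractingWith (1 / 2 : NNReal) Ψ := by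
    refine ⟨?_, LipschitzWith.of_dist_le_mul fun y z => ?_⟩
    · rw [← NNReal.coe_lt_coe]; norm_num
    rw [BoundedContinuousFunction.dist_le (by positivity)]
    intro t
    rw [dist_eq_norm]
    set s := max t t₀ with hs
    have hs0 : t₀ ≤ s := hmax t
    have hcoe : ((1 / 2 : NNReal) : ℝ) = 1 / 2 := by norm_num
    rw [hcoe]
    refine norm_le_half_of_abs_sc_le hγ dist_nonneg hK fun k => ?_
    rw [sc_sub, hΨ, hΨ, ← mul_sub, abs_mul, abs_of_pos (Real.exp_pos _)]
    have i1 := (hgi y k t₀ s).continuousOn_mul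
      (g := fun r => Real.exp (-lam k * (s - r))) (by fun_prop)
    have i2 := (hgi z k t₀ s).continuousOn_mul
      (g := fun r => Real.exp (-lam k * (s - r))) (by fun_prop)
    have e1 : D y k s - D z k s = ∫ r in t₀..s, Real.exp (-lam k * (s - r)) *
        (bf (radial R (Real.exp (γ * (r - t₀)) • y r)) k -
          bf (radial R (Real.exp (γ * (r - t₀)) • z r)) k) := by
      simp only [D]
      rw [add_sub_add_left_eq_sub, ← intervalIntegral.integral_sub i1 i2]
      refine intervalIntegral.integral_congr fun r _ => ?_
      simp only [g]; ring
    rw [e1]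
    have h2 := abs_duhamel_le (B := k * Real.pi * (4 * R) * dist y z) (lam_nonneg k) hγ
      (by positivity) hs0 (g := fun r => bf (radial R (Real.exp (γ * (r - t₀)) • y r)) k -
          bf (radial R (Real.exp (γ * (r - t₀)) • z r)) k) (fun r _ => by
        refine (abs_bf_radial_sub_le hR _ _ k).trans ?_
        rw [mul_assoc _ (dist y z)]
        refine mul_le_mul_of_nonneg_left ?_ (by positivity)
        rw [← smul_sub, norm_smul, Real.norm_eq_abs, abs_of_pos (Real.exp_pos _), mul_comm,
          ← dist_eq_norm]
        exact mul_le_mul_of_nonneg_right (BoundedContinuousFunction.dist_coe_le_dist r)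
          (Real.exp_pos _).le)
    calc _ ≤ Real.exp (-γ * (s - t₀)) * (k * Real.pi * (4 * R) * dist y z / (lam k + γ) *
          Real.exp (γ * (s - t₀))) := mul_le_mul_of_nonneg_left h2 (Real.exp_pos _).le
      _ = (Real.exp (-γ * (s - t₀)) * Real.exp (γ * (s - t₀))) *
          (k * Real.pi * (4 * R) / (lam k + γ) * dist y z) := by ring
      _ = _ := by rw [← Real.exp_add]; ring_nf; simp
  set y := ContractingWith.fixedPoint Ψ hcontr
  have hy : Ψ y = y := hcontr.fixedPoint_isFixedPt
  have hyc : ∀ (k : ℕ) t, t₀ ≤ t → sc (Real.exp (γ * (t - t₀)) • y t) k = D y k t := by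
    intro k t ht
    have := hΨ y t k
    rw [hy, max_eq_left ht] at this
    rw [sc_smul, this, ← mul_assoc, ← Real.exp_add]; ring_nf; simp
  have hy0 : Real.exp (γ * (t₀ - t₀)) • y t₀ = u₀ := by
    refine L2.ext_sc fun k => ?_
    rw [hyc k t₀ le_rfl]; simp [D]
  refine ⟨fun t => Real.exp (γ * (t - t₀)) • y t, ⟨?_, fun k t ht => ?_⟩, hy0⟩
  · exact ((by fun_prop : Continuous fun r => Real.exp (γ * (r - t₀))).smul
      y.continuous).continuousOn
  · rw [hyc k t ht, hy0]

/-- Global existence for the Burgers equation: by dissipativity the truncation is never active when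
its radius is large enough. -/
theorem exists_isMild {f : ℝ → L2} {F : ℝ} (hf : IsForce f F) (t₀ : ℝ) (u₀ : L2) :
    ∃ u, IsMild f id t₀ u ∧ u t₀ = u₀ := by
  have hF0 := hf.nonneg
  have hR : 0 < F + ‖u₀‖ + 1 := by positivity
  obtain ⟨u, hu, hu0⟩ := exists_isMild_radial hf hR t₀ u₀
  refine ⟨u, ⟨hu.cont, fun k t ht => ?_⟩, hu0⟩
  rw [hu.eq k t ht]
  congr 1
  refine intervalIntegral.integral_congr fun r hr => ?_
  rw [Set.uIcc_of_le ht] at hr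
  have h1 := hu.norm_sq_le hf (isTrunc_radial hR) hr.1
  rw [hu0] at h1
  have h2 : Real.exp (-(r - t₀)) ≤ 1 := by rw [Real.exp_le_one_iff]; linarith [hr.1]
  have h3 : ‖u r‖ ≤ F + ‖u₀‖ + 1 := by
    refine le_of_sq_le_sq ?_ hR.le
    nlinarith [norm_nonneg u₀, sq_nonneg ‖u₀‖, mul_nonneg hF0 (norm_nonneg u₀)]
  simp only [radial_of_norm_le hR h3, id]

/-! ### Weak solutions are mild solutions, and conversely -/

theorem IsTestFunction.exists_Ioo {t₀ : ℝ} {φ : ℝ → ℝ} (hφ : IsTestFunction (Set.Ioi t₀) φ) :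
    ∃ a b, t₀ < a ∧ a ≤ b ∧ tsupport φ ⊆ Set.Ioo a b := by
  rcases (tsupport φ).eq_empty_or_nonempty with he | hne
  · exact ⟨t₀ + 1, t₀ + 1, by linarith, le_rfl, by rw [he]; exact Set.empty_subset _⟩
  have hK : IsCompact (tsupport φ) := hφ.compact
  have h1 : t₀ < sInf (tsupport φ) := hφ.support (hK.sInf_mem hne)
  have h2 : ∀ x ∈ tsupport φ, sInf (tsupport φ) ≤ x ∧ x ≤ sSup (tsupport φ) := fun x hx =>
    ⟨csInf_le hK.bddBelow hx, le_csSup hK.bddAbove hx⟩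
  obtain ⟨x, hx⟩ := hne
  refine ⟨(t₀ + sInf (tsupport φ)) / 2, sSup (tsupport φ) + 1, by linarith,
    by linarith [h2 x hx], fun y hy => ⟨by linarith [h2 y hy], by linarith [h2 y hy]⟩⟩

/-- Integrability on `s` with respect to the norm topology of `E`. Stating it with the normed group
structure as the only parameter keeps a single topology on `H⁻¹` in play. -/
abbrev NormIntegrableOn {E : Type*} [NormedAddCommGroup E] (g : ℝ → E) (s : Set ℝ) : Prop :=
  IntegrableOn g s

theorem normIntegrableOn_smul_of_tsupport {E : Type*} [NormedAddCommGroup E] [NormedSpace ℝ E]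
    {φ : ℝ → ℝ} {g : ℝ → E} {a b : ℝ} (hφ : Continuous φ) (hs : tsupport φ ⊆ Set.Ioo a b)
    (s : Set ℝ) (hg : NormIntegrableOn g (Set.Icc a b)) :
    NormIntegrableOn (fun t => φ t • g t) s := by
  refine Integrable.integrableOn ?_
  rw [← integrableOn_iff_integrable_of_support_subset (s := Set.Icc a b) (fun t ht =>
    Set.Ioo_subset_Icc_self (hs (subset_tsupport _ (fun h => ht (by simp [h])))))]
  exact hg.continuousOn_smul hφ.continuousOn isCompact_Icc

theorem setIntegral_eq_intervalIntegral {g : ℝ → ℝ} {t₀ a b : ℝ} (ha : t₀ < a) (hab : a ≤ b)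
    (hg : ∀ t, t ∉ Set.Ioo a b → g t = 0) : ∫ t in Set.Ioi t₀, g t = ∫ t in a..b, g t := by
  rw [intervalIntegral.integral_of_le hab, setIntegral_eq_integral_of_forall_compl_eq_zero,
    setIntegral_eq_integral_of_forall_compl_eq_zero]
  · exact fun t ht => hg t fun h => ht ⟨h.1, h.2.le⟩
  · exact fun t ht => hg t fun h => ht (ha.trans h.1)

/-- An absolutely continuous function has its derivative as weak derivative. -/
theorem IsTestFunction.integral_deriv_mul {t₀ : ℝ} {φ y h : ℝ → ℝ}
    (hφ : IsTestFunction (Set.Ioi t₀) φ) (hh : ∀ a b, t₀ < a → a ≤ b →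
      IntervalIntegrable h volume a b)
    (hy : ∀ a b, t₀ < a → a ≤ b → y b = y a + ∫ r in a..b, h r) :
    ∫ t in Set.Ioi t₀, deriv φ t * y t = - ∫ t in Set.Ioi t₀, φ t * h t := by
  obtain ⟨a, b, ha, hab, hs⟩ := hφ.exists_Ioo
  have hφ0 : ∀ t, t ∉ Set.Ioo a b → φ t = 0 := fun t ht =>
    image_eq_zero_of_notMem_tsupport fun h => ht (hs h)
  have hφ1 : ∀ t, t ∉ Set.Ioo a b → deriv φ t = 0 := fun t ht =>
    image_eq_zero_of_notMem_tsupport fun h => ht (hs (tsupport_deriv_subset h))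
  have hc : Continuous (deriv φ) := hφ.smooth.continuous_deriv (by simp)
  rw [setIntegral_eq_intervalIntegral ha hab (fun t ht => by rw [hφ1 t ht, zero_mul]),
    setIntegral_eq_intervalIntegral ha hab (fun t ht => by rw [hφ0 t ht, zero_mul])]
  have key := integral_mul_add_mul hab (hc.intervalIntegrable a b) (hh a b ha hab) (F := φ)
    (H := y) (fun t _ => by
      rw [intervalIntegral.integral_eq_sub_of_hasDerivAt
        (fun x _ => (hφ.smooth.differentiable (by simp) x).hasDerivAt) (hc.intervalIntegrable _ _)]
      ring) (fun t ht => hy a t ha ht.1)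
  have hyc := continuousOn_of_eq_integral hab (hh a b ha hab) (fun t ht => hy a t ha ht.1)
  rw [hφ0 a (by simp), hφ0 b (by simp), zero_mul, zero_mul, sub_zero,
    intervalIntegral.integral_add] at key
  · linarith
  · exact (hc.continuousOn.mul hyc).intervalIntegrable_of_Icc hab
  · exact (hh a b ha hab).continuousOn_mul hφ.smooth.continuous.continuousOn

theorem continuous_toHneg : Continuous toHneg := by
  unfold toHneg
  exact ((innerSL ℝ).continuous.clm_comp continuous_const)

theorem toHneg_apply (w : L2) (v : H10) : toHneg w v = inner ℝ w (toL2 v) := rfl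

theorem norm_toL2_apply_le (U : H10) : ‖toL2 U‖ ≤ ‖U‖ :=
  (H10.norm_toL2_le U).trans (H10.norm_dx_le U)

theorem norm_toHneg_le (w : L2) : ‖toHneg w‖ ≤ ‖w‖ :=
  ContinuousLinearMap.opNorm_le_bound _ (norm_nonneg _) fun v =>
    (norm_inner_le_norm _ _).trans
      (mul_le_mul_of_nonneg_left (norm_toL2_apply_le v) (norm_nonneg _))

/-- A functional on `H¹₀(0,1)` is determined by its values on the sines. -/
theorem Hneg.ext_sineH {A B : Hneg} (h : ∀ k : ℕ, A (sineH k) = B (sineH k)) : A = B := by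
  refine ContinuousLinearMap.ext fun v => ?_
  have h1 := A.hasSum (H10.hasSum_sineH v)
  have h2 := B.hasSum (H10.hasSum_sineH v)
  simp only [map_smul, h] at h1 h2
  exact h1.unique h2

/-- The functional `v ↦ -(u_x, v_x) + (u²/2, v_x)`, that is `u_xx - u u_x`. -/
def stationary (U : H10) : Hneg :=
  ((innerSL ℝ ((1 / 2 : ℝ) • sqL U - dx U)).comp dx)

theorem stationary_apply (U v : H10) :
    stationary U v = - inner ℝ (dx U) (dx v) - convection U v := by
  rw [convection_eq, stationary]
  simp only [ContinuousLinearMap.comp_apply, innerSL_apply_apply, inner_sub_left, real_inner_smul_left]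
  ring

theorem continuous_stationary : Continuous stationary := by
  unfold stationary
  have h := continuous_sqL
  exact ((innerSL ℝ (E := L2)).continuous.comp ((h.const_smul (1 / 2 : ℝ)).sub dx.continuous)).clm_comp
    continuous_const

theorem norm_stationary_le (U : H10) : ‖stationary U‖ ≤ (1 + ‖toL2 U‖) * ‖U‖ := by
  refine ContinuousLinearMap.opNorm_le_bound _ (by positivity) fun v => ?_
  refine (norm_inner_le_norm (𝕜 := ℝ) ((1 / 2 : ℝ) • sqL U - dx U) (dx v)).trans ?_
  refine mul_le_mul ?_ (H10.norm_dx_le v) (norm_nonneg _) (by positivity)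
  refine (norm_sub_le _ _).trans ?_
  rw [norm_smul, Real.norm_eq_abs, abs_of_pos (by norm_num)]
  have h1 := norm_sqL_le U
  have h2 := H10.norm_dx_le U
  have h3 := mul_le_mul_of_nonneg_right h2 (norm_nonneg (toL2 U))
  have h4 := mul_nonneg (norm_nonneg U) (norm_nonneg (toL2 U))
  linarith

theorem normIntegrableOn_smul_dual {E : Type*} [NormedAddCommGroup E] [NormedSpace ℝ E]
    {φ : ℝ → ℝ} {g : ℝ → StrongDual ℝ E} {a b : ℝ} (hφ : Continuous φ)
    (hs : tsupport φ ⊆ Set.Ioo a b) (s : Set ℝ) (hg : NormIntegrableOn g (Set.Icc a b)) :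
    NormIntegrableOn (fun t => φ t • g t) s := normIntegrableOn_smul_of_tsupport hφ hs s hg

theorem normIntegrableOn_toHneg {u : ℝ → L2} {a b : ℝ} (hu : ContinuousOn u (Set.Icc a b)) :
    NormIntegrableOn (fun t => toHneg (u t)) (Set.Icc a b) :=
  (continuous_toHneg.comp_continuousOn hu).integrableOn_Icc

theorem LocallyL2.memLp_add {E : Type*} [NormedAddCommGroup E] {g h : ℝ → E} {μ : Measure ℝ}
    (hg : MemLp g 2 μ) (hh : MemLp h 2 μ) : MemLp (fun t => g t + h t) 2 μ := hg.add hh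

theorem LocallyL2.normIntegrableOn {E : Type*} [NormedAddCommGroup E] {t₀ : ℝ} {g : ℝ → E}
    (hg : LocallyL2 t₀ g) {a b : ℝ} (ha : t₀ ≤ a) : NormIntegrableOn g (Set.Icc a b) := by
  have : IntegrableOn g (Set.Ioc t₀ b) := (hg b).integrable (by norm_num)
  exact (integrableOn_Icc_iff_integrableOn_Ioc (by simp)).2 (this.mono_set (Set.Ioc_subset_Ioc_left ha))

theorem LocallyL2.memLp_apply {E : Type*} [NormedAddCommGroup E] [NormedSpace ℝ E] {t₀ : ℝ}
    {g : ℝ → StrongDual ℝ E} (hg : LocallyL2 t₀ g) (v : E) (T : ℝ) :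
    MemLp (fun t => g t v) 2 (volume.restrict (Set.Ioc t₀ T)) :=
  (ContinuousLinearMap.apply ℝ ℝ v).comp_memLp' (hg T)

theorem integral_dual_apply {E : Type*} [NormedAddCommGroup E] [NormedSpace ℝ E] {s : Set ℝ}
    {g : ℝ → StrongDual ℝ E} (hg : NormIntegrableOn g s) (v : E) :
    (∫ t in s, g t) v = ∫ t in s, g t v := ContinuousLinearMap.integral_apply hg v

/-- The energy identity bounds the integral of `‖u_x‖²` uniformly as the left end point of the
interval decreases to `t₀`. -/
theorem IsMild.locallyL2_lift {f : ℝ → L2} {F : ℝ} {t₀ : ℝ} {u : ℝ → L2} (hf : IsForce f F)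
    (hu : IsMild f id t₀ u) : LocallyL2 t₀ fun t => lift (u t) := by
  intro T
  rcases le_or_gt T t₀ with hT | hT
  · rw [Set.Ioc_eq_empty (not_lt.2 hT), Measure.restrict_empty]; exact memLp_measure_zero
  have hF0 := hf.nonneg
  have hmeas : AEStronglyMeasurable (fun t => lift (u t)) (volume.restrict (Set.Ioc t₀ T)) :=
    ((hu.continuousOn_lift hf isTrunc_id).mono Set.Ioc_subset_Ioi_self).aestronglyMeasurable
      measurableSet_Ioc
  rw [memLp_two_iff_integrable_sq_norm hmeas]
  obtain ⟨R, hR⟩ := isCompact_Icc.exists_bound_of_continuousOn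
    (hu.cont.mono (Set.Icc_subset_Ici_self : Set.Icc t₀ T ⊆ _))
  have hR0 : 0 ≤ R := (norm_nonneg _).trans (hR T ⟨hT.le, le_rfl⟩)
  have hi : ∀ s, t₀ < s → s ≤ T →
      IntegrableOn (fun t => ‖lift (u t)‖ ^ 2) (Set.Ioc s T) := fun s hs hsT => by
    rw [← intervalIntegrable_iff_integrableOn_Ioc_of_le hsT]
    exact (((hu.continuousOn_lift hf isTrunc_id).mono fun r hr =>
      hs.trans_le hr.1).norm.pow 2).intervalIntegrable_of_Icc hsT
  -- The left end point tends to `t₀` along `t₀ + (T - t₀) / (n + 1)`, with a bound independent of `n`.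
  refine integrableOn_Ioc_of_intervalIntegral_norm_bounded_left (l := atTop) (a₀ := t₀)
    (a := fun n : ℕ => t₀ + (T - t₀) * (1 / ((n : ℝ) + 1)))
    (I := (R ^ 2 + F * R) * (T - t₀) + R ^ 2) (fun n => ?_) ?_ (Eventually.of_forall fun n => ?_)
  · have h1 : 0 < 1 / ((n : ℝ) + 1) := by positivity
    have h2 : 1 / ((n : ℝ) + 1) ≤ 1 := by
      rw [div_le_one (by positivity)]; linarith [(Nat.cast_nonneg n : (0 : ℝ) ≤ n)]
    exact hi _ (by nlinarith) (by nlinarith)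
  · have := (tendsto_one_div_add_atTop_nhds_zero_nat (𝕜 := ℝ)).const_mul (T - t₀) |>.const_add t₀
    simpa using this
  · have h1 : 0 < 1 / ((n : ℝ) + 1) := by positivity
    have h2 : 1 / ((n : ℝ) + 1) ≤ 1 := by
      rw [div_le_one (by positivity)]; linarith [(Nat.cast_nonneg n : (0 : ℝ) ≤ n)]
    set s := t₀ + (T - t₀) * (1 / ((n : ℝ) + 1))
    have hs : t₀ < s := by simp only [s]; nlinarith
    have hsT : s ≤ T := by simp only [s]; nlinarith
    have e := hu.energy hf isTrunc_id hs hsT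
    have i1 := hu.intervalIntegrable_inner hf hs.le hsT
    have i2 := hu.intervalIntegrable_norm_dx_sq hf isTrunc_id hs hsT
    rw [intervalIntegral.integral_const_mul, intervalIntegral.integral_sub i1 i2] at e
    have b1 : ∫ r in s..T, (inner ℝ (f r) (u r) : ℝ) ≤ ∫ _ in s..T, F * R := by
      refine intervalIntegral.integral_mono_ae_restrict hsT i1 _root_.intervalIntegrable_const ?_
      filter_upwards [ae_restrict_of_ae hf.bound, ae_restrict_mem measurableSet_Icc] with r hr hmr
      exact (real_inner_le_norm _ _).trans (mul_le_mul hr (hR r ⟨hs.le.trans hmr.1, hmr.2⟩)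
        (norm_nonneg _) hF0)
    rw [intervalIntegral.integral_const, smul_eq_mul] at b1
    have b2 : ∫ r in s..T, ‖lift (u r)‖ ^ 2 ≤ ∫ r in s..T, (R ^ 2 + ‖dx (lift (u r))‖ ^ 2) := by
      refine intervalIntegral.integral_mono_on hsT
        ((intervalIntegrable_iff_integrableOn_Ioc_of_le hsT).2 (hi s hs hsT))
        (_root_.intervalIntegrable_const.add i2) fun r hr => ?_
      rw [H10.norm_sq, hu.toL2_lift hf isTrunc_id (hs.trans_le hr.1)]
      have := pow_le_pow_left₀ (norm_nonneg _) (hR r ⟨hs.le.trans hr.1, hr.2⟩) 2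
      linarith
    rw [intervalIntegral.integral_add _root_.intervalIntegrable_const i2,
      intervalIntegral.integral_const, smul_eq_mul] at b2
    have b3 : ‖u s‖ ^ 2 ≤ R ^ 2 := pow_le_pow_left₀ (norm_nonneg _) (hR s ⟨hs.le, hsT⟩) 2
    have b4 : (T - s) * R ^ 2 ≤ (T - t₀) * R ^ 2 := by gcongr
    have b5 : (T - s) * (F * R) ≤ (T - t₀) * (F * R) := by gcongr
    simp only [norm_pow, norm_norm]
    rw [intervalIntegral.integral_of_le hsT] at b2
    nlinarith [sq_nonneg ‖u T‖]

/-- The time derivative is `stationary u + f`; since the sines span a dense subspace of `H¹₀(0,1)`, it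
suffices to verify this on sines, where it is the equation for a single coefficient. -/
theorem IsMild.isWeakSolution {f : ℝ → L2} {F : ℝ} {t₀ : ℝ} {u : ℝ → L2} (hf : IsForce f F)
    (hu : IsMild f id t₀ u) : IsWeakSolution f t₀ (u t₀) u := by
  have hU := hu.locallyL2_lift hf
  have hlift : ∀ t, t₀ < t → toL2 (lift (u t)) = u t := fun t ht => hu.toL2_lift hf isTrunc_id ht
  have hu' : LocallyL2 t₀ fun t => stationary (lift (u t)) + toHneg (f t) := by
    intro T
    obtain ⟨R, hR⟩ := isCompact_Icc.exists_bound_of_continuousOn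
      (hu.cont.mono (Set.Icc_subset_Ici_self : Set.Icc t₀ T ⊆ _))
    refine LocallyL2.memLp_add ?_ ?_
    · refine (hU T).of_le_mul (c := 1 + R)
        (continuous_stationary.comp_aestronglyMeasurable (hU T).1) ?_
      filter_upwards [ae_restrict_mem measurableSet_Ioc] with t ht
      refine (norm_stationary_le _).trans (mul_le_mul_of_nonneg_right ?_ (norm_nonneg _))
      rw [hlift t ht.1]
      linarith [hR t (Set.Ioc_subset_Icc_self ht)]
    · refine MemLp.of_bound (continuous_toHneg.comp_aestronglyMeasurable hf.meas.restrict) F ?_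
      filter_upwards [ae_restrict_of_ae hf.bound] with t ht
      exact (norm_toHneg_le _).trans ht
  refine ⟨hu.cont, rfl, fun t => lift (u t), fun t => stationary (lift (u t)) + toHneg (f t),
    hU, hu', Eventually.of_forall hlift, ?_, Eventually.of_forall fun t ht v => ?_⟩
  · intro φ hφ
    obtain ⟨a, b, ha, hab, hs⟩ := hφ.exists_Ioo
    have hc : Continuous (deriv φ) := hφ.smooth.continuous_deriv (by simp)
    have i1 : NormIntegrableOn (fun t => deriv φ t • toHneg (u t)) (Set.Ioi t₀) := by
      exact normIntegrableOn_smul_dual (E := H10) hc (tsupport_deriv_subset.trans hs) _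
        (normIntegrableOn_toHneg (hu.cont.mono fun r hr => ha.le.trans hr.1))
    have i2 : NormIntegrableOn (fun t => φ t • (stationary (lift (u t)) + toHneg (f t)))
        (Set.Ioi t₀) := by
      exact normIntegrableOn_smul_dual (E := H10) hφ.smooth.continuous hs _
        (hu'.normIntegrableOn ha.le)
    refine Hneg.ext_sineH fun k => ?_
    rw [neg_apply, integral_dual_apply i1, integral_dual_apply i2]
    have key := hφ.integral_deriv_mul (y := fun t => sc (u t) k)
      (h := fun r => sc (f r) k + bf (id (u r)) k - lam k * sc (u r) k)
      (fun a b ha hab => (hu.intervalIntegrable hf isTrunc_id k ha.le hab).sub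
        (((hu.continuousOn_sc k).mono fun _ hr =>
          ha.le.trans hr.1).intervalIntegrable_of_Icc hab |>.const_mul _))
      (fun a b ha hab => hu.integral_eq hf isTrunc_id k ha.le hab)
    have e1 : ∀ t, (deriv φ t • toHneg (u t)) (sineH k) = deriv φ t * sc (u t) k := fun t => by
      rw [smul_apply, toHneg_apply, toL2_sineH, smul_eq_mul, real_inner_comm, sc]
    simp only [e1]
    rw [key]
    congr 1
    refine setIntegral_congr_fun measurableSet_Ioi fun t ht => ?_
    simp only [smul_apply, add_apply, smul_eq_mul]
    rw [toHneg_apply, toL2_sineH, stationary_apply, convection_sineH, real_inner_comm (dx _),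
      inner_dx_sineH, hlift t ht, real_inner_comm, sc]
    simp only [id]; ring
  · rw [add_apply, stationary_apply, toHneg_apply]; ring

/-- Testing with a sine and the lemma of du Bois-Reymond show that each coefficient satisfies its
integrated equation, which is equivalent to the variation of constants formula. -/
theorem IsWeakSolution.isMild {f : ℝ → L2} {F : ℝ} {t₀ : ℝ} {u₀ : L2} {u : ℝ → L2}
    (hf : IsForce f F) (hu : IsWeakSolution f t₀ u₀ u) : IsMild f id t₀ u := by
  obtain ⟨hc, -, U, u', -, hu', hUu, hd, heq⟩ := hu
  refine ⟨hc, fun k => ?_⟩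
  set g : ℝ → ℝ := fun t => u' t (sineH k) with hg
  have hsck : ContinuousOn (fun t => sc (u t) k) (Set.Ici t₀) := (continuous_sc k).comp_continuousOn hc
  have hgL : ∀ T, MemLp g 2 (volume.restrict (Set.Ioc t₀ T)) := fun T =>
    hu'.memLp_apply (sineH k) T
  have hgi : ∀ a b, t₀ ≤ a → a ≤ b → IntervalIntegrable g volume a b := fun a b ha hab => by
    rw [intervalIntegrable_iff_integrableOn_Ioc_of_le hab]
    have : IntegrableOn g (Set.Ioc t₀ b) := (hgL b).integrable (by norm_num)
    exact this.mono_set (Set.Ioc_subset_Ioc_left ha)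
  have hgae : ∀ᵐ t, t₀ < t → g t = sc (f t) k + bf (u t) k - lam k * sc (u t) k := by
    filter_upwards [hUu, heq] with t h1 h2 ht
    have e1 := h1 ht
    have e2 := h2 ht (sineH k)
    rw [convection_sineH, toL2_sineH, real_inner_comm (dx _), inner_dx_sineH, e1,
      real_inner_comm] at e2
    have e3 : (inner ℝ (sn k) (f t) : ℝ) = sc (f t) k := rfl
    rw [e3] at e2
    simp only [hg]; linarith
  have hweak : ∀ φ, IsTestFunction (Set.Ioi t₀) φ →
      ∫ t in Set.Ioi t₀, deriv φ t * sc (u t) k = - ∫ t in Set.Ioi t₀, φ t * g t := by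
    intro φ hφ
    obtain ⟨a, b, ha, hab, hs⟩ := hφ.exists_Ioo
    have hcd : Continuous (deriv φ) := hφ.smooth.continuous_deriv (by simp)
    have i1 : NormIntegrableOn (fun t => deriv φ t • toHneg (u t)) (Set.Ioi t₀) := by
      exact normIntegrableOn_smul_dual (E := H10) hcd (tsupport_deriv_subset.trans hs) _
        (normIntegrableOn_toHneg (hc.mono fun r hr => ha.le.trans hr.1))
    have i2 : NormIntegrableOn (fun t => φ t • u' t) (Set.Ioi t₀) := by
      exact normIntegrableOn_smul_dual (E := H10) hφ.smooth.continuous hs _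
        (hu'.normIntegrableOn ha.le)
    have := congrArg (fun A : Hneg => A (sineH k)) (hd φ hφ)
    simp only [neg_apply] at this
    rw [integral_dual_apply i1, integral_dual_apply i2] at this
    simp only [smul_apply, toHneg_apply, toL2_sineH, smul_eq_mul] at this
    simp only [sc, hg]
    rw [← this]
    refine integral_congr_ae (Eventually.of_forall fun t => ?_)
    simp only [real_inner_comm]
  have hprim : ContinuousOn (fun t => ∫ r in t₀..t, g r) (Set.Ici t₀) := by
    intro t ht
    have h1 := intervalIntegral.continuousOn_primitive_interval' (μ := volume) (f := g)
      (hgi t₀ (t + 1) le_rfl (by linarith [Set.mem_Ici.1 ht])) (Set.left_mem_uIcc)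
    rw [Set.uIcc_of_le (by linarith [Set.mem_Ici.1 ht])] at h1
    refine (h1 t ⟨ht, by linarith⟩).mono_of_mem_nhdsWithin ?_
    rw [← Set.Ici_inter_Iic]
    exact inter_mem_nhdsWithin _ (Iic_mem_nhds (by linarith))
  obtain ⟨c, hcst⟩ := eq_const_of_forall_integral_deriv_eq_zero (t₀ := t₀)
    (z := fun t => sc (u t) k - ∫ r in t₀..t, g r)
    ((hsck.sub hprim).mono Set.Ioi_subset_Ici_self) (fun φ hφ => by
      have h1 := hφ.integral_deriv_mul (y := fun t => ∫ r in t₀..t, g r) (h := g)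
        (fun a b ha hab => hgi a b ha.le hab) (fun a b ha hab => by
          rw [intervalIntegral.integral_add_adjacent_intervals (hgi _ _ le_rfl ha.le)
            (hgi _ _ ha.le hab)])
      obtain ⟨a, b, ha, hab, hs⟩ := hφ.exists_Ioo
      have hcd : Continuous (deriv φ) := hφ.smooth.continuous_deriv (by simp)
      have i1 : ∀ {z : ℝ → ℝ}, ContinuousOn z (Set.Ici t₀) →
          Integrable (fun t => deriv φ t * z t) (volume.restrict (Set.Ioi t₀)) := fun hz =>
        normIntegrableOn_smul_of_tsupport hcd (tsupport_deriv_subset.trans hs) _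
          (hz.mono fun r hr => ha.le.trans hr.1).integrableOn_Icc
      simp only [mul_sub]
      rw [integral_sub (i1 hsck) (i1 hprim), hweak φ hφ, h1, sub_self])
  have hc0 : sc (u t₀) k = c := by
    have hz : ContinuousOn (fun t => sc (u t) k - ∫ r in t₀..t, g r) (Set.Ici t₀) :=
      hsck.sub hprim
    have l1 : Tendsto (fun t => sc (u t) k - ∫ r in t₀..t, g r) (𝓝[>] t₀)
        (𝓝 (sc (u t₀) k - ∫ r in t₀..t₀, g r)) :=
      (hz t₀ Set.self_mem_Ici).mono Set.Ioi_subset_Ici_self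
    have l2 : Tendsto (fun t => sc (u t) k - ∫ r in t₀..t, g r) (𝓝[>] t₀) (𝓝 c) := by
      refine tendsto_const_nhds.congr' ?_
      filter_upwards [self_mem_nhdsWithin] with t ht
      exact (hcst t ht).symm
    have := tendsto_nhds_unique l1 l2
    simpa using this
  intro t ht
  have hbf : ContinuousOn (fun r => bf (u r) k) (Set.Ici t₀) :=
    (continuous_bf k).comp_continuousOn hc
  refine (mild_iff_integral ht ((hf.intervalIntegrable k t₀ t).add
    ((hbf.mono Set.Icc_subset_Ici_self).intervalIntegrable_of_Icc ht))
    (hsck.mono Set.Icc_subset_Ici_self)).2 (fun s hs => ?_) t ⟨ht, le_rfl⟩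
  have h2 : ∫ r in t₀..s, (sc (f r) k + bf (id (u r)) k - lam k * sc (u r) k) =
      ∫ r in t₀..s, g r := by
    refine intervalIntegral.integral_congr_ae ?_
    filter_upwards [hgae] with r hr hmr
    rw [Set.uIoc_of_le hs.1] at hmr
    exact (hr hmr.1).symm
  change _ = _ + ∫ r in t₀..s, (sc (f r) k + bf (id (u r)) k - lam k * sc (u r) k)
  rw [h2]
  rcases hs.1.eq_or_lt with rfl | hlt
  · simp
  · have := hcst s hlt
    rw [hc0]; linarith

/-- Weak solutions exist and are unique. -/
theorem exists_isSolutionProcess {f : ℝ → L2} {F : ℝ} (hf : IsForce f F) :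
    ∃ S : ℝ → ℝ → L2 → L2, IsSolutionProcess f S ∧
      ∀ t₀ u₀, IsMild f id t₀ (fun t => S t t₀ u₀) ∧ S t₀ t₀ u₀ = u₀ := by
  choose u hu hu0 using fun t₀ u₀ => exists_isMild hf t₀ u₀
  refine ⟨fun t t₀ u₀ => u t₀ u₀ t, fun t₀ u₀ => ⟨?_, fun v hv t ht => ?_⟩, fun t₀ u₀ =>
    ⟨hu t₀ u₀, hu0 t₀ u₀⟩⟩
  · have := (hu t₀ u₀).isWeakSolution hf
    rwa [hu0] at this
  · exact (hv.isMild hf).unique hf (hu t₀ u₀) (by rw [hv.2.1, hu0]) ht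

/-! ### A smooth approximation of the absolute value -/

/-- The smooth convex approximation `√(s² + ε²) - ε` of `|s|`. -/
def smoothAbs (ε s : ℝ) : ℝ := √(s ^ 2 + ε ^ 2) - ε

/-- The derivative of `smoothAbs ε`. -/
def smoothSign (ε s : ℝ) : ℝ := s / √(s ^ 2 + ε ^ 2)

/-- The second derivative of `smoothAbs ε`. -/
def smoothDelta (ε s : ℝ) : ℝ := ε ^ 2 / ((s ^ 2 + ε ^ 2) * √(s ^ 2 + ε ^ 2))

theorem sqrt_sq_add_pos {ε : ℝ} (hε : 0 < ε) (s : ℝ) : 0 < √(s ^ 2 + ε ^ 2) := by positivity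

theorem le_sqrt_sq_add {ε : ℝ} (s : ℝ) : ε ≤ √(s ^ 2 + ε ^ 2) :=
  Real.le_sqrt_of_sq_le (by nlinarith [sq_nonneg s])

theorem smoothAbs_zero {ε : ℝ} (hε : 0 < ε) : smoothAbs ε 0 = 0 := by
  simp [smoothAbs, Real.sqrt_sq hε.le]

theorem smoothSign_zero (ε : ℝ) : smoothSign ε 0 = 0 := by simp [smoothSign]

theorem smoothAbs_nonneg {ε : ℝ} (s : ℝ) : 0 ≤ smoothAbs ε s :=
  sub_nonneg.2 (le_sqrt_sq_add s)

theorem abs_le_smoothAbs_add {ε : ℝ} (s : ℝ) : |s| ≤ smoothAbs ε s + ε := by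
  rw [smoothAbs, sub_add_cancel]
  refine Real.le_sqrt_of_sq_le ?_
  rw [sq_abs]; nlinarith [sq_nonneg ε]

theorem smoothAbs_le_abs {ε : ℝ} (hε : 0 < ε) (s : ℝ) : smoothAbs ε s ≤ |s| := by
  rw [smoothAbs, sub_le_iff_le_add]
  refine Real.sqrt_le_iff.2 ⟨by positivity, ?_⟩
  nlinarith [sq_abs s, mul_nonneg (abs_nonneg s) hε.le]

theorem hasDerivAt_sqrt_sq_add {ε : ℝ} (hε : 0 < ε) (s : ℝ) :
    HasDerivAt (fun s => √(s ^ 2 + ε ^ 2)) (smoothSign ε s) s := by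
  have h := ((hasDerivAt_pow 2 s).add_const (ε ^ 2)).sqrt (by positivity)
  refine h.congr_deriv ?_
  rw [smoothSign, div_eq_div_iff (by positivity) (by positivity)]
  push_cast; ring

theorem hasDerivAt_smoothAbs {ε : ℝ} (hε : 0 < ε) (s : ℝ) :
    HasDerivAt (smoothAbs ε) (smoothSign ε s) s := (hasDerivAt_sqrt_sq_add hε s).sub_const ε

theorem hasDerivAt_smoothSign {ε : ℝ} (hε : 0 < ε) (s : ℝ) :
    HasDerivAt (smoothSign ε) (smoothDelta ε s) s := by
  have hp := sqrt_sq_add_pos hε s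
  have h := (hasDerivAt_id s).div (hasDerivAt_sqrt_sq_add hε s) hp.ne'
  refine h.congr_deriv ?_
  have hs : √(s ^ 2 + ε ^ 2) ^ 2 = s ^ 2 + ε ^ 2 := Real.sq_sqrt (by positivity)
  rw [smoothDelta, smoothSign, hs]
  simp only [id]
  have hp2 : 0 < s ^ 2 + ε ^ 2 := by positivity
  generalize √(s ^ 2 + ε ^ 2) = A at hp hs
  field_simp
  linear_combination hs

theorem continuous_smoothAbs (ε : ℝ) : Continuous (smoothAbs ε) := by
  unfold smoothAbs; fun_prop

theorem continuous_smoothSign {ε : ℝ} (hε : 0 < ε) : Continuous (smoothSign ε) :=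
  continuous_iff_continuousAt.2 fun s => (hasDerivAt_smoothSign hε s).continuousAt

theorem continuous_smoothDelta {ε : ℝ} (hε : 0 < ε) : Continuous (smoothDelta ε) := by
  unfold smoothDelta
  refine continuous_const.div (by fun_prop) fun s => ?_
  positivity

theorem smoothDelta_nonneg (ε s : ℝ) : 0 ≤ smoothDelta ε s := by
  unfold smoothDelta; positivity

theorem abs_smoothSign_le (ε s : ℝ) : |smoothSign ε s| ≤ 1 := by
  rw [smoothSign, abs_div, abs_of_nonneg (Real.sqrt_nonneg _)]
  refine div_le_one_of_le₀ (Real.le_sqrt_of_sq_le ?_) (Real.sqrt_nonneg _)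
  rw [sq_abs]; nlinarith [sq_nonneg ε]

theorem mul_smoothSign_nonneg (ε s : ℝ) : 0 ≤ s * smoothSign ε s := by
  rw [smoothSign, ← mul_div_assoc]
  exact div_nonneg (mul_self_nonneg s) (Real.sqrt_nonneg _)

theorem mul_smoothSign_le {ε : ℝ} (hε : 0 < ε) (s : ℝ) :
    s * smoothSign ε s ≤ smoothAbs ε s + ε := by
  have hp := sqrt_sq_add_pos hε s
  rw [smoothAbs, sub_add_cancel, smoothSign, ← mul_div_assoc, div_le_iff₀ hp,
    Real.mul_self_sqrt (by positivity)]
  nlinarith [sq_nonneg ε]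

theorem sq_mul_smoothDelta_le {ε : ℝ} (hε : 0 < ε) (s : ℝ) : s ^ 2 * smoothDelta ε s ≤ ε := by
  have hp := sqrt_sq_add_pos hε s
  have h1 := le_sqrt_sq_add (ε := ε) s
  rw [smoothDelta, ← mul_div_assoc, div_le_iff₀ (by positivity)]
  have : s ^ 2 * ε ^ 2 ≤ ε * ((s ^ 2 + ε ^ 2) * ε) := by nlinarith [sq_nonneg s, sq_nonneg (ε ^ 2)]
  refine this.trans ?_
  gcongr

/-- A second order Taylor bound, from the concavity of the square root. -/
theorem smoothAbs_sub_le {ε : ℝ} (hε : 0 < ε) (a b : ℝ) :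
    smoothAbs ε b - smoothAbs ε a ≤ smoothSign ε a * (b - a) + 1 / (2 * ε) * (b - a) ^ 2 := by
  have hp := sqrt_sq_add_pos hε a
  have hA : √(a ^ 2 + ε ^ 2) ^ 2 = a ^ 2 + ε ^ 2 := Real.sq_sqrt (by positivity)
  have hB : √(b ^ 2 + ε ^ 2) ^ 2 = b ^ 2 + ε ^ 2 := Real.sq_sqrt (by positivity)
  have h1 := le_sqrt_sq_add (ε := ε) a
  have h2 : 1 / (2 * √(a ^ 2 + ε ^ 2)) ≤ 1 / (2 * ε) := by gcongr
  have h3 := mul_le_mul_of_nonneg_right h2 (sq_nonneg (b - a))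
  have h4 : √(b ^ 2 + ε ^ 2) - √(a ^ 2 + ε ^ 2) ≤
      a / √(a ^ 2 + ε ^ 2) * (b - a) + 1 / (2 * √(a ^ 2 + ε ^ 2)) * (b - a) ^ 2 := by
    rw [show a / √(a ^ 2 + ε ^ 2) * (b - a) + 1 / (2 * √(a ^ 2 + ε ^ 2)) * (b - a) ^ 2 =
      (b ^ 2 - a ^ 2) / (2 * √(a ^ 2 + ε ^ 2)) by field_simp; ring, le_div_iff₀ (by positivity)]
    nlinarith [sq_nonneg (√(b ^ 2 + ε ^ 2) - √(a ^ 2 + ε ^ 2))]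
  simp only [smoothAbs, smoothSign]
  linarith

theorem lipschitzWith_of_hasDerivAt {φ φ' : ℝ → ℝ} (hφ : ∀ x, HasDerivAt φ (φ' x) x) {K : NNReal}
    (hK : ∀ x, |φ' x| ≤ K) : LipschitzWith K φ :=
  lipschitzWith_of_nnnorm_deriv_le (fun x => (hφ x).differentiableAt) fun x => by
    rw [(hφ x).deriv]; exact hK x

theorem lipschitzWith_smoothAbs {ε : ℝ} (hε : 0 < ε) : LipschitzWith 1 (smoothAbs ε) :=
  lipschitzWith_of_hasDerivAt (hasDerivAt_smoothAbs hε) fun x => by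
    simpa using abs_smoothSign_le ε x

theorem lipschitzWith_smoothSign {ε : ℝ} (hε : 0 < ε) :
    LipschitzWith (Real.toNNReal (1 / ε)) (smoothSign ε) :=
  lipschitzWith_of_hasDerivAt (hasDerivAt_smoothSign hε) fun x => by
    have h1 := le_sqrt_sq_add (ε := ε) x
    rw [abs_of_nonneg (smoothDelta_nonneg ε x), Real.coe_toNNReal _ (by positivity), smoothDelta,
      div_le_div_iff₀ (by positivity) hε, one_mul]
    have : ε ^ 2 ≤ x ^ 2 + ε ^ 2 := by nlinarith [sq_nonneg x]
    gcongr

/-! ### Composition in `H¹₀(0,1)` -/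

/-- The chain rule for functions given as integrals. -/
theorem comp_eq_integral {F g φ φ' : ℝ → ℝ} {a b : ℝ} (hab : a ≤ b)
    (hg : IntervalIntegrable g volume a b)
    (hF : ∀ t ∈ Set.Icc a b, F t = F a + ∫ s in a..t, g s)
    (hφ : ∀ x, HasDerivAt φ (φ' x) x) {K : NNReal} (hK : LipschitzWith K φ) :
    ∀ t ∈ Set.Icc a b, φ (F t) = φ (F a) + ∫ s in a..t, φ' (F s) * g s := by
  intro t ht
  obtain ⟨hF1, hF2⟩ := ac_of_eq_integral hab hg hF
  have hac : AbsolutelyContinuousOnInterval (fun s => φ (F s)) a b := by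
    refine squeeze_zero (fun E => Finset.sum_nonneg fun i _ => dist_nonneg) (fun E => ?_)
      (hF1.const_mul K)
    refine Finset.sum_le_sum fun i _ => (hK.dist_le_mul _ _).trans (le_of_eq ?_)
    simp only [Real.dist_eq, ← mul_sub, abs_mul, NNReal.abs_eq]
  have hac' := hac.mono (c := a) (d := t) (by
    rw [Set.uIcc_of_le ht.1, Set.uIcc_of_le hab]; exact Set.Icc_subset_Icc_right ht.2)
  have e : ∫ s in a..t, φ' (F s) * g s = ∫ s in a..t, deriv (fun s => φ (F s)) s := by
    rw [intervalIntegral.integral_of_le ht.1, intervalIntegral.integral_of_le ht.1,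
      integral_Ioc_eq_integral_Ioo, integral_Ioc_eq_integral_Ioo]
    refine integral_congr_ae ((ae_restrict_iff' measurableSet_Ioo).2 ?_)
    filter_upwards [hF2] with s h1 hs
    exact ((hφ (F s)).comp s (h1 ⟨hs.1, hs.2.trans_le ht.2⟩)).deriv.symm
  rw [e, hac'.integral_deriv_eq_sub]
  ring

/-- If `W` belongs to `H¹₀(0,1)` and `φ(0) = 0` then `φ(W) ψ` belongs to `H¹₀(0,1)`, and its weak
derivative is given by the chain and product rules. -/
theorem H10.exists_comp_mul (W : H10) {φ φ' ψ : ℝ → ℝ} (hφ : ∀ x, HasDerivAt φ (φ' x) x)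
    {K : NNReal} (hK : LipschitzWith K φ) (hφ' : Continuous φ') (h0 : φ 0 = 0)
    (hψ : ContDiff ℝ 1 ψ) :
    ∃ Y : H10, toL2 Y =ᵐ[μI] (fun x => φ (toL2 W x) * ψ x) ∧
      dx Y =ᵐ[μI] fun x => φ' (toL2 W x) * dx W x * ψ x + φ (toL2 W x) * deriv ψ x := by
  have hcψ' : Continuous (deriv ψ) := hψ.continuous_deriv le_rfl
  set F := prim (dx W) with hFdef
  have hFc : ContinuousOn F (Set.Icc 0 1) := continuousOn_prim (dx W)
  have hdW := L2.intervalIntegrable (dx W)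
  have hφF := comp_eq_integral zero_le_one hdW (fun t _ => prim_eq (dx W) t) hφ hK
  have hc1 : ContinuousOn (fun x => φ' (F x)) (Set.Icc 0 1) := hφ'.comp_continuousOn hFc
  have hc0 : ContinuousOn (fun x => φ (F x)) (Set.Icc 0 1) := hK.continuous.comp_continuousOn hFc
  have hi1 : IntervalIntegrable (fun x => φ' (F x) * dx W x) volume 0 1 :=
    hdW.continuousOn_mul (by rwa [Set.uIcc_of_le zero_le_one])
  have hψi : ∀ t ∈ Set.Icc (0 : ℝ) 1, ψ t = ψ 0 + ∫ s in (0 : ℝ)..t, deriv ψ s := fun t _ => by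
    rw [intervalIntegral.integral_eq_sub_of_hasDerivAt
      (fun x _ => (hψ.differentiable (by simp) x).hasDerivAt) (hcψ'.intervalIntegrable _ _)]
    ring
  set g : ℝ → ℝ := fun x => φ' (F x) * dx W x * ψ x + φ (F x) * deriv ψ x with hg
  have hprod : ∀ t ∈ Set.Icc (0 : ℝ) 1, ∫ x in (0 : ℝ)..t, g x = φ (F t) * ψ t := fun t ht => by
    have hsub : Set.Icc 0 t ⊆ Set.Icc 0 1 := Set.Icc_subset_Icc_right ht.2
    have := integral_mul_add_mul ht.1 (hi1.mono_set (by
      rw [Set.uIcc_of_le ht.1, Set.uIcc_of_le zero_le_one]; exact hsub))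
      (hcψ'.intervalIntegrable 0 t) (fun s hs => hφF s (hsub hs)) (fun s hs => hψi s (hsub hs))
    rw [hg, this, hFdef, prim_zero_right, h0]; ring
  have hmem : MemLp g 2 μI := by
    have hm : ∀ {z : ℝ → ℝ}, ContinuousOn z (Set.Icc 0 1) → AEStronglyMeasurable z μI := fun hz =>
      (hz.mono Set.Ioo_subset_Icc_self).aestronglyMeasurable measurableSet_Ioo
    have hc2 := hc1.mul hψ.continuous.continuousOn
    have hc3 := hc0.mul hcψ'.continuousOn
    obtain ⟨B, hB⟩ := isCompact_Icc.exists_bound_of_continuousOn hc2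
    obtain ⟨B', hB'⟩ := isCompact_Icc.exists_bound_of_continuousOn hc3
    refine MemLp.add (f := fun x => φ' (F x) * dx W x * ψ x) ?_
      (memLp_of_bound (hm hc3) B' (fun x hx => hB' x (Set.Ioo_subset_Icc_self hx)) 2)
    refine (Lp.memLp (dx W)).of_le_mul (c := B) (((hm hc1).mul (Lp.aestronglyMeasurable _)).mul
      hψ.continuous.aestronglyMeasurable) (ae_unitInterval fun x hx => ?_)
    have := hB x (Set.Ioo_subset_Icc_self hx)
    rw [show φ' (F x) * dx W x * ψ x = φ' (F x) * ψ x * dx W x by ring, norm_mul]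
    exact mul_le_mul_of_nonneg_right this (norm_nonneg _)
  have hprim : ∀ t ∈ Set.Icc (0 : ℝ) 1, prim (hmem.toLp g) t = φ (F t) * ψ t := fun t ht => by
    rw [prim, intervalIntegral_congr_μI hmem.coeFn_toLp ht, hprod t ht]
  obtain ⟨Y, hY1, hY2⟩ := H10.exists_dx_eq (hmem.toLp g) (by
    rw [← prim_one_right, hprim 1 (by simp), hFdef, H10.prim_dx_one, h0, zero_mul])
  refine ⟨Y, ?_, ?_⟩
  · rw [hY1]
    refine (coeFn_primL _).trans ?_
    filter_upwards [H10.coeFn_toL2 W, ae_unitInterval fun x hx =>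
      hprim x (Set.Ioo_subset_Icc_self hx)] with x h1 h2
    rw [h2, h1]
  · rw [hY2]
    refine hmem.coeFn_toLp.trans ?_
    filter_upwards [H10.coeFn_toL2 W] with x h1
    rw [h1]

/-! ### Contraction in a weighted `L¹` norm -/

/-- The pointwise inequality behind the contraction: `w` and `p` are the values of the difference of
two solutions and of its derivative, `a` is the mean of the two solutions, `E = e^{(M+1)x}`, and the
weight is `Q - E`. The quadratic term in `p` absorbs the cross term, and the second derivative of
the weight dominates `M` times the first. -/
theorem dissipation_pointwise {ε M Q E w p a : ℝ} (hε : 0 < ε) (hM : 0 ≤ M) (ha : |a| ≤ M)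
    (hE : 1 ≤ E) (hEQ : E + 1 ≤ Q) :
    -(p * (smoothDelta ε w * p * (Q - E) + smoothSign ε w * (-((M + 1) * E)))) +
      a * w * (smoothDelta ε w * p * (Q - E) + smoothSign ε w * (-((M + 1) * E))) +
      (smoothSign ε w * p * (-((M + 1) * E)) + smoothAbs ε w * (-((M + 1) ^ 2 * E))) ≤
    -(1 / Q) * (smoothAbs ε w * (Q - E)) + (M ^ 2 * Q / 4 + M * (M + 1) * Q) * ε := by
  have hd := smoothDelta_nonneg ε w
  have hwd := sq_mul_smoothDelta_le hε w
  have hn := smoothAbs_nonneg (ε := ε) w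
  have hs0 := mul_smoothSign_nonneg ε w
  have hs1 := mul_smoothSign_le hε w
  have hψ : 0 < Q - E := by linarith
  have hQ : 0 < Q := by linarith
  have h1 : -(smoothDelta ε w * p ^ 2 * (Q - E)) + a * w * smoothDelta ε w * p * (Q - E) ≤
      M ^ 2 * Q / 4 * ε := by
    have e1 : -(smoothDelta ε w * p ^ 2 * (Q - E)) + a * w * smoothDelta ε w * p * (Q - E) ≤
        a ^ 2 / 4 * (w ^ 2 * smoothDelta ε w) * (Q - E) := by
      nlinarith [mul_nonneg (mul_nonneg hd hψ.le) (sq_nonneg (p - a * w / 2))]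
    have e2 : a ^ 2 ≤ M ^ 2 := by rw [← sq_abs a]; exact pow_le_pow_left₀ (abs_nonneg _) ha 2
    have e3 : a ^ 2 / 4 * (w ^ 2 * smoothDelta ε w) * (Q - E) ≤ M ^ 2 / 4 * ε * Q := by
      gcongr
      linarith
    linarith
  have h2 : -(a * (w * smoothSign ε w) * ((M + 1) * E)) ≤
      M * (smoothAbs ε w + ε) * ((M + 1) * E) := by
    have e1 : -a * (w * smoothSign ε w) ≤ M * (smoothAbs ε w + ε) :=
      (mul_le_mul_of_nonneg_right ((neg_le_abs a).trans ha) hs0).trans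
        (mul_le_mul_of_nonneg_left hs1 hM)
    have := mul_le_mul_of_nonneg_right e1 (by positivity : 0 ≤ (M + 1) * E)
    linarith
  have h3 : M * ε * ((M + 1) * E) ≤ M * (M + 1) * Q * ε := by
    have : M * (M + 1) * ε * E ≤ M * (M + 1) * ε * Q := by gcongr; linarith
    linarith
  have h4 : 1 / Q * (smoothAbs ε w * (Q - E)) ≤ (M + 1) * E * smoothAbs ε w := by
    have e1 : (Q - E) / Q ≤ 1 := (div_le_one hQ).2 (by linarith)
    have e2 : 1 ≤ (M + 1) * E := by nlinarith
    have e3 := mul_le_mul_of_nonneg_right (e1.trans e2) hn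
    calc 1 / Q * (smoothAbs ε w * (Q - E)) = (Q - E) / Q * smoothAbs ε w := by ring
      _ ≤ _ := e3
  nlinarith

theorem integrable_smoothAbs_mul {ε : ℝ} (hε : 0 < ε) (w : L2) {ψ : ℝ → ℝ} (hψ : Continuous ψ) :
    Integrable (fun x => smoothAbs ε (w x) * ψ x) μI := by
  simp only [mul_comm _ (ψ _)]
  refine integrable_continuous_mul ?_ hψ
  refine (L2.integrable w).mono
    ((continuous_smoothAbs ε).comp_aestronglyMeasurable (Lp.aestronglyMeasurable _)) ?_
  refine Eventually.of_forall fun x => ?_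
  rw [Real.norm_eq_abs, abs_of_nonneg (smoothAbs_nonneg _)]
  exact smoothAbs_le_abs hε _

/-- The differential inequality in integrated form. The right side of the equation for the difference
`U - V`, tested with `η'(U - V) ψ` where `η` is the smooth absolute value and `ψ = Q - e^{(M+1)x}`, is at
most `-1/Q` times the weighted norm, up to an error of order `ε`. Neither the weight nor the constants
depend on `ε`. -/
theorem exists_dissipation {M : ℝ} (hM : 0 ≤ M) : ∃ (ψ : ℝ → ℝ) (Q c : ℝ), 0 < Q ∧ 0 ≤ c ∧
    Continuous ψ ∧ (∀ x ∈ Set.Ioo (0 : ℝ) 1, 1 ≤ ψ x ∧ ψ x ≤ Q) ∧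
    ∀ U V : H10, ‖dx U‖ ≤ M → ‖dx V‖ ≤ M → ∀ ε, 0 < ε → ∃ Y : H10,
      toL2 Y =ᵐ[μI] (fun x => smoothSign ε (toL2 (U - V) x) * ψ x) ∧
      -inner ℝ (dx (U - V)) (dx Y) + 1 / 2 * inner ℝ (sqL U - sqL V) (dx Y) ≤
        -(1 / Q) * (∫ x, smoothAbs ε (toL2 (U - V) x) * ψ x ∂μI) + c * ε := by
  set Q := Real.exp (M + 1) + 1 with hQ
  have hQ0 : 0 < Q := by positivity
  set ψ : ℝ → ℝ := fun x => Q - Real.exp ((M + 1) * x) with hψ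
  set ψ₁ : ℝ → ℝ := fun x => -((M + 1) * Real.exp ((M + 1) * x)) with hψ₁
  have hd0 : ∀ x, HasDerivAt (fun x => Real.exp ((M + 1) * x))
      ((M + 1) * Real.exp ((M + 1) * x)) x := fun x => by
    have := ((hasDerivAt_id x).const_mul (M + 1)).exp
    refine this.congr_deriv ?_
    simp only [id]; ring
  have hd1 : deriv ψ = ψ₁ := funext fun x => ((hd0 x).const_sub Q).deriv
  have hd2 : deriv ψ₁ = fun x => -((M + 1) ^ 2 * Real.exp ((M + 1) * x)) := funext fun x => by
    exact ((((hd0 x).const_mul (M + 1)).fun_neg).congr_deriv (by ring)).deriv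
  have hE : ∀ x ∈ Set.Ioo (0 : ℝ) 1, 1 ≤ Real.exp ((M + 1) * x) ∧
      Real.exp ((M + 1) * x) + 1 ≤ Q := fun x hx => by
    refine ⟨Real.one_le_exp (by have := hx.1; positivity), ?_⟩
    rw [hQ]
    have := hx.2
    gcongr
    nlinarith
  have hψc : ContDiff ℝ 1 ψ := by fun_prop
  have hψ₁c : ContDiff ℝ 1 ψ₁ := by fun_prop
  refine ⟨ψ, Q, M ^ 2 * Q / 4 + M * (M + 1) * Q, hQ0, by positivity, hψc.continuous,
    fun x hx => ⟨?_, ?_⟩, fun U V hU hV ε hε => ?_⟩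
  · have := (hE x hx).2; simp only [hψ]; linarith
  · have := (hE x hx).1; simp only [hψ]; linarith
  obtain ⟨Y, hY1, hY2⟩ := (U - V).exists_comp_mul (hasDerivAt_smoothSign hε)
    (lipschitzWith_smoothSign hε) (continuous_smoothDelta hε) (smoothSign_zero ε) hψc
  -- The integral of the derivative of `η(w) ψ'` vanishes; adding it moves a derivative to `ψ`.
  obtain ⟨Z, -, hZ2⟩ := (U - V).exists_comp_mul (hasDerivAt_smoothAbs hε)
    (lipschitzWith_smoothAbs hε) (continuous_smoothSign hε) (smoothAbs_zero hε) hψ₁c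
  refine ⟨Y, hY1, ?_⟩
  have hZ0 : ∫ x, dx Z x ∂μI = 0 := by
    rw [integral_unitInterval]; exact H10.prim_dx_one Z
  have i1 := L2.integrable_mul (dx (U - V)) (dx Y)
  have i2 := L2.integrable_mul (sqL U - sqL V) (dx Y)
  have i3 := L2.integrable (dx Z)
  have i4 := integrable_smoothAbs_mul hε (toL2 (U - V)) hψc.continuous
  have e : -inner ℝ (dx (U - V)) (dx Y) + 1 / 2 * inner ℝ (sqL U - sqL V) (dx Y) =
      ∫ x, (-(dx (U - V) x * dx Y x) + 1 / 2 * ((sqL U - sqL V : L2) x * dx Y x) + dx Z x) ∂μI := by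
    rw [integral_add (i1.fun_neg.fun_add (i2.const_mul _)) i3, integral_add i1.fun_neg (i2.const_mul _),
      integral_neg, integral_const_mul, hZ0, inner_eq_integral, inner_eq_integral, add_zero]
  have e' : -(1 / Q) * (∫ x, smoothAbs ε (toL2 (U - V) x) * ψ x ∂μI) +
      (M ^ 2 * Q / 4 + M * (M + 1) * Q) * ε = ∫ x, (-(1 / Q) * (smoothAbs ε (toL2 (U - V) x) * ψ x) +
        (M ^ 2 * Q / 4 + M * (M + 1) * Q) * ε) ∂μI := by
    rw [integral_add (i4.const_mul _) (integrable_const _), integral_const_mul, integral_const]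
    simp
  rw [e, e']
  refine integral_mono_ae ((i1.fun_neg.fun_add (i2.const_mul _)).add i3)
    ((i4.const_mul _).add (integrable_const _)) ?_
  rw [map_sub toL2] at hY2 hZ2 ⊢
  filter_upwards [hY2, hZ2, coeFn_sqL U, coeFn_sqL V, Lp.coeFn_sub (sqL U) (sqL V),
    Lp.coeFn_sub (toL2 U) (toL2 V), U.abs_le_norm_dx, V.abs_le_norm_dx,
    ae_unitInterval hE] with x h1 h2 h3 h4 h5 h6 h7 h8 h9
  have ha : |(toL2 U x + toL2 V x) / 2| ≤ M := by
    rw [abs_div, abs_two]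
    have := abs_add_le (toL2 U x) (toL2 V x)
    linarith
  have key := dissipation_pointwise (p := dx (U - V) x) (w := (toL2 U - toL2 V : L2) x)
    hε hM ha h9.1 h9.2
  rw [h1, h2, h5, Pi.sub_apply, h3, h4, hd1, hd2]
  simp only [hψ, hψ₁]
  refine le_trans (le_of_eq ?_) key
  rw [h6, Pi.sub_apply]
  ring

/-- The second order Taylor bound `smoothAbs_sub_le`, integrated against the weight. -/
theorem weighted_sub_le {ε Q : ℝ} (hε : 0 < ε) {ψ : ℝ → ℝ} (hψ : Continuous ψ)
    (hψb : ∀ x ∈ Set.Ioo (0 : ℝ) 1, 1 ≤ ψ x ∧ ψ x ≤ Q) (w w' y : L2)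
    (hy : y =ᵐ[μI] fun x => smoothSign ε (w x) * ψ x) :
    (∫ x, smoothAbs ε (w' x) * ψ x ∂μI) - (∫ x, smoothAbs ε (w x) * ψ x ∂μI) ≤
      inner ℝ y (w' - w) + Q / (2 * ε) * ‖w' - w‖ ^ 2 := by
  have i1 := integrable_smoothAbs_mul hε w hψ
  have i2 := integrable_smoothAbs_mul hε w' hψ
  have i3 := L2.integrable_mul y (w' - w)
  have i4 := (Lp.memLp (w' - w)).integrable_sq
  rw [← integral_sub i2 i1, inner_eq_integral, L2.norm_sq, ← integral_const_mul,
    ← integral_add i3 (i4.const_mul _)]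
  refine integral_mono_ae (i2.sub i1) (i3.add (i4.const_mul _)) ?_
  filter_upwards [hy, Lp.coeFn_sub w' w, ae_unitInterval hψb] with x h1 h2 h3
  rw [h1, h2, Pi.sub_apply]
  have h4 := mul_le_mul_of_nonneg_right (smoothAbs_sub_le hε (w x) (w' x))
    (zero_le_one.trans h3.1)
  have h5 : 1 / (2 * ε) * (w' x - w x) ^ 2 * ψ x ≤ 1 / (2 * ε) * (w' x - w x) ^ 2 * Q := by
    have := h3.2
    gcongr
  have h6 : Q / (2 * ε) * (w' x - w x) ^ 2 = 1 / (2 * ε) * (w' x - w x) ^ 2 * Q := by ring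
  change smoothAbs ε (w' x) * ψ x - smoothAbs ε (w x) * ψ x ≤ _
  linarith

theorem abs_weighted_sub_le {ε Q : ℝ} (hε : 0 < ε) {ψ : ℝ → ℝ} (hψ : Continuous ψ)
    (hψb : ∀ x ∈ Set.Ioo (0 : ℝ) 1, 1 ≤ ψ x ∧ ψ x ≤ Q) (hQ : 0 < Q) (w w' : L2) :
    |(∫ x, smoothAbs ε (w' x) * ψ x ∂μI) - (∫ x, smoothAbs ε (w x) * ψ x ∂μI)| ≤
      Q * ‖w' - w‖ := by
  rw [← integral_sub (integrable_smoothAbs_mul hε w' hψ) (integrable_smoothAbs_mul hε w hψ)]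
  refine (abs_integral_le_integral_abs).trans ?_
  refine le_trans ?_ (mul_le_mul_of_nonneg_left (integral_abs_le_norm (w' - w)) hQ.le)
  rw [← integral_const_mul]
  refine integral_mono_ae ((integrable_smoothAbs_mul hε w' hψ).sub
    (integrable_smoothAbs_mul hε w hψ)).abs ((L2.integrable _).abs.const_mul _) ?_
  filter_upwards [Lp.coeFn_sub w' w, ae_unitInterval hψb] with x h2 h3
  simp only [h2, Pi.sub_apply, ← sub_mul, abs_mul]
  rw [abs_of_pos (zero_lt_one.trans_le h3.1), mul_comm]
  have := (lipschitzWith_smoothAbs hε).dist_le_mul (w' x) (w x)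
  rw [Real.dist_eq, Real.dist_eq, NNReal.coe_one, one_mul] at this
  exact mul_le_mul h3.2 this (abs_nonneg _) hQ.le

/-- The sine coefficients of an element of `H¹₀(0,1)` are absolutely summable. -/
theorem H10.summable_abs_sc (Y : H10) : Summable fun k : ℕ => |sc (toL2 Y) k| := by
  refine Summable.of_nonneg_of_le (fun k => abs_nonneg _) (fun k => ?_)
    ((H10.hasSum_lam_mul_sq Y).summable.add
      (Real.summable_one_div_nat_pow.2 (one_lt_two)))
  rcases Nat.eq_zero_or_pos k with rfl | hk
  · simp [sc_zero_right, lam]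
  have hk0 : (0 : ℝ) < k := by exact_mod_cast hk
  have h1 : (k : ℝ) ^ 2 ≤ lam k := sq_le_lam k
  have h2 : (k : ℝ) ^ 2 * sc (toL2 Y) k ^ 2 ≤ lam k * sc (toL2 Y) k ^ 2 :=
    mul_le_mul_of_nonneg_right h1 (sq_nonneg _)
  have h3 : |sc (toL2 Y) k| ≤ (k : ℝ) ^ 2 * sc (toL2 Y) k ^ 2 + 1 / (k : ℝ) ^ 2 := by
    have h4 : (k : ℝ) ^ 2 * sc (toL2 Y) k ^ 2 = ((k : ℝ) * |sc (toL2 Y) k|) ^ 2 := by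
      rw [mul_pow, sq_abs]
    have h5 : |sc (toL2 Y) k| = ((k : ℝ) * |sc (toL2 Y) k|) * (1 / k) := by field_simp
    have h6 : 1 / (k : ℝ) ^ 2 = (1 / (k : ℝ)) ^ 2 := by rw [div_pow, one_pow]
    rw [h4, h6]
    nlinarith [sq_nonneg ((k : ℝ) * |sc (toL2 Y) k| - 1 / k), sq_nonneg ((k : ℝ) * |sc (toL2 Y) k|),
      sq_nonneg (1 / (k : ℝ))]
  linarith

/-- The difference of two solutions tested with `Y`, in terms of sine coefficients. -/
theorem hasSum_sc_mul_difference (U V Y : H10) :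
    HasSum (fun k : ℕ => sc (toL2 Y) k *
      (bf (toL2 U) k - bf (toL2 V) k - lam k * sc (toL2 U - toL2 V) k))
      (-inner ℝ (dx (U - V)) (dx Y) + 1 / 2 * inner ℝ (sqL U - sqL V) (dx Y)) := by
  have h1 := ((innerSL ℝ (dx (U - V))).comp dx).hasSum (H10.hasSum_sineH Y)
  have h2 := (hasSum_bf_mul_sc U Y).sub (hasSum_bf_mul_sc V Y)
  have e : -inner ℝ (dx (U - V)) (dx Y) + 1 / 2 * inner ℝ (sqL U - sqL V) (dx Y) =
      -convection U Y - -convection V Y - ((innerSL ℝ (dx (U - V))).comp dx) Y := by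
    rw [convection_eq, convection_eq, inner_sub_left]
    simp only [ContinuousLinearMap.comp_apply, innerSL_apply_apply]
    ring
  rw [e]
  refine (h2.sub h1).congr_fun fun k => ?_
  simp only [ContinuousLinearMap.comp_apply, map_smul, innerSL_apply_apply, smul_eq_mul]
  rw [real_inner_comm, inner_dx_sineH, map_sub toL2]
  ring

section Evolution

variable {f : ℝ → L2} {F s T D : ℝ} {u v : ℝ → L2}

/-- The difference of two solutions satisfies an equation without force, coefficientwise. -/
theorem sc_sub_eq_integral (hf : IsForce f F) (hu : IsMild f id s u) (hv : IsMild f id s v)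
    (k : ℕ) {a b : ℝ} (ha : s ≤ a) (hab : a ≤ b) :
    sc (u b - v b) k - sc (u a - v a) k =
      ∫ r in a..b, (bf (u r) k - bf (v r) k - lam k * sc (u r - v r) k) := by
  have hi : ∀ {z : ℝ → L2}, IsMild f id s z → IntervalIntegrable
      (fun r => sc (f r) k + bf (id (z r)) k - lam k * sc (z r) k) volume a b := fun hz =>
    (hz.intervalIntegrable hf isTrunc_id k ha hab).sub (((hz.continuousOn_sc k).mono fun _ hr =>
      ha.trans hr.1).intervalIntegrable_of_Icc hab |>.const_mul _)
  rw [sc_sub, sc_sub, hu.integral_eq hf isTrunc_id k ha hab, hv.integral_eq hf isTrunc_id k ha hab]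
  have := intervalIntegral.integral_sub (hi hu) (hi hv)
  rw [add_sub_add_comm, add_sub_cancel_left, ← this]
  refine intervalIntegral.integral_congr fun r _ => ?_
  simp only [sc_sub, id]; ring

/-- The coefficients of the right side of the equation for the difference of two solutions are bounded
uniformly in `k`, on functions with uniformly decaying coefficients. -/
theorem exists_abs_difference_le (hD : 0 ≤ D) : ∃ B : ℝ, 0 ≤ B ∧ ∀ u v : L2, u ∈ decaySet D →
    v ∈ decaySet D → ∀ k : ℕ, |bf u k - bf v k - lam k * sc (u - v) k| ≤ B := by
  obtain ⟨M, hM, h⟩ := exists_abs_bf_le_of_mem_decaySet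
  refine ⟨2 * (M * D ^ 2) + 2 * (Real.pi ^ 2 * D), by positivity, fun u v hu hv k => ?_⟩
  rcases Nat.eq_zero_or_pos k with rfl | hk
  · simp only [Nat.cast_zero, bf_zero_right, sc_zero_right]
    simp only [sub_self, mul_zero, abs_zero]; positivity
  have hk1 : (1 : ℝ) ≤ k := by exact_mod_cast hk
  have hb : ∀ w, w ∈ decaySet D → |bf w k| ≤ M * D ^ 2 := fun w hw =>
    (h D w hw k).trans (div_le_self (by positivity) hk1)
  have hs : ∀ w, w ∈ decaySet D → |lam k * sc w k| ≤ Real.pi ^ 2 * D := fun w hw => by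
    rw [abs_mul, abs_of_nonneg (lam_nonneg _)]
    refine (mul_le_mul (lam_le k) (hw k) (abs_nonneg _) (by positivity)).trans (le_of_eq ?_)
    field_simp
  have h1 := hb u hu
  have h2 := hb v hv
  have h3 := hs u hu
  have h4 := hs v hv
  rw [sc_sub, mul_sub]
  rw [abs_le] at *
  constructor <;> linarith [h1.1, h1.2, h2.1, h2.2, h3.1, h3.2, h4.1, h4.2]

/-- The upper right derivative of the regularised weighted `L¹` norm of a difference of solutions is
at most the value of the equation tested with `η'(w) ψ`. -/
theorem frequently_slope_lt (hf : IsForce f F) (hu : IsMild f id s u) (hv : IsMild f id s v)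
    (hD : 0 ≤ D) (huv : ∀ t ∈ Set.Icc s T, u t ∈ decaySet D ∧ v t ∈ decaySet D) {ε Q : ℝ}
    (hε : 0 < ε) {ψ : ℝ → ℝ} (hψ : Continuous ψ)
    (hψb : ∀ x ∈ Set.Ioo (0 : ℝ) 1, 1 ≤ ψ x ∧ ψ x ≤ Q) {t : ℝ} (ht : t ∈ Set.Ico s T) {Y : H10}
    (hY : toL2 Y =ᵐ[μI] fun x => smoothSign ε ((u t - v t : L2) x) * ψ x) {r : ℝ}
    (hr : -inner ℝ (dx (lift (u t) - lift (v t))) (dx Y) +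
      1 / 2 * inner ℝ (sqL (lift (u t)) - sqL (lift (v t))) (dx Y) < r) :
    ∃ᶠ z in 𝓝[>] t, (z - t)⁻¹ * ((∫ x, smoothAbs ε ((u z - v z : L2) x) * ψ x ∂μI) -
      ∫ x, smoothAbs ε ((u t - v t : L2) x) * ψ x ∂μI) < r := by
  obtain ⟨B, hB, hBb⟩ := exists_abs_difference_le hD
  set w : ℝ → L2 := fun t => u t - v t with hw
  set q : ℕ → ℝ → ℝ := fun k r => bf (u r) k - bf (v r) k - lam k * sc (w r) k with hq
  have hqc : ∀ k, ContinuousOn (q k) (Set.Ici s) := fun k =>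
    ((hu.continuousOn_bf isTrunc_id k).sub (hv.continuousOn_bf isTrunc_id k)).sub
      (((continuous_sc k).comp_continuousOn (hu.cont.sub hv.cont)).const_mul _)
  -- `d k` is the difference quotient of coefficient `k`. It is bounded by `B` and tends to the right side
  -- `q k t` of the equation.
  set d : ℕ → ℝ → ℝ := fun k z => (z - t)⁻¹ * (sc (w z) k - sc (w t) k) with hd
  have hnear : ∀ᶠ z in 𝓝[>] t, z ∈ Set.Ioo t T := Ioo_mem_nhdsGT ht.2
  have hdlim : ∀ k, Tendsto (d k) (𝓝[>] t) (𝓝 (q k t)) := fun k => by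
    have hm : Set.Ici s ∈ 𝓝[>] t := by
      filter_upwards [hnear] with z hz using ht.1.trans hz.1.le
    have h1 : HasDerivWithinAt (fun z => ∫ r in t..z, q k r) (q k t) (Set.Ioi t) t :=
      (intervalIntegral.integral_hasDerivWithinAt_right IntervalIntegrable.refl (s := Set.Ici t)
        (t := Set.Ioi t)
        ⟨Set.Ici s, hm, (hqc k).aestronglyMeasurable measurableSet_Ici⟩
        ((hqc k t ht.1).mono (Set.Ioi_subset_Ici ht.1))).mono Set.Ioi_subset_Ici_self
    rw [hasDerivWithinAt_iff_tendsto_slope' (by simp)] at h1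
    refine h1.congr' ?_
    filter_upwards [hnear] with z hz
    rw [slope_def_field, intervalIntegral.integral_same, sub_zero, hd, div_eq_inv_mul]
    simp only [hw]
    rw [sc_sub_eq_integral hf hu hv k ht.1 hz.1.le]
  have hdb : ∀ᶠ z in 𝓝[>] t, ∀ k, |d k z| ≤ B := by
    filter_upwards [hnear] with z hz k
    have hz0 : 0 < z - t := sub_pos.2 hz.1
    have := intervalIntegral.norm_integral_le_of_norm_le_const (a := t) (b := z) (C := B)
      (f := q k) (fun r hr => by
        rw [Set.uIoc_of_le hz.1.le] at hr
        have hm := huv r ⟨ht.1.trans hr.1.le, hr.2.trans hz.2.le⟩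
        exact hBb _ _ hm.1 hm.2 k)
    simp only [hd, hw]
    rw [sc_sub_eq_integral hf hu hv k ht.1 hz.1.le, abs_mul, abs_inv, abs_of_pos hz0,
      inv_mul_le_iff₀ hz0, mul_comm]
    rwa [Real.norm_eq_abs, abs_of_pos hz0] at this
  have hwb : ∀ᶠ z in 𝓝[>] t, ∀ k : ℕ, |sc (w z) k - sc (w t) k| ≤ 4 * D * (1 / (k : ℝ) ^ 2) := by
    filter_upwards [hnear] with z hz k
    have h1 := huv z ⟨ht.1.trans hz.1.le, hz.2.le⟩
    have h2 := huv t ⟨ht.1, ht.2.le⟩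
    have e : 4 * D * (1 / (k : ℝ) ^ 2) = 4 * (D / (k : ℝ) ^ 2) := by ring
    have a1 := abs_le.1 (h1.1 k)
    have a2 := abs_le.1 (h1.2 k)
    have a3 := abs_le.1 (h2.1 k)
    have a4 := abs_le.1 (h2.2 k)
    rw [e]
    simp only [hw, sc_sub]
    rw [abs_le]
    constructor <;> linarith [a1.1, a1.2, a2.1, a2.2, a3.1, a3.2, a4.1, a4.2]
  have hws : Summable fun k : ℕ => 4 * D * (1 / (k : ℝ) ^ 2) :=
    (Real.summable_one_div_nat_pow.2 one_lt_two).mul_left _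
  have hw0 : ∀ k : ℕ, Tendsto (fun z => sc (w z) k - sc (w t) k) (𝓝[>] t) (𝓝 0) := fun k => by
    have h1 : ContinuousWithinAt (fun z => sc (w z) k) (Set.Ioi t) t :=
      (((continuous_sc k).comp_continuousOn (hu.cont.sub hv.cont)) t ht.1).mono
        (Set.Ioi_subset_Ici ht.1)
    simpa using h1.tendsto.sub_const (sc (w t) k)
  -- The linear part of the Taylor expansion converges to the tested equation, because the coefficients of
  -- `Y` are absolutely summable.
  have hlim1 := tendsto_tsum_of_dominated_convergence (𝓕 := 𝓝[>] t)
    (f := fun z (k : ℕ) => sc (toL2 Y) k * d k z) (g := fun k => sc (toL2 Y) k * q k t)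
    ((H10.summable_abs_sc Y).mul_right B) (fun k => (hdlim k).const_mul _) (by
      filter_upwards [hdb] with z hz k
      rw [norm_mul]
      exact mul_le_mul_of_nonneg_left (hz k) (abs_nonneg _))
  -- The quadratic remainder, divided by `z - t`, vanishes in the limit.
  have hlim2 := tendsto_tsum_of_dominated_convergence (𝓕 := 𝓝[>] t)
    (f := fun z (k : ℕ) => d k z * (sc (w z) k - sc (w t) k)) (g := fun _ => 0)
    (hws.mul_left B) (fun k => by simpa using (hdlim k).mul (hw0 k)) (by
      filter_upwards [hdb, hwb] with z hz hz' k
      rw [norm_mul]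
      exact mul_le_mul (hz k) (hz' k) (abs_nonneg _) hB)
  have hU := toL2_lift_of_mem (huv t ⟨ht.1, ht.2.le⟩).1
  have hV := toL2_lift_of_mem (huv t ⟨ht.1, ht.2.le⟩).2
  have hsum := hasSum_sc_mul_difference (lift (u t)) (lift (v t)) Y
  rw [hU, hV] at hsum
  rw [hsum.tsum_eq] at hlim1
  have hlim := hlim1.add (hlim2.const_mul (Q / (2 * ε)))
  rw [tsum_zero, mul_zero, add_zero] at hlim
  refine Eventually.frequently ?_
  filter_upwards [hlim.eventually_lt_const hr, hnear] with z hz hzt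
  have hz0 : 0 < z - t := sub_pos.2 hzt.1
  refine lt_of_le_of_lt ?_ hz
  refine (mul_le_mul_of_nonneg_left (weighted_sub_le hε hψ hψb (w t) (w z) _ hY)
    (inv_nonneg.2 hz0.le)).trans (le_of_eq ?_)
  have e1 := (hasSum_sc_mul (toL2 Y) (w z - w t)).mul_left (z - t)⁻¹
  have e2 := (hasSum_sc_sq (w z - w t)).mul_left (z - t)⁻¹
  simp only [sc_sub (w z) (w t)] at e1 e2
  have e3 : ∑' k : ℕ, sc (toL2 Y) k * d k z = (z - t)⁻¹ * inner ℝ (toL2 Y) (w z - w t) := by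
    rw [← e1.tsum_eq]
    refine tsum_congr fun k => ?_
    simp only [hd]; ring
  have e4 : ∑' k : ℕ, d k z * (sc (w z) k - sc (w t) k) = (z - t)⁻¹ * ‖w z - w t‖ ^ 2 := by
    rw [← e2.tsum_eq]
    refine tsum_congr fun k => ?_
    simp only [hd]; ring
  rw [e3, e4]; ring

end Evolution

/-- Contraction: two solutions whose coefficients decay uniformly approach each other
exponentially in `L¹(0,1)`, with constants that depend only on the decay. -/
theorem exists_integral_abs_sub_le {D : ℝ} (hD : 0 ≤ D) : ∃ C δ : ℝ, 0 ≤ C ∧ 0 < δ ∧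
    ∀ (f : ℝ → L2) (F s T : ℝ) (u v : ℝ → L2), IsForce f F → IsMild f id s u → IsMild f id s v →
      (∀ t ∈ Set.Icc s T, u t ∈ decaySet D ∧ v t ∈ decaySet D) → ∀ t ∈ Set.Icc s T,
        ∫ x, |(u t - v t : L2) x| ∂μI ≤ C * Real.exp (-δ * (t - s)) * ‖u s - v s‖ := by
  obtain ⟨ψ, Q, c, hQ, hc, hψ, hψb, H⟩ := exists_dissipation (Real.sqrt_nonneg _ : 0 ≤ decayBound D)
  refine ⟨Q, 1 / Q, hQ.le, by positivity, fun f F s T u v hf hu hv huv t ht => ?_⟩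
  set Φ : ℝ → ℝ → ℝ := fun ε t => ∫ x, smoothAbs ε ((u t - v t : L2) x) * ψ x ∂μI with hΦ
  -- The estimate for the regularised norm, with an error of order `ε`.
  have key : ∀ ε, 0 < ε → ∫ x, |(u t - v t : L2) x| ∂μI ≤
      Q * Real.exp (-(1 / Q) * (t - s)) * ‖u s - v s‖ + (c * Q + 1) * ε := by
    intro ε hε
    have hcont : ContinuousOn (Φ ε) (Set.Icc s T) := by
      have h1 : Continuous fun w : L2 => ∫ x, smoothAbs ε (w x) * ψ x ∂μI := by
        refine (LipschitzWith.of_dist_le_mul (K := Real.toNNReal Q) fun w w' => ?_).continuous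
        rw [Real.dist_eq, dist_eq_norm, Real.coe_toNNReal _ hQ.le]
        exact abs_weighted_sub_le hε hψ hψb hQ w' w
      exact h1.comp_continuousOn ((hu.cont.sub hv.cont).mono Set.Icc_subset_Ici_self)
    have hg := le_gronwallBound_of_liminf_deriv_right_le (δ := Φ ε s) (K := -(1 / Q)) (ε := c * ε)
      (f' := fun t => -(1 / Q) * Φ ε t + c * ε) hcont (fun z hz r hr => by
        have hm := huv z ⟨hz.1, hz.2.le⟩
        have hb : ∀ {w : L2}, w ∈ decaySet D → ‖dx (lift w)‖ ≤ decayBound D := fun hw =>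
          (H10.norm_dx_le _).trans (norm_le_decayBound (by rwa [toL2_lift_of_mem hw]))
        obtain ⟨Y, hY, hYle⟩ := H (lift (u z)) (lift (v z)) (hb hm.1) (hb hm.2) ε hε
        rw [map_sub toL2, toL2_lift_of_mem hm.1, toL2_lift_of_mem hm.2] at hY hYle
        exact frequently_slope_lt hf hu hv hD huv hε hψ hψb hz hY (hYle.trans_lt hr))
      le_rfl (fun _ _ => le_rfl) t ht
    rw [gronwallBound_of_K_ne_0 (neg_ne_zero.2 (by positivity))] at hg
    have h1 : c * ε / -(1 / Q) * (Real.exp (-(1 / Q) * (t - s)) - 1) ≤ c * ε * Q := by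
      have e : c * ε / -(1 / Q) * (Real.exp (-(1 / Q) * (t - s)) - 1) =
        c * ε * Q * (1 - Real.exp (-(1 / Q) * (t - s))) := by field_simp; ring
      rw [e]
      exact mul_le_of_le_one_right (by positivity) (by linarith [Real.exp_pos (-(1 / Q) * (t - s))])
    have h2 : Φ ε s ≤ Q * ‖u s - v s‖ := by
      have := abs_weighted_sub_le hε hψ hψb hQ 0 (u s - v s)
      rw [sub_zero] at this
      have h0 : ∫ x, smoothAbs ε ((0 : L2) x) * ψ x ∂μI = 0 := by
        refine integral_eq_zero_of_ae ?_
        filter_upwards [Lp.coeFn_zero ℝ 2 μI] with x hx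
        rw [hx, Pi.zero_apply, smoothAbs_zero hε, zero_mul]
      rw [h0, sub_zero] at this
      exact (le_abs_self _).trans this
    have h3 : ∫ x, |(u t - v t : L2) x| ∂μI ≤ Φ ε t + ε := by
      have i1 := integrable_smoothAbs_mul hε (u t - v t) hψ
      have e : Φ ε t + ε = ∫ x, (smoothAbs ε ((u t - v t : L2) x) * ψ x + ε) ∂μI := by
        rw [integral_add i1 (integrable_const _), integral_const]; simp [hΦ]
      rw [e]
      refine integral_mono_ae (L2.integrable _).abs (i1.add (integrable_const _)) ?_
      filter_upwards [ae_unitInterval hψb] with x hx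
      refine (abs_le_smoothAbs_add (ε := ε) _).trans ?_
      exact add_le_add_left (le_mul_of_one_le_right (smoothAbs_nonneg _) hx.1) ε
    have h4 := mul_le_mul_of_nonneg_right h2 (Real.exp_pos (-(1 / Q) * (t - s))).le
    linarith
  refine le_of_forall_pos_le_add fun ε hε => ?_
  have hp : 0 < c * Q + 1 := by positivity
  have := key (ε / (c * Q + 1)) (by positivity)
  rwa [mul_div_cancel₀ _ hp.ne'] at this

/-! ### Pullback convergence in `H¹₀(0,1)` -/

theorem abs_sc_le_integral (w : L2) (k : ℤ) : |sc w k| ≤ √2 * ∫ x, |w x| ∂μI := by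
  rw [sc_eq_integral, ← integral_const_mul]
  refine abs_integral_le_integral_abs.trans (integral_mono_of_nonneg
    (Eventually.of_forall fun x => abs_nonneg _) ((L2.integrable w).abs.const_mul _)
    (Eventually.of_forall fun x => ?_))
  simp only [abs_mul, abs_of_nonneg (Real.sqrt_nonneg 2)]
  exact mul_le_mul_of_nonneg_right
    (mul_le_of_le_one_right (Real.sqrt_nonneg 2) (Real.abs_sin_le_one _)) (abs_nonneg _)

theorem norm_le_of_mem_decaySet {D : ℝ} {w : L2} (hw : w ∈ decaySet D) : ‖w‖ ≤ decayBound D := by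
  have h := toL2_lift_of_mem hw
  rw [← h]
  exact (norm_toL2_apply_le _).trans (norm_le_decayBound (by rwa [h]))

/-- On a set with uniformly decaying coefficients, uniform closeness of the coefficients gives
closeness in `H¹₀(0,1)`. -/
theorem exists_norm_sub_le_of_sc (D : ℝ) {ε : ℝ} (hε : 0 < ε) : ∃ η, 0 < η ∧ ∀ U V : H10,
    toL2 U ∈ decaySet D → toL2 V ∈ decaySet D →
      (∀ k : ℕ, |sc (toL2 U - toL2 V) k| ≤ η) → ‖U - V‖ ≤ ε := by
  by_contra! h
  choose U V hU hV hη hUV using fun n : ℕ => h (1 / ((n : ℝ) + 1)) (by positivity)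
  have hlim : Tendsto (fun n => U n - V n) atTop (𝓝 0) := by
    refine H10.tendsto_of_sc (D := D + D) (Eventually.of_forall fun n k => ?_) (fun k => ?_)
      fun k => ?_
    · rw [map_sub, sc_sub, add_div]
      exact (abs_sub _ _).trans (add_le_add (hU n k) (hV n k))
    · have h0 : 0 ≤ D / (k : ℝ) ^ 2 := (abs_nonneg _).trans (hU 0 k)
      rw [map_zero, sc_zero, abs_zero, add_div]; linarith
    · rw [map_zero, sc_zero]
      refine squeeze_zero_norm (fun n => ?_) tendsto_one_div_add_atTop_nhds_zero_nat
      rw [map_sub]; exact hη n k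
  obtain ⟨n, hn⟩ := (hlim.norm.eventually_lt_const (by simpa using hε)).exists
  exact (hUV n).not_gt hn

/-- A bounded set of solutions enters a set of uniformly decaying coefficients, after a time that
depends only on the bound. -/
theorem exists_absorbing (f : ℝ → L2) (F : ℝ) (hf : IsForce f F) : ∃ D, 0 ≤ D ∧ ∀ ρ : ℝ,
    ∃ T₀, 0 ≤ T₀ ∧ ∀ (s : ℝ) (u : ℝ → L2), IsMild f id s u → ‖u s‖ ≤ ρ →
      ∀ t, s + T₀ ≤ t → u t ∈ decaySet D := by
  obtain ⟨D, hD, h⟩ := exists_mem_decaySet (√(F ^ 2 + 1)) F one_pos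
  -- After time `ρ²` the energy estimate gives `‖u‖² ≤ F² + e^{-ρ²} ρ² ≤ F² + 1`; one more unit of time
  -- produces the decay.
  refine ⟨D, hD, fun ρ => ⟨ρ ^ 2 + 1, by positivity, fun s u hu hρ t ht => ?_⟩⟩
  refine h f id (s + ρ ^ 2) t u hf isTrunc_id
    (hu.restart hf isTrunc_id (by nlinarith [sq_nonneg ρ])) (fun r hr => ?_) t
    ⟨by linarith, le_rfl⟩
  refine Real.le_sqrt_of_sq_le ?_
  have hsr : ρ ^ 2 ≤ r - s := by linarith [hr.1]
  refine (hu.norm_sq_le hf isTrunc_id (by nlinarith [sq_nonneg ρ])).trans ?_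
  have h1 : ‖u s‖ ^ 2 ≤ ρ ^ 2 := pow_le_pow_left₀ (norm_nonneg _) hρ 2
  have h2 : Real.exp (-(r - s)) * (r - s) ≤ 1 := by
    rw [Real.exp_neg, inv_mul_le_iff₀ (Real.exp_pos _)]
    linarith [Real.add_one_le_exp (r - s)]
  have h3 := mul_le_mul_of_nonneg_left (h1.trans hsr) (Real.exp_pos (-(r - s))).le
  linarith

/-- Solutions that start in a bounded set of `L²` approach each other in `H¹₀`, uniformly. -/
theorem exists_norm_lift_sub_le {f : ℝ → L2} {F : ℝ} (hf : IsForce f F) (ρ : ℝ) {ε : ℝ}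
    (hε : 0 < ε) : ∃ T, 0 ≤ T ∧ ∀ (s : ℝ) (u v : ℝ → L2), IsMild f id s u → IsMild f id s v →
      ‖u s‖ ≤ ρ → ‖v s‖ ≤ ρ → ∀ t, s + T ≤ t → ‖lift (u t) - lift (v t)‖ ≤ ε := by
  obtain ⟨D, hD, habs⟩ := exists_absorbing f F hf
  obtain ⟨T₀, hT₀, hT⟩ := habs ρ
  obtain ⟨η, hη, hclose⟩ := exists_norm_sub_le_of_sc D hε
  obtain ⟨C, δ, hC, hδ, hcontr⟩ := exists_integral_abs_sub_le hD
  set K := √2 * (C * (decayBound D + decayBound D)) with hK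
  have hB : 0 ≤ decayBound D := Real.sqrt_nonneg _
  have hK0 : 0 ≤ K := by positivity
  have hlim : Tendsto (fun T => K * Real.exp (-δ * T)) atTop (𝓝 0) := by
    have h1 : Tendsto (fun T : ℝ => -δ * T) atTop atBot :=
      tendsto_id.const_mul_atTop_of_neg (neg_neg_of_pos hδ)
    simpa using (Real.tendsto_exp_atBot.comp h1).const_mul K
  obtain ⟨T₁, hT₁, hT₁0⟩ := ((hlim.eventually_lt_const hη).and (eventually_ge_atTop 0)).exists
  refine ⟨T₀ + T₁, by positivity, fun s u v hu hv hus hvs t ht => ?_⟩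
  have hst : s + T₀ ≤ t := by linarith
  have hD' : ∀ r ∈ Set.Icc (s + T₀) t, u r ∈ decaySet D ∧ v r ∈ decaySet D := fun r hr =>
    ⟨hT s u hu hus r hr.1, hT s v hv hvs r hr.1⟩
  have hut := hD' t ⟨hst, le_rfl⟩
  refine hclose _ _ ?_ ?_ fun k => ?_
  · rw [toL2_lift_of_mem hut.1]; exact hut.1
  · rw [toL2_lift_of_mem hut.2]; exact hut.2
  rw [toL2_lift_of_mem hut.1, toL2_lift_of_mem hut.2]
  have h1 := hcontr f F (s + T₀) t u v hf (hu.restart hf isTrunc_id (by linarith))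
    (hv.restart hf isTrunc_id (by linarith)) hD' t ⟨hst, le_rfl⟩
  have hus' := hD' (s + T₀) ⟨le_rfl, hst⟩
  have h2 : ‖u (s + T₀) - v (s + T₀)‖ ≤ decayBound D + decayBound D :=
    (norm_sub_le _ _).trans (add_le_add (norm_le_of_mem_decaySet hus'.1)
      (norm_le_of_mem_decaySet hus'.2))
  have h3 : Real.exp (-δ * (t - (s + T₀))) ≤ Real.exp (-δ * T₁) := by
    refine Real.exp_le_exp.2 ?_
    nlinarith
  refine (abs_sc_le_integral _ _).trans ?_
  calc √2 * ∫ x, |(u t - v t : L2) x| ∂μI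
      ≤ √2 * (C * Real.exp (-δ * T₁) * (decayBound D + decayBound D)) := by
        refine mul_le_mul_of_nonneg_left (h1.trans ?_) (Real.sqrt_nonneg 2)
        gcongr
    _ = K * Real.exp (-δ * T₁) := by rw [hK]; ring
    _ ≤ η := hT₁.le

/-! ### The eternal solution -/

theorem IsMild.congr {f : ℝ → L2} {t₀ : ℝ} {u v : ℝ → L2} (hu : IsMild f id t₀ u)
    (h : ∀ t, t₀ ≤ t → v t = u t) : IsMild f id t₀ v where
  cont := hu.cont.congr h
  eq k t ht := by
    rw [h t ht, h t₀ le_rfl, hu.eq k t ht]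
    congr 1
    refine intervalIntegral.integral_congr fun r hr => ?_
    rw [Set.uIcc_of_le ht] at hr
    simp only [id, h r hr.1]

section Pullback

variable {f : ℝ → L2} {F : ℝ} {S : ℝ → ℝ → L2 → L2}

/-- The process property `S(t,s) S(s,r) = S(t,r)`. -/
theorem process_comp (hf : IsForce f F)
    (hS : ∀ t₀ u₀, IsMild f id t₀ (fun t => S t t₀ u₀) ∧ S t₀ t₀ u₀ = u₀) {r s t : ℝ} (hrs : r ≤ s)
    (hst : s ≤ t) (u₀ : L2) : S t s (S s r u₀) = S t r u₀ :=
  (hS s (S s r u₀)).1.unique hf ((hS r u₀).1.restart hf isTrunc_id hrs) (hS s _).2 hst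

/-- There is a curve in `H¹₀`, bounded and mild on every half-line: the limit of the solutions that
start from `0` at time `-n`. -/
theorem exists_eternal (hf : IsForce f F)
    (hS : ∀ t₀ u₀, IsMild f id t₀ (fun t => S t t₀ u₀) ∧ S t₀ t₀ u₀ = u₀) :
    ∃ u : ℝ →ᵇ H10, ∀ t₀, IsMild f id t₀ fun t => toL2 (u t) := by
  have hF := hf.nonneg
  obtain ⟨D, hD, habs⟩ := exists_absorbing f F hf
  obtain ⟨T₀, hT₀, hT⟩ := habs 0
  set z : ℕ → ℝ → L2 := fun n t => S t (-n) 0 with hz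
  have hzm : ∀ n : ℕ, IsMild f id (-n) (z n) := fun n => (hS _ _).1
  have hz0 : ∀ n : ℕ, z n (-n) = 0 := fun n => (hS _ _).2
  have hzF : ∀ (n : ℕ) (t : ℝ), -n ≤ t → ‖z n t‖ ≤ F := fun n t ht => by
    have := (hzm n).norm_sq_le hf isTrunc_id ht
    rw [hz0, norm_zero] at this
    refine le_of_sq_le_sq ?_ hF
    linarith
  have hzD : ∀ t, ∀ᶠ n : ℕ in atTop, z n t ∈ decaySet D := fun t => by
    filter_upwards [tendsto_natCast_atTop_atTop.eventually_ge_atTop (T₀ - t)] with n hn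
    exact hT _ _ (hzm n) (by rw [hz0, norm_zero]) t (by linarith)
  -- At time `-N` the solutions from `-n ≤ -N` and from `-N` are both bounded by `F`, so they are close at `t`.
  have hcau : ∀ t, CauchySeq fun n => lift (z n t) := fun t => by
    refine Metric.cauchySeq_iff'.2 fun ε hε => ?_
    obtain ⟨T, hT0, hT⟩ := exists_norm_lift_sub_le hf F (half_pos hε)
    obtain ⟨N, hN⟩ := exists_nat_ge (T - t)
    refine ⟨N, fun n hn => ?_⟩
    have hn' : (N : ℝ) ≤ n := by exact_mod_cast hn
    rw [dist_eq_norm]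
    refine (hT (-N) (z n) (z N) ((hzm n).restart hf isTrunc_id (by linarith)) (hzm N)
      (hzF n _ (by linarith)) (hzF N _ le_rfl) t (by linarith)).trans_lt (half_lt_self hε)
  choose U hU using fun t => cauchySeq_tendsto_of_complete (hcau t)
  have hUL : ∀ t, Tendsto (fun n => z n t) atTop (𝓝 (toL2 (U t))) := fun t => by
    refine ((toL2.continuous.tendsto _).comp (hU t)).congr' ?_
    filter_upwards [hzD t] with n hn
    exact toL2_lift_of_mem hn
  have hUD : ∀ t, toL2 (U t) ∈ decaySet D := fun t k => by
    refine le_of_tendsto (((continuous_sc k).tendsto _).comp (hUL t)).abs ?_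
    filter_upwards [hzD t] with n hn using hn k
  have hge : ∀ t : ℝ, ∀ᶠ n : ℕ in atTop, -(n : ℝ) ≤ t := fun t => by
    filter_upwards [tendsto_natCast_atTop_atTop.eventually_ge_atTop (-t)] with n hn
    linarith
  have hUF : ∀ t, ‖toL2 (U t)‖ ≤ F := fun t => by
    refine le_of_tendsto (hUL t).norm ?_
    filter_upwards [hge t] with n hn using hzF n t hn
  -- Continuous dependence on the initial value shows that the limit is again a solution.
  have hUS : ∀ t₀ t, t₀ ≤ t → toL2 (U t) = S t t₀ (toL2 (U t₀)) := fun t₀ t ht => by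
    obtain ⟨γ, hγ⟩ := exists_norm_sub_le (2 * F)
    have hb : ∀ w : L2, ‖w‖ ≤ F → ∀ r ∈ Set.Icc t₀ t, ‖S r t₀ w‖ ≤ 2 * F := fun w hw r hr => by
      have h1 := (hS t₀ w).1.norm_sq_le hf isTrunc_id hr.1
      simp only [(hS t₀ w).2] at h1
      have h2 : ‖w‖ ^ 2 ≤ F ^ 2 := pow_le_pow_left₀ (norm_nonneg _) hw 2
      have h3 : Real.exp (-(r - t₀)) ≤ 1 := Real.exp_le_one_iff.2 (by linarith [hr.1])
      have h4 := mul_le_of_le_one_left (sq_nonneg ‖w‖) h3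
      refine le_of_sq_le_sq ?_ (by positivity)
      nlinarith [sq_nonneg F]
    have hlim : Tendsto (fun n => z n t) atTop (𝓝 (S t t₀ (toL2 (U t₀)))) := by
      rw [tendsto_iff_norm_sub_tendsto_zero]
      have h0 := (tendsto_iff_norm_sub_tendsto_zero.1 (hUL t₀)).const_mul
        (2 * Real.exp (γ * (t - t₀)))
      rw [mul_zero] at h0
      refine squeeze_zero' (Eventually.of_forall fun n => norm_nonneg _) ?_ h0
      filter_upwards [hge t₀] with n hn
      have := hγ f F t₀ t _ _ hf (hS t₀ (z n t₀)).1 (hS t₀ (toL2 (U t₀))).1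
        (hb _ (hzF n _ hn)) (hb _ (hUF t₀)) t ⟨ht, le_rfl⟩
      simp only [(hS t₀ _).2] at this
      rwa [show S t t₀ (z n t₀) = z n t from process_comp hf hS hn ht 0] at this
    exact tendsto_nhds_unique (hUL t) hlim
  have hmild : ∀ t₀, IsMild f id t₀ fun t => toL2 (U t) := fun t₀ =>
    (hS t₀ (toL2 (U t₀))).1.congr fun t ht => hUS t₀ t ht
  have hc : Continuous U := continuous_iff_continuousAt.2 fun t => by
    have := (hmild (t - 1)).continuousOn_lift hf isTrunc_id
    simp only [lift_toL2] at this
    exact this.continuousAt (Ioi_mem_nhds (by linarith))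
  exact ⟨BoundedContinuousFunction.ofNormedAddCommGroup U hc (decayBound D)
    fun t => norm_le_decayBound (hUD t), hmild⟩

/-- Every solution is attracted in the pullback sense by a bounded eternal one. -/
theorem pullbackAttracts_singleton (hf : IsForce f F)
    (hS : ∀ t₀ u₀, IsMild f id t₀ (fun t => S t t₀ u₀) ∧ S t₀ t₀ u₀ = u₀) {u : ℝ →ᵇ H10}
    (hu : ∀ t₀, IsMild f id t₀ fun t => toL2 (u t)) : PullbackAttracts S fun t => {u t} := by
  intro B hB t
  obtain ⟨ρ, hρ⟩ := hB.exists_norm_le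
  constructor
  · obtain ⟨D, hD, habs⟩ := exists_absorbing f F hf
    obtain ⟨T₀, hT₀, hT⟩ := habs ρ
    filter_upwards [eventually_le_atBot (t - T₀)] with t₀ ht₀
    rintro _ ⟨b, hb, rfl⟩
    refine ⟨lift (S t t₀ b), toL2_lift_of_mem (hT t₀ _ (hS t₀ b).1 ?_ t (by linarith))⟩
    rw [(hS t₀ b).2]; exact hρ b hb
  · refine ENNReal.tendsto_nhds_zero.2 fun ε hε => ?_
    obtain ⟨ε', hε', hle⟩ : ∃ ε' : ℝ, 0 < ε' ∧ ENNReal.ofReal ε' ≤ ε := by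
      obtain ⟨e, he, hlt⟩ := ENNReal.lt_iff_exists_nnreal_btwn.1 hε
      exact ⟨e, by exact_mod_cast he, by rw [ENNReal.ofReal_coe_nnreal]; exact hlt.le⟩
    obtain ⟨T, hT0, hT⟩ := exists_norm_lift_sub_le hf (max ρ ‖u‖) hε'
    filter_upwards [eventually_le_atBot (t - T)] with t₀ ht₀
    refine iSup₂_le fun a ha => ?_
    obtain ⟨b, hb, hab⟩ := ha
    rw [Metric.infEDist_singleton, edist_dist, dist_eq_norm]
    refine le_trans (ENNReal.ofReal_le_ofReal ?_) hle
    have := hT t₀ _ _ (hS t₀ b).1 (hu t₀) ?_ ?_ t (by linarith)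
    · rwa [hab, lift_toL2, lift_toL2] at this
    · rw [(hS t₀ b).2]; exact (hρ b hb).trans (le_max_left _ _)
    · exact ((norm_toL2_apply_le _).trans (u.norm_coe_le_norm t₀)).trans (le_max_right _ _)

/-- Two bounded solutions that exist for all time coincide: at any time they have been approaching each
other for arbitrarily long. -/
theorem eq_of_isBounded_range (hf : IsForce f F) {u : ℝ →ᵇ H10}
    (hu : ∀ t₀, IsMild f id t₀ fun t => toL2 (u t)) {v : ℝ → H10}
    (hv : ∀ t₀, IsMild f id t₀ fun t => toL2 (v t)) (hb : Bornology.IsBounded (Set.range v)) :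
    v = u := by
  obtain ⟨ρ, hρ⟩ := hb.exists_norm_le
  funext t
  rw [← sub_eq_zero, ← norm_le_zero_iff]
  refine le_of_forall_pos_le_add fun ε hε => ?_
  obtain ⟨T, hT0, hT⟩ := exists_norm_lift_sub_le hf (max ρ ‖u‖) hε
  have := hT (t - T) _ _ (hv _) (hu _)
    (((norm_toL2_apply_le _).trans (hρ _ ⟨_, rfl⟩)).trans (le_max_left _ _))
    (((norm_toL2_apply_le _).trans (u.norm_coe_le_norm _)).trans (le_max_right _ _)) t (by linarith)
  rwa [lift_toL2, lift_toL2, ← zero_add ε] at this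

/-- The sections of a bounded eternal solution lie in every closed family that pullback attracts
bounded sets, because the solution itself is a bounded set of initial values. -/
theorem mem_of_pullbackAttracts {u : ℝ →ᵇ H10}
    (hu : ∀ t₀ t, t₀ ≤ t → S t t₀ (toL2 (u t₀)) = toL2 (u t)) {C : ℝ → Set H10}
    (hC : ∀ t, IsClosed (C t)) (hatt : PullbackAttracts S C) (t : ℝ) : u t ∈ C t := by
  have hB : Bornology.IsBounded (Set.range fun t => toL2 (u t)) := by
    refine isBounded_iff_forall_norm_le.2 ⟨‖u‖, ?_⟩
    rintro _ ⟨t, rfl⟩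
    exact (norm_toL2_apply_le _).trans (u.norm_coe_le_norm t)
  rw [← (hC t).closure_eq, Metric.mem_closure_iff_infEDist_zero]
  refine le_antisymm (ge_of_tendsto (hatt _ hB t).2 ?_) (zero_le)
  filter_upwards [eventually_le_atBot t] with t₀ ht₀
  exact le_iSup₂_of_le (u t) ⟨toL2 (u t₀), ⟨t₀, rfl⟩, hu t₀ t ht₀⟩ le_rfl

/-- The sections of a pullback attractor lie in `{u t}` by minimality, because `{u t}` attracts. -/
theorem isPullbackAttractor_iff (hf : IsForce f F)
    (hS : ∀ t₀ u₀, IsMild f id t₀ (fun t => S t t₀ u₀) ∧ S t₀ t₀ u₀ = u₀) {u : ℝ →ᵇ H10}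
    (hu : ∀ t₀, IsMild f id t₀ fun t => toL2 (u t)) (A : ℝ → Set H10) :
    IsPullbackAttractor S A ↔ ∀ t, A t = {u t} := by
  have hatt := pullbackAttracts_singleton hf hS hu
  have hinv : ∀ t₀ t, t₀ ≤ t → S t t₀ (toL2 (u t₀)) = toL2 (u t) := fun t₀ t ht =>
    (hS t₀ _).1.unique hf (hu t₀) (hS t₀ _).2 ht
  constructor
  · intro hA t
    exact ((hA.nonempty t).subset_singleton_iff).1
      (hA.minimal _ (fun _ => isClosed_singleton) hatt t)
  · intro hA
    obtain rfl : A = fun t => {u t} := funext hA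
    refine ⟨fun t => Set.singleton_nonempty _, fun t => isCompact_singleton, fun s t hst => ?_,
      hatt, fun C hC hCatt t => ?_⟩
    · simp only [Set.image_singleton, hinv s t hst]
    · exact Set.singleton_subset_iff.2 (mem_of_pullbackAttracts hinv hC hCatt t)

end Pullback

end Burgers

end

theorem mainTheorem1 (f : ℝ → Burgers.L2) (hf : MeasureTheory.MemLp f ⊤ MeasureTheory.volume) :
    ∃ S : ℝ → ℝ → Burgers.L2 → Burgers.L2, Burgers.IsSolutionProcess f S ∧
      ∃ u : BoundedContinuousFunction ℝ Burgers.H10,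
        Burgers.IsEternalSolution f u ∧
        (∀ v : ℝ → Burgers.H10, Burgers.IsEternalSolution f v →
          Bornology.IsBounded (Set.range v) → v = u) ∧
        Burgers.PullbackAttracts S (fun t => {u t}) ∧
        (∀ A : ℝ → Set Burgers.H10,
          Burgers.IsPullbackAttractor S A ↔ ∀ t, A t = {u t}) := by
  obtain ⟨F, hF⟩ := Burgers.exists_isForce hf
  obtain ⟨S, hS, hmild⟩ := Burgers.exists_isSolutionProcess hF
  obtain ⟨u, hu⟩ := Burgers.exists_eternal hF hmild
  exact ⟨S, hS, u, fun t₀ => (hu t₀).isWeakSolution hF,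
    fun v hv hb => Burgers.eq_of_isBounded_range hF hu (fun t₀ => (hv t₀).isMild hF) hb,
    Burgers.pullbackAttracts_singleton hF hmild hu,
    Burgers.isPullbackAttractor_iff hF hmild hu⟩
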